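/- **Setting.** Let $\mathbb T=\mathbb R/L\mathbb Z$ with $L>0$, let $T_0>0$ and $\Phi\in W^{2,\infty}(\mathbb T)$, and put $E=-\partial_x\Phi$, $$\mathcal A u=\sqrt{T_0}\,\partial_x u-\tfrac{E}{2\sqrt{T_0}}u,\qquad \mathcal A^\star u=-\sqrt{T_0}\,\partial_x u-\tfrac{E}{2\sqrt{T_0}}u .$$ For $\varepsilon>0$ and $\tau(\varepsilon)>0$ consider the Hermite form of the Vlasov–Fokker–Planck equation, for $D=(D_k)_{k\in\mathbb N}$, $$\partial_t D_k+\tfrac1\varepsilon\bigl(\sqrt k\,\mathcal A D_{k-1}-\sqrt{k+1}\,\mathcal A^\star D_{k+1}\bigr)=-\tfrac{k}{\tau(\varepsilon)}D_k,\qquad k\ge 0, \tag{1}$$ whose solutions are understood as weak solutions in $C([0,\infty);\ell^2(\mathbb N;L^2(\mathbb T)))$. Let $\|D\|_{L^2}^2=\sum_k\|D_k\|_{L^2(\mathbb T)}^2$, $\|\mathcal B D\|_{L^2}^2=\|\mathcal A D_0\|_{L^2(\mathbb T)}^2+\sum_{k\ge1}\|\mathcal A^\star D_k\|_{L^2(\mathbb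 T)}^2$, $\|D\|_{H^1}^2=\|\mathcal B D\|_{L^2}^2+\|D\|_{L^2}^2$ and $D_\perp=(0,D_1,D_2,\dots)$. Let $\rho_\infty=c_0e^{-\Phi/T_0}$, where $c_0>0$ is fixed by conservation of mass, $\int_{\mathbb T}\rho_\infty\,dx=\int_{\mathbb T}D_0(0)\sqrt{\rho_\infty}\,dx$ (the total mass is assumed to be positive), and let $D_\infty=(\sqrt{\rho_\infty},0,0,\dots)$. For $g\in L^2(\mathbb T)$ with $\int_{\mathbb T} g\sqrt{\rho_\infty}\,dx=0$ let $\|g\|_{H^{-1}}=\|\mathcal A u\|_{L^2(\mathbb T)}$, where $u\in H^2(\mathbb T)$ is the solution of $\mathcal A^\star\mathcal A u=g$, $\int_{\mathbb T} u\sqrt{\rho_\infty}\,dx=0$. **Theorem.** There is a constant $C>0$, depending only on $\Phi$ and $T_0$ (and on the torus), such that the following holds for all $\overline\tau_0>0$, all $\varepsilon_0>0$ and all $\tau:(0,\varepsilon_0]\to(0,\infty)$ with $\tau(\varepsilon)/\varepsilon\le\overline\tau_0$ for every $\varepsilon\in(0,\varepsilon_0]$. Put $\kappa=\dfrac1{C(\overline\tau_0^2+1)}$.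 For every $\varepsilon\in(0,\varepsilon_0]$ let $D$ be a solution of (1) with $\|D(0)\|_{H^1}<\infty$. (i) Suppose that $\tau(\varepsilon)/\varepsilon^2\to\tau_0\in(0,\infty)$ as $\varepsilon\to0$ and that $\bigl|\frac{\tau(\varepsilon)}{\tau_0\varepsilon^2}-1\bigr|\le\frac12$ for all $\varepsilon\in(0,\varepsilon_0]$. Then for all $\varepsilon\in(0,\varepsilon_0]$ and $t\ge0$ $$\|D_\perp(t)\|_{L^2}\le\|D_\perp(0)\|_{L^2}\,e^{-t/(4\tau_0\varepsilon^2)}+\tau_0\,\varepsilon\,C(\overline\tau_0+1)\,\|D(0)-D_\infty\|_{H^1}\,e^{-\tau_0\kappa t}.$$ Moreover, let $D_{\tau_0,0}\in C([0,\infty);L^2(\mathbb T))$ be a weak solution of the drift-diffusion equation $\partial_tD_{\tau_0,0}+\tau_0\mathcal A^\star\mathcal A D_{\tau_0,0}=0$ with $\int_{\mathbb T} D_{\tau_0,0}(0)\sqrt{\rho_\infty}\,dx=\int_{\mathbb T}\rho_\infty\,dx$, and let $D_{\tau_0}=(D_{\tau_0,0},0,0,\dots)$. Then for all $\varepsilon\in(0,\varepsilon_0]$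 and $t\ge0$ the norm $\|D_0(t)-D_{\tau_0,0}(t)\|_{H^{-1}}$ is well defined and $$\begin{aligned}\|D_0(t)-D_{\tau_0,0}(t)\|_{H^{-1}}\le{}& C\Bigl(\|D_0(0)-D_{\tau_0,0}(0)\|_{H^{-1}}+\varepsilon\,\tau_0(\overline\tau_0^3+1)\|D(0)-D_\infty\|_{H^1}\Bigr)e^{-\tau_0\kappa t}\\&+C\Bigl|\tfrac{\tau_0\varepsilon^2}{\tau(\varepsilon)}-1\Bigr|\,\|D_{\tau_0}(0)-D_\infty\|_{L^2}\,e^{-\tau_0\kappa t}.\end{aligned}$$ (ii) Suppose that $\tau(\varepsilon)/\varepsilon^2\to+\infty$ as $\varepsilon\to0$. Then for all $\varepsilon\in(0,\varepsilon_0]$ and $t\ge0$ $$\|D_\perp(t)\|_{L^2}\le\|D_\perp(0)\|_{L^2}\,e^{-t/(2\tau(\varepsilon))}+\tfrac{\tau(\varepsilon)}{\varepsilon}\,C(\overline\tau_0+1)\,\|D(0)-D_\infty\|_{H^1}\,e^{-\frac{\tau(\varepsilon)}{\varepsilon^2}\kappa t},$$ and the norm $\|D_0(t)-D_{\infty,0}\|_{H^{-1}}$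 is well defined and $$\|D_0(t)-D_{\infty,0}\|_{H^{-1}}\le C\Bigl(\|D_0(0)-D_{\infty,0}\|_{H^{-1}}+\tfrac{\tau(\varepsilon)}{\varepsilon}(\overline\tau_0^3+1)\|D(0)-D_\infty\|_{H^1}\Bigr)e^{-\frac{\tau(\varepsilon)}{\varepsilon^2}\kappa t}.$$ -/

import Mathlib

open MeasureTheory Set Filter Topology
open scoped ENNReal

namespace VFP

noncomputable section

/-- `L^p(𝕋)` for the one-dimensional torus `𝕋 = ℝ / Lℤ` with Lebesgue measure. -/
abbrev LpT (L : ℝ) [Fact (0 < L)] (p : ℝ≥0∞) : Type :=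
  Lp ℝ p (volume : Measure (AddCircle L))

/-- `ℓ²(ℕ; L²(𝕋))`, whose norm is `‖D‖² = ∑ₖ ‖Dₖ‖²`. -/
abbrev SeqL2 (L : ℝ) [Fact (0 < L)] : Type :=
  lp (fun _ : ℕ => LpT L 2) 2

variable {L : ℝ} [Fact (0 < L)]

/-! ### Weak derivatives on the torus -/

/-- Smooth test functions on the torus (their lift to `ℝ` is `C^∞`). -/
def IsTest (φ : AddCircle L → ℝ) : Prop :=
  ContDiff ℝ ((⊤ : ℕ∞) : WithTop ℕ∞) (fun y : ℝ => φ (y : AddCircle L))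

/-- The classical derivative of a function on the torus. -/
def torusDeriv (φ : AddCircle L → ℝ) (x : AddCircle L) : ℝ :=
  deriv (fun y : ℝ => φ (x + (y : AddCircle L))) 0

/-- `g` is the weak derivative of `u`. -/
def IsWeakDeriv {p : ℝ≥0∞} (u g : LpT L p) : Prop :=
  ∀ φ : AddCircle L → ℝ, IsTest φ →
    ∫ x : AddCircle L, u x * torusDeriv φ x = - ∫ x : AddCircle L, g x * φ x

/-- `u ∈ W^{1,p}(𝕋)`. -/
def MemW1 {p : ℝ≥0∞} (u : LpT L p) : Prop := ∃ g : LpT L p, IsWeakDeriv u g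

open Classical in
/-- The weak derivative `∂ₓ u ∈ L^p(𝕋)` of `u ∈ W^{1,p}(𝕋)` (and `0` for other `u`). -/
def weakDeriv {p : ℝ≥0∞} (u : LpT L p) : LpT L p :=
  if h : MemW1 u then h.choose else 0

/-- `u ∈ H¹(𝕋)`. -/
abbrev MemH1 (u : LpT L 2) : Prop := MemW1 u

/-- `Φ ∈ W^{2,∞}(𝕋)`. -/
def MemW2Infty (Φ : LpT L ⊤) : Prop := MemW1 Φ ∧ MemW1 (weakDeriv Φ)

/-! ### The operators -/

/-- The electric field `E = -∂ₓ Φ`. -/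
def electricField (Φ : LpT L ⊤) : LpT L ⊤ := - weakDeriv Φ

/-- `𝒜 u = √T₀ ∂ₓ u - E / (2 √T₀) u`, meaningful for `u ∈ H¹(𝕋)`. -/
def opA (T₀ : ℝ) (Φ : LpT L ⊤) (u : LpT L 2) : LpT L 2 :=
  √T₀ • weakDeriv u - (1 / (2 * √T₀)) • ((electricField Φ) • u : LpT L 2)

/-- `𝒜⋆ u = -√T₀ ∂ₓ u - E / (2 √T₀) u`, meaningful for `u ∈ H¹(𝕋)`. -/
def opAstar (T₀ : ℝ) (Φ : LpT L ⊤) (u : LpT L 2) : LpT L 2 :=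
  - (√T₀ • weakDeriv u) - (1 / (2 * √T₀)) • ((electricField Φ) • u : LpT L 2)

/-- `ℬ₀ = 𝒜` and `ℬₖ = 𝒜⋆` for `k ≥ 1`. -/
def opB (T₀ : ℝ) (Φ : LpT L ⊤) (k : ℕ) (u : LpT L 2) : LpT L 2 :=
  if k = 0 then opA T₀ Φ u else opAstar T₀ Φ u

/-- `‖D‖_{H¹} < ∞` for `D ∈ ℓ²(L²)`: all `Dₖ` are in `H¹(𝕋)` and `∑ₖ ‖ℬₖ Dₖ‖² < ∞`. -/
def SeqMemH1 (T₀ : ℝ) (Φ : LpT L ⊤) (D : SeqL2 L) : Prop :=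
  (∀ k, MemH1 (D k)) ∧ Summable (fun k => ‖opB T₀ Φ k (D k)‖ ^ 2)

/-- `‖D‖_{H¹} = (‖ℬ D‖² + ‖D‖²)^{1/2}`. -/
def seqH1Norm (T₀ : ℝ) (Φ : LpT L ⊤) (D : SeqL2 L) : ℝ :=
  √(∑' k, ‖opB T₀ Φ k (D k)‖ ^ 2 + ‖D‖ ^ 2)

/-! ### Equilibrium -/

/-- `ρ_∞ = c₀ exp(-Φ / T₀)`. -/
def rhoInf (T₀ : ℝ) (Φ : LpT L ⊤) (c₀ : ℝ) (x : AddCircle L) : ℝ :=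
  c₀ * Real.exp (- Φ x / T₀)

theorem memLp_sqrt_rhoInf (T₀ : ℝ) (Φ : LpT L ⊤) (c₀ : ℝ) :
    MemLp (fun x => √(rhoInf T₀ Φ c₀ x)) 2 (volume : Measure (AddCircle L)) := by
  have hm : AEStronglyMeasurable (fun x => √(rhoInf T₀ Φ c₀ x))
      (volume : Measure (AddCircle L)) := by
    have hΦ : AEMeasurable (fun x => Φ x) (volume : Measure (AddCircle L)) :=
      (Lp.aestronglyMeasurable Φ).aemeasurable
    unfold rhoInf
    exact (((hΦ.neg.div_const T₀).exp.const_mul c₀).sqrt).aestronglyMeasurable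
  refine MemLp.of_bound hm (√(|c₀| * Real.exp (‖Φ‖ / |T₀|))) ?_
  have hb : ∀ᵐ x ∂(volume : Measure (AddCircle L)), ‖Φ x‖ ≤ ‖Φ‖ := by
    have h := ae_le_eLpNormEssSup (f := fun x => Φ x) (μ := (volume : Measure (AddCircle L)))
    have hfin : eLpNormEssSup (fun x => Φ x) (volume : Measure (AddCircle L)) ≠ ⊤ := by
      have := Lp.eLpNorm_ne_top Φ
      rwa [eLpNorm_exponent_top] at this
    filter_upwards [h] with x hx
    rw [Lp.norm_def, eLpNorm_exponent_top]
    have := ENNReal.toReal_mono hfin hx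
    simpa using this
  filter_upwards [hb] with x hx
  rw [Real.norm_of_nonneg (Real.sqrt_nonneg _)]
  refine Real.sqrt_le_sqrt ?_
  unfold rhoInf
  refine (mul_le_mul_of_nonneg_right (le_abs_self c₀) (Real.exp_nonneg _)).trans ?_
  refine mul_le_mul_of_nonneg_left (Real.exp_le_exp.mpr ?_) (abs_nonneg _)
  calc - Φ x / T₀ ≤ |(- Φ x / T₀)| := le_abs_self _
    _ = |Φ x| / |T₀| := by rw [abs_div, abs_neg]
    _ ≤ ‖Φ‖ / |T₀| := by gcongr; exact hx

/-- `D_{∞,0} = √ρ_∞` as an element of `L²(𝕋)`. -/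
def sqrtRhoInf (T₀ : ℝ) (Φ : LpT L ⊤) (c₀ : ℝ) : LpT L 2 :=
  (memLp_sqrt_rhoInf T₀ Φ c₀).toLp _

/-- The sequence `(u, 0, 0, …)`. -/
def zeroth (u : LpT L 2) : SeqL2 L := lp.single 2 0 u

/-- The equilibrium `D_∞ = (√ρ_∞, 0, 0, …)`. -/
def equilibrium (T₀ : ℝ) (Φ : LpT L ⊤) (c₀ : ℝ) : SeqL2 L :=
  zeroth (sqrtRhoInf T₀ Φ c₀)

/-- `D_⊥ = (0, D₁, D₂, …)`. -/
def perp (D : SeqL2 L) : SeqL2 L := D - zeroth (D 0)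

/-- The density `u √ρ_∞` has the same mass as `ρ_∞`. This is the relation that fixes `c₀`. -/
def HasEquilibriumMass (T₀ : ℝ) (Φ : LpT L ⊤) (c₀ : ℝ) (u : LpT L 2) : Prop :=
  ∫ x : AddCircle L, u x * √(rhoInf T₀ Φ c₀ x) = ∫ x : AddCircle L, rhoInf T₀ Φ c₀ x

/-! ### The `H⁻¹` norm -/

/-- `u ∈ H²(𝕋)` solves `𝒜⋆ 𝒜 u = g` with `∫ u √ρ_∞ = 0`. -/
structure IsEllipticSol (T₀ : ℝ) (Φ : LpT L ⊤) (c₀ : ℝ) (g u : LpT L 2) : Prop where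
  memH1 : MemH1 u
  memH1_opA : MemH1 (opA T₀ Φ u)
  eq : opAstar T₀ Φ (opA T₀ Φ u) = g
  mean_zero : ∫ x : AddCircle L, u x * √(rhoInf T₀ Φ c₀ x) = 0

open Classical in
/-- `‖g‖_{H⁻¹} = ‖𝒜 u‖` where `u` solves the elliptic problem with datum `g`
(and `0` if that problem has no solution). -/
def hMinusOneNorm (T₀ : ℝ) (Φ : LpT L ⊤) (c₀ : ℝ) (g : LpT L 2) : ℝ :=
  if h : ∃ u, IsEllipticSol T₀ Φ c₀ g u then ‖opA T₀ Φ h.choose‖ else 0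

/-! ### Solutions -/

/-- Weak solutions, in `C([0,∞); ℓ²(L²(𝕋)))`, of the Hermite system
`∂ₜ Dₖ + (1/ε) (√k 𝒜 Dₖ₋₁ - √(k+1) 𝒜⋆ Dₖ₊₁) = -(k/τ) Dₖ`, tested against `φ ∈ H¹(𝕋)`;
`𝒜` and `𝒜⋆` are moved to the test function by duality. For `k = 0` the term with `Dₖ₋₁`
has the coefficient `√0 = 0`. The initial datum is `D 0`. -/
structure IsHermiteSol (T₀ : ℝ) (Φ : LpT L ⊤) (ε τ : ℝ) (D : ℝ → SeqL2 L) : Prop where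
  continuousOn : ContinuousOn D (Ici 0)
  weak : ∀ (k : ℕ) (φ : LpT L 2), MemH1 φ → ∀ t : ℝ, 0 ≤ t →
    HasDerivWithinAt (fun s : ℝ => inner ℝ (D s k) φ)
      (- (1 / ε) * (√(k : ℝ) * inner ℝ (D t (k - 1)) (opAstar T₀ Φ φ)
          - √((k : ℝ) + 1) * inner ℝ (D t (k + 1)) (opA T₀ Φ φ))
        - (k : ℝ) / τ * inner ℝ (D t k) φ) (Ici 0) t

/-- Weak solutions, in `C([0,∞); L²(𝕋))`, of the drift-diffusion equation
`∂ₜ u + τ₀ 𝒜⋆ 𝒜 u = 0`, tested against `φ ∈ H²(𝕋)`; the symmetric operator `𝒜⋆ 𝒜` is moved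
to the test function. -/
structure IsDriftDiffusionSol (T₀ : ℝ) (Φ : LpT L ⊤) (τ₀ : ℝ) (u : ℝ → LpT L 2) : Prop where
  continuousOn : ContinuousOn u (Ici 0)
  weak : ∀ φ : LpT L 2, MemH1 φ → MemH1 (opA T₀ Φ φ) → ∀ t : ℝ, 0 ≤ t →
    HasDerivWithinAt (fun s : ℝ => inner ℝ (u s) φ)
      (- τ₀ * inner ℝ (u t) (opAstar T₀ Φ (opA T₀ Φ φ))) (Ici 0) t

/-- The exponent `κ = 1 / (C (τ̄₀² + 1))`. -/
def kappa (C τbar : ℝ) : ℝ := 1 / (C * (τbar ^ 2 + 1))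

end

end VFP

/-! Substituting time `t = τ s` and putting `r = τ / ε` turns the system into `∂ₛ Dₖ + r (√k A Dₖ₋₁
- √(k+1) B Dₖ₊₁) = -k Dₖ`, with one parameter `r`. Here `B` is the adjoint of `A`, and only a little
structure matters (`HermitePair`): `A + B = b` and `A B - B A = M` are bounded, and `A` satisfies a
Poincaré inequality on the complement of its kernel element `e = √ρ_∞`. The equilibrium is
stationary and mass is conserved, so one may subtract `D_∞` and assume that `D₀ ⟂ e`.

Damping acts only on `D_⊥`, so decay comes from hypocoercivity. In `L²` the functional is `‖D‖² +
2αr ⟨D₁, A (1 + B A)⁻¹ D₀⟩`. Differentiating the mixed term produces `-r ⟨(1 - R₁) D₀, D₀⟩` with `R₁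
= (1 + B A)⁻¹`, which is coercive by Poincaré. In `H¹` one adds `⟨A D₀, D₁⟩` to `‖ℬ D‖²`; the
commutator `M` costs `r² ‖D_⊥‖²`, paid for by a multiple `K` of the `L²` functional. With `α` of
order `1 / (1 + r²)` the rate is a multiple of `r² / (1 + r²)`, which is `(τ/ε²) / (1 + (τ/ε)²)` in
the original time.

The bound on `D_⊥` follows from `d/ds ‖D_⊥‖² ≤ -2 ‖D_⊥‖² + 2 r ‖A D₀‖ ‖D_⊥‖` and the decay of `A
D₀`. For the `H⁻¹` bound let `u` solve `∂ₛ u = -m B A u` and put `Y = D₀ - u + r B D₁`. The terms of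
order `r` cancel in `∂ₛ Y = -r² B A (D₀ - u) + (m - r²) B A u + √2 r² B B D₂`. Pairing with `R₁ Y`
costs no derivatives: all operators that arise are bounded, and the remaining errors are absorbed by
the dissipation of the `H¹` functional. In the diffusive regime `u` is the limit flow minus
equilibrium and `m / r² = τ₀ ε² / τ`; in the other regime `u = 0`.

Weak solutions do not justify these computations directly. Every energy is therefore regularized by
resolvents `(1 + δ B A)⁻¹` and `(1 + δ A B)⁻¹` and truncated by a cutoff in the Hermite index; the
errors vanish as the cutoff `N` tends to infinity and `δ` tends to zero. The main carriers are
`IsWeakSol.upperSlope_l2Func`, `IsWeakSol.upperSlope_h1Func`, `IsWeakSol.exists_deriv_corrector` and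
`HermitePair.exists_decay`; `hermitePair_opA` supplies the concrete operators. -/

namespace VFP

/-! ### Resolvents of adjoint pairs of unbounded operators -/

section Resolvent

variable {H : Type*} [NormedAddCommGroup H] [InnerProductSpace ℝ H]

/-- `A` and `B` are the graphs of two densely defined operators that are adjoint to each other. -/
structure IsAdjointPair (A B : Submodule ℝ (H × H)) : Prop where
  inner_eq : ∀ {u w v z : H}, (u, w) ∈ A → (v, z) ∈ B → inner ℝ w v = inner ℝ u z
  mem_left : ∀ {u w : H}, (∀ v z, (v, z) ∈ B → inner ℝ w v = inner ℝ u z) → (u, w) ∈ A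
  mem_right : ∀ {v z : H}, (∀ u w, (u, w) ∈ A → inner ℝ w v = inner ℝ u z) → (v, z) ∈ B
  dense_left : Dense {u : H | ∃ w, (u, w) ∈ A}
  dense_right : Dense {v : H | ∃ z, (v, z) ∈ B}

/-- `R = (1 + δ B A)⁻¹` and `W = A R`. -/
structure IsResolvent (A B : Submodule ℝ (H × H)) (δ : ℝ) (R W : H →L[ℝ] H) : Prop where
  pos : 0 < δ
  fst : ∀ f, (R f, W f) ∈ A
  snd : ∀ f, (W f, δ⁻¹ • (f - R f)) ∈ B

variable {A B : Submodule ℝ (H × H)} {δ : ℝ} {R W R' W' : H →L[ℝ] H}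

theorem IsAdjointPair.symm (h : IsAdjointPair A B) : IsAdjointPair B A where
  inner_eq hu hv := by
    rw [real_inner_comm, ← h.inner_eq hv hu, real_inner_comm]
  mem_left hu := h.mem_right fun v z hv => by
    rw [real_inner_comm, ← hu v z hv, real_inner_comm]
  mem_right hu := h.mem_left fun v z hv => by
    rw [real_inner_comm, ← hu v z hv, real_inner_comm]
  dense_left := h.dense_right
  dense_right := h.dense_left

theorem IsAdjointPair.isClosed (h : IsAdjointPair A B) : IsClosed (A : Set (H × H)) := by
  have : (A : Set (H × H)) =
      ⋂ q ∈ B, {p : H × H | inner ℝ p.2 q.1 = inner ℝ p.1 q.2} := by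
    ext ⟨u, w⟩
    simp only [SetLike.mem_coe, mem_iInter, mem_ofPred_eq]
    exact ⟨fun hu q hq => h.inner_eq hu hq, fun hu => h.mem_left fun v z hv => hu (v, z) hv⟩
  rw [this]
  exact isClosed_biInter fun q _ => isClosed_eq (by fun_prop) (by fun_prop)

/-- Project `(f, 0)` orthogonally onto the closed graph `{(u, √δ w) : (u, w) ∈ A}`. The projection
is `(R f, √δ W f)`, and orthogonality of the remainder to the graph reads `⟨f - R f, u⟩ = δ ⟨W f,
w⟩`, which by maximality of `B` puts `W f` in its domain. -/
theorem IsAdjointPair.exists_isResolvent [CompleteSpace H] (h : IsAdjointPair A B)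
    (hδ : 0 < δ) : ∃ R W : H →L[ℝ] H, IsResolvent A B δ R W := by
  let e := WithLp.prodContinuousLinearEquiv 2 ℝ H H
  let S : WithLp 2 (H × H) →L[ℝ] H × H :=
    ((ContinuousLinearMap.fst ℝ H H).comp e.toContinuousLinearMap).prod
      ((√δ)⁻¹ • (ContinuousLinearMap.snd ℝ H H).comp e.toContinuousLinearMap)
  let K : Submodule ℝ (WithLp 2 (H × H)) := A.comap S.toLinearMap
  have hK : IsClosed (K : Set (WithLp 2 (H × H))) := h.isClosed.preimage S.continuous
  have : CompleteSpace K := hK.completeSpace_coe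
  let Q : H →L[ℝ] WithLp 2 (H × H) :=
    K.starProjection.comp (e.symm.toContinuousLinearMap.comp (ContinuousLinearMap.inl ℝ H H))
  have hs : √δ * √δ = δ := Real.mul_self_sqrt hδ.le
  have hs0 : √δ ≠ 0 := (Real.sqrt_pos.2 hδ).ne'
  have hmem : ∀ f, ((S.comp Q) f) ∈ A := fun f => K.starProjection_apply_mem _
  refine ⟨(ContinuousLinearMap.fst ℝ H H).comp (S.comp Q),
    (ContinuousLinearMap.snd ℝ H H).comp (S.comp Q), hδ, hmem, fun f => ?_⟩
  refine h.mem_right fun u w hu => ?_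
  have hq : WithLp.toLp 2 (u, √δ • w) ∈ K := by
    change ((u, (√δ)⁻¹ • √δ • w) : H × H) ∈ A
    rwa [smul_smul, inv_mul_cancel₀ hs0, one_smul]
  have h0 := K.starProjection_inner_eq_zero (e.symm (f, 0)) _ hq
  rw [WithLp.prod_inner_apply] at h0
  have h1 : inner ℝ (f - (Q f).fst) u + inner ℝ (0 - (Q f).snd) (√δ • w) = 0 := h0
  change inner ℝ w ((√δ)⁻¹ • (Q f).snd) = inner ℝ u (δ⁻¹ • (f - (Q f).fst))
  rw [zero_sub, inner_neg_left, inner_smul_right] at h1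
  rw [inner_smul_right, inner_smul_right, real_inner_comm (f - (Q f).fst) u, real_inner_comm (Q f).snd w]
  have : inner ℝ (f - (Q f).fst) u = √δ * inner ℝ (Q f).snd w := by linarith
  rw [this, ← mul_assoc]
  congr 1
  field_simp
  nlinarith

namespace IsResolvent

theorem mem_snd_smul (hR : IsResolvent A B δ R W) (f : H) : (δ • W f, f - R f) ∈ B := by
  have := B.smul_mem δ (hR.snd f)
  simpa [Prod.smul_mk, smul_smul, mul_inv_cancel₀ hR.pos.ne'] using this

theorem inner_self (h : IsAdjointPair A B) (hR : IsResolvent A B δ R W) (f : H) :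
    inner ℝ (R f) f = ‖R f‖ ^ 2 + δ * ‖W f‖ ^ 2 := by
  have h1 := h.inner_eq (hR.fst f) (hR.mem_snd_smul f)
  rw [inner_smul_right, inner_sub_right, real_inner_self_eq_norm_sq,
    real_inner_self_eq_norm_sq] at h1
  linarith

theorem symm (h : IsAdjointPair A B) (hR : IsResolvent A B δ R W) (f g : H) :
    inner ℝ (R f) g = inner ℝ f (R g) := by
  have h1 := h.inner_eq (hR.fst f) (hR.mem_snd_smul g)
  have h2 := h.inner_eq (hR.fst g) (hR.mem_snd_smul f)
  rw [inner_smul_right, inner_sub_right] at h1 h2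
  rw [real_inner_comm (W f) (W g)] at h2
  rw [real_inner_comm (R g) f]
  have := real_inner_comm (R f) (R g)
  linarith

/-- Injectivity of `1 + δ B A`: pairing the equation for a difference with itself gives a sum of two
squares equal to zero. All later resolvent identities come from recognising an element as `v + δ B A
v`. -/
theorem apply_add (h : IsAdjointPair A B) (hR : IsResolvent A B δ R W) {v w z : H}
    (hv : (v, w) ∈ A) (hw : (w, z) ∈ B) : R (v + δ • z) = v ∧ W (v + δ • z) = w := by
  set f := v + δ • z with hf
  have h1 : (R f - v, W f - w) ∈ A := A.sub_mem (hR.fst f) hv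
  have h2 : (δ • (W f - w), -(R f - v)) ∈ B := by
    have := B.sub_mem (hR.mem_snd_smul f) (B.smul_mem δ hw)
    have e : (δ • W f, f - R f) - δ • (w, z) = (δ • (W f - w), -(R f - v)) := by
      ext1
      · simp [smul_sub]
      · simp [hf]; abel
    rwa [e] at this
  have h3 := h.inner_eq h1 h2
  rw [inner_smul_right, inner_neg_right, real_inner_self_eq_norm_sq,
    real_inner_self_eq_norm_sq] at h3
  have h4 : 0 ≤ δ * ‖W f - w‖ ^ 2 := mul_nonneg hR.pos.le (sq_nonneg _)
  have h5 : ‖R f - v‖ ^ 2 = 0 := by nlinarith [sq_nonneg ‖R f - v‖]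
  have h6 : ‖W f - w‖ ^ 2 = 0 := by
    rcases mul_eq_zero.1 (show δ * ‖W f - w‖ ^ 2 = 0 by linarith) with h | h
    · exact absurd h hR.pos.ne'
    · exact h
  exact ⟨sub_eq_zero.1 (norm_eq_zero.1 (pow_eq_zero_iff two_ne_zero |>.1 h5)),
    sub_eq_zero.1 (norm_eq_zero.1 (pow_eq_zero_iff two_ne_zero |>.1 h6))⟩

theorem inner_apply (h : IsAdjointPair A B) (hR : IsResolvent A B δ R W)
    (hR' : IsResolvent B A δ R' W') (f g : H) : inner ℝ (W f) g = inner ℝ f (W' g) := by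
  have h1 := h.inner_eq (hR.fst f) (hR'.fst g)
  have h2 := h.inner_eq (hR'.mem_snd_smul g) (hR.mem_snd_smul f)
  rw [inner_smul_right, inner_smul_left] at h2
  simp only [conj_trivial] at h2
  rw [inner_sub_left, inner_sub_right] at h2
  have h3 := mul_left_cancel₀ hR.pos.ne' h2
  linarith [real_inner_comm g (W f), real_inner_comm (R' g) (W f), real_inner_comm (W' g) f,
    real_inner_comm (W' g) (R f)]

/-- The intertwining `A (1 + δ B A)⁻¹ = (1 + δ A B)⁻¹ A` on the domain of `A`. It makes `W g`
bounded by `‖A g‖` uniformly in `δ`. -/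
theorem apply_of_mem (h : IsAdjointPair A B) (hR : IsResolvent A B δ R W)
    (hR' : IsResolvent B A δ R' W') {g z : H} (hg : (g, z) ∈ A) : W g = R' z := by
  refine ext_inner_right ℝ fun φ => ?_
  rw [hR.inner_apply h hR', hR'.symm h.symm, h.inner_eq hg (hR'.fst φ)]

theorem norm_sq_le (h : IsAdjointPair A B) (hR : IsResolvent A B δ R W) (f : H) :
    ‖R f‖ ^ 2 + δ * ‖W f‖ ^ 2 ≤ ‖f‖ ^ 2 := by
  have h1 := hR.inner_self h f
  have h2 := norm_sub_sq_real f (R f)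
  rw [real_inner_comm] at h2
  have h3 := mul_nonneg hR.pos.le (sq_nonneg ‖W f‖)
  nlinarith [sq_nonneg ‖f - R f‖]

theorem norm_apply_le (h : IsAdjointPair A B) (hR : IsResolvent A B δ R W) (f : H) :
    ‖R f‖ ≤ ‖f‖ := by
  refine abs_le_of_sq_le_sq' ?_ (norm_nonneg _) |>.2
  have h3 := mul_nonneg hR.pos.le (sq_nonneg ‖W f‖)
  linarith [hR.norm_sq_le h f]

theorem norm_sub_le (h : IsAdjointPair A B) (hR : IsResolvent A B δ R W) (f : H) :
    ‖f - R f‖ ≤ ‖f‖ := by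
  refine abs_le_of_sq_le_sq' ?_ (norm_nonneg _) |>.2
  have h1 := hR.inner_self h f
  have h2 := norm_sub_sq_real f (R f)
  rw [real_inner_comm] at h2
  have h3 := mul_nonneg hR.pos.le (sq_nonneg ‖W f‖)
  nlinarith [sq_nonneg ‖R f‖]

theorem norm_apply_snd_le (h : IsAdjointPair A B) (hR : IsResolvent A B δ R W) (f : H) :
    ‖W f‖ ≤ (√δ)⁻¹ * ‖f‖ := by
  have hs := Real.sqrt_pos.2 hR.pos
  rw [← div_eq_inv_mul, le_div_iff₀ hs]
  refine abs_le_of_sq_le_sq' ?_ (norm_nonneg _) |>.2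
  rw [mul_pow, Real.sq_sqrt hR.pos.le]
  linarith [hR.norm_sq_le h f, sq_nonneg ‖R f‖]

theorem norm_sub_sq_le (h : IsAdjointPair A B) (hR : IsResolvent A B δ R W) {v w : H}
    (hv : (v, w) ∈ A) : ‖v - R v‖ ^ 2 ≤ δ * ‖w‖ ^ 2 := by
  have h1 := h.inner_eq (A.sub_mem hv (hR.fst v)) (hR.mem_snd_smul v)
  simp only at h1
  rw [real_inner_self_eq_norm_sq, inner_smul_right, inner_sub_left,
    real_inner_self_eq_norm_sq] at h1
  rw [← h1]
  refine mul_le_mul_of_nonneg_left ?_ hR.pos.le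
  have := real_inner_le_norm w (W v)
  nlinarith [sq_nonneg (‖w‖ - ‖W v‖), sq_nonneg ‖W v‖, sq_nonneg ‖w‖]

/-- On the domain of `A` the error is `O(√δ)` by `norm_sub_sq_le`; density and the contraction
property extend convergence to all of `H`. -/
theorem tendsto (h : IsAdjointPair A B) {ι : Type*} {l : Filter ι} {δ : ι → ℝ}
    {R W : ι → H →L[ℝ] H} (hR : ∀ i, IsResolvent A B (δ i) (R i) (W i))
    (hδ : Tendsto δ l (𝓝 0)) (f : H) : Tendsto (fun i => R i f) l (𝓝 f) := by
  rw [Metric.tendsto_nhds]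
  intro η hη
  obtain ⟨v, ⟨w, hv⟩, hfv⟩ := h.dense_left.exists_dist_lt f (show 0 < η / 3 by positivity)
  have h1 : Tendsto (fun i => δ i * ‖w‖ ^ 2) l (𝓝 0) := by
    simpa using hδ.mul_const (‖w‖ ^ 2)
  filter_upwards [h1.eventually_lt_const (show 0 < (η / 3) ^ 2 by positivity)] with i hi
  have h2 : ‖v - R i v‖ < η / 3 :=
    lt_of_pow_lt_pow_left₀ 2 (by positivity) (((hR i).norm_sub_sq_le h hv).trans_lt hi)
  have h3 : ‖R i (f - v)‖ ≤ ‖f - v‖ := (hR i).norm_apply_le h _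
  rw [dist_eq_norm] at hfv ⊢
  have h4 : R i f - f = R i (f - v) - (v - R i v) - (f - v) := by
    rw [map_sub]; abel
  rw [h4]
  calc _ ≤ ‖R i (f - v)‖ + ‖v - R i v‖ + ‖f - v‖ :=
        (_root_.norm_sub_le _ _).trans (by gcongr; exact _root_.norm_sub_le _ _)
    _ < η := by linarith

end IsResolvent

end Resolvent

end VFP

namespace VFP

/-! ### Commutators of resolvents and consequences of the Poincaré inequality -/

section HermitePair

variable {H : Type*} [NormedAddCommGroup H] [InnerProductSpace ℝ H]

/-- A pair of adjoint operators `A`, `B` with the same domain, whose sum is the bounded operator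
`b`, whose commutator is the bounded operator `M`, and such that `A` satisfies a Poincaré
inequality on the orthogonal complement of the element `e` of its kernel. -/
structure HermitePair (A B : Submodule ℝ (H × H)) (b M : H →L[ℝ] H) (e : H) (cP : ℝ) : Prop
    extends IsAdjointPair A B where
  add_left : ∀ {u w : H}, (u, w) ∈ A → (u, b u - w) ∈ B
  add_right : ∀ {u w : H}, (u, w) ∈ B → (u, b u - w) ∈ A
  commutator : ∀ {u w v z : H}, (u, w) ∈ A → (v, z) ∈ A →
    inner ℝ (b u - w) (b v - z) - inner ℝ w z = inner ℝ (M u) v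
  kernel : (e, 0) ∈ A
  poincare_pos : 0 < cP
  poincare : ∀ {u w : H}, (u, w) ∈ A → inner ℝ u e = 0 → ‖u‖ ≤ cP * ‖w‖

variable {A B : Submodule ℝ (H × H)} {b M : H →L[ℝ] H} {e : H} {cP δ : ℝ}
  {R W R' W' R₁ W₁ R₁' W₁' : H →L[ℝ] H}

theorem IsAdjointPair.unique (h : IsAdjointPair A B) {u w w' : H} (hw : (u, w) ∈ A)
    (hw' : (u, w') ∈ A) : w = w' := by
  refine h.dense_right.eq_of_inner_left (𝕜 := ℝ) fun v hv => ?_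
  obtain ⟨z, hz⟩ := hv
  rw [h.inner_eq hw hz, h.inner_eq hw' hz]

namespace IsResolvent

theorem apply_snd (h : IsAdjointPair A B) (hR : IsResolvent A B δ R W)
    (hR' : IsResolvent B A δ R' W') (f : H) : W (W' f) = δ⁻¹ • R' (f - R' f) := by
  rw [hR.apply_of_mem h hR' (hR'.snd f), map_smul]

theorem comm_apply (h : IsAdjointPair A B) (hR : IsResolvent A B δ R W)
    (hR' : IsResolvent B A δ R' W') (f : H) : W (R f) = R' (W f) :=
  hR.apply_of_mem h hR' (hR.fst f)

theorem apply_generator (h : IsAdjointPair A B) (hR : IsResolvent A B δ R W)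
    (h₁ : IsResolvent A B 1 R₁ W₁) (f : H) :
    R₁ (δ⁻¹ • (f - R f)) = R f - R₁ (R f) := by
  have := (h₁.apply_add h (hR.fst f) (hR.snd f)).1
  rw [one_smul, map_add] at this
  exact eq_sub_of_add_eq' this

theorem generator_apply (h : IsAdjointPair A B) (hR : IsResolvent A B δ R W)
    (h₁ : IsResolvent A B 1 R₁ W₁) (f : H) :
    δ⁻¹ • (R₁ f - R (R₁ f)) = R (f - R₁ f) := by
  have h2 : (W₁ f, f - R₁ f) ∈ B := by simpa using h₁.snd f
  have := (hR.apply_add h (h₁.fst f) h2).1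
  rw [map_add, map_smul] at this
  nth_rewrite 1 [← this]
  rw [add_sub_cancel_left, smul_smul, inv_mul_cancel₀ hR.pos.ne', one_smul]

end IsResolvent

namespace HermitePair

variable (h : HermitePair A B b M e cP)
include h

theorem inner_kernel (hR : IsResolvent A B δ R W) (f : H) :
    inner ℝ (R f) e = inner ℝ f e := by
  rw [hR.symm h.toIsAdjointPair]
  have := (hR.apply_add h.toIsAdjointPair h.kernel B.zero_mem).1
  simp only [smul_zero, add_zero] at this
  rw [this]

/-- Since `B A = A B - M`, applying `1 + δ B A` to `R' f` gives `f - δ M R' f`. The commutator form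
puts `A R' f` in the domain of `B`. -/
theorem resolvent_swap (hR : IsResolvent A B δ R W) (hR' : IsResolvent B A δ R' W') (f : H) :
    R (f - δ • M (R' f)) = R' f ∧ W (f - δ • M (R' f)) = b (R' f) - W' f := by
  have hA := h.add_right (hR'.fst f)
  have hB : (b (R' f) - W' f, δ⁻¹ • (f - R' f) - M (R' f)) ∈ B := by
    refine h.mem_right fun u w hu => ?_
    have h1 := h.commutator hA hu
    have h2 := h.inner_eq (hR'.snd f) (h.add_left hu)
    rw [sub_sub_cancel] at h1
    have h3 := real_inner_comm (b (R' f) - W' f) w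
    have h4 := real_inner_comm (δ⁻¹ • (f - R' f)) u
    have h5 := real_inner_comm (M (R' f)) u
    rw [inner_sub_right u]
    linarith
  have := hR.apply_add h.toIsAdjointPair hA hB
  rwa [smul_sub, smul_smul, mul_inv_cancel₀ hR.pos.ne', one_smul, ← add_sub_assoc,
    add_sub_cancel] at this

/-- The commutator term in the `L²` estimate. -/
theorem inner_commutator (hR : IsResolvent A B δ R W) (hR' : IsResolvent B A δ R' W')
    (a c : H) : inner ℝ c (b (R' a) - W' a) - inner ℝ c (W a)
      = -(δ * inner ℝ (W' c) (M (R' a))) := by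
  have h1 := hR.inner_apply h.toIsAdjointPair hR' (M (R' a)) c
  rw [real_inner_comm, real_inner_comm (W' c)] at h1
  rw [← (h.resolvent_swap hR hR' a).2, map_sub, inner_sub_right, map_smul, inner_smul_right, h1]
  ring

/-- Of the factor `δ` in the commutator one `√δ` is spent on `√δ ‖W' c‖ ≤ √⟨R' c, c⟩`, which the
damping controls, and the other makes the term vanish in the limit. -/
theorem inner_commutator_le (hR : IsResolvent A B δ R W) (hR' : IsResolvent B A δ R' W')
    (a c : H) : inner ℝ c (b (R' a) - W' a) - inner ℝ c (W a)
      ≤ √δ * ‖M‖ * √(inner ℝ (R' c) c) * ‖a‖ := by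
  rw [h.inner_commutator hR hR']
  have h0 := hR'.inner_self h.toIsAdjointPair.symm c
  have h1 : √δ * ‖W' c‖ ≤ √(inner ℝ (R' c) c) := by
    refine Real.le_sqrt_of_sq_le ?_
    rw [mul_pow, Real.sq_sqrt hR.pos.le, h0]
    linarith [sq_nonneg ‖R' c‖]
  have h2 : ‖M (R' a)‖ ≤ ‖M‖ * ‖a‖ :=
    (M.le_opNorm _).trans
      (by gcongr; exact hR'.norm_apply_le h.toIsAdjointPair.symm a)
  have h3 := abs_real_inner_le_norm (W' c) (M (R' a))
  have h4 : -(δ * inner ℝ (W' c) (M (R' a))) ≤ δ * (‖W' c‖ * ‖M (R' a)‖) := by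
    have := neg_abs_le (inner ℝ (W' c) (M (R' a)))
    nlinarith [hR.pos]
  refine h4.trans ?_
  calc δ * (‖W' c‖ * ‖M (R' a)‖) = √δ * (√δ * ‖W' c‖) * ‖M (R' a)‖ := by
        nth_rewrite 1 [← Real.mul_self_sqrt hR.pos.le]; ring
    _ ≤ √δ * √(inner ℝ (R' c) c) * (‖M‖ * ‖a‖) := by gcongr
    _ = _ := by ring

/-- `A R'` is bounded by `W'` under the adjoint. -/
theorem inner_left_resolvent_le (hR : IsResolvent A B δ R W) (hR' : IsResolvent B A δ R' W')
    (a c : H) : |inner ℝ c (b (R' a) - W' a)| ≤ (1 + δ * ‖M‖) * ‖W' c‖ * ‖a‖ := by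
  rw [← (h.resolvent_swap hR hR' a).2, real_inner_comm, hR.inner_apply h.toIsAdjointPair hR']
  refine (abs_real_inner_le_norm _ _).trans ?_
  have h2 : ‖M (R' a)‖ ≤ ‖M‖ * ‖a‖ :=
    (M.le_opNorm _).trans
      (by gcongr; exact hR'.norm_apply_le h.toIsAdjointPair.symm a)
  have h3 : ‖a - δ • M (R' a)‖ ≤ (1 + δ * ‖M‖) * ‖a‖ := by
    refine (norm_sub_le _ _).trans ?_
    rw [norm_smul, Real.norm_of_nonneg hR.pos.le]
    nlinarith [hR.pos]
  calc _ ≤ (1 + δ * ‖M‖) * ‖a‖ * ‖W' c‖ := by gcongr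
    _ = _ := by ring

/-- The commutator term in the `H¹` estimate. -/
theorem inner_commutator_snd_le (hR : IsResolvent A B δ R W) (hR' : IsResolvent B A δ R' W')
    (a c : H) :
    inner ℝ c (b (W (W' a)) - δ⁻¹ • (W' a - R (W' a))) - inner ℝ c (W (δ⁻¹ • (a - R a)))
      ≤ 2 * ‖M‖ * ‖W' c‖ * ‖a‖ := by
  have hp := h.toIsAdjointPair
  set g := δ⁻¹ • (a - R' a) with hg
  have h1 : W (W' a) = R' g := by rw [hR.apply_snd hp hR', hg, map_smul]
  -- Both arguments of `W` are Yosida approximations, of `A B` and of `B A`. Their difference is `R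
  -- M R' a` by `resolvent_swap`, and the extra term `δ M R' g` equals `M R' (a - R' a)`, so no
  -- negative power of `δ` survives.
  have h2 : b (W (W' a)) - δ⁻¹ • (W' a - R (W' a)) = W (g - δ • M (R' g)) := by
    rw [(h.resolvent_swap hR hR' g).2]
    refine hp.unique (h.add_right (hR.snd (W' a))) ?_
    rw [h1]
    exact h.add_right (hR'.fst g)
  have h3 : g - δ⁻¹ • (a - R a) = R (M (R' a)) := by
    have := (h.resolvent_swap hR hR' a).1
    rw [map_sub, map_smul] at this
    rw [hg, ← smul_sub, sub_sub_sub_cancel_left]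
    nth_rewrite 1 [← this]
    rw [sub_sub_cancel, smul_smul,
      inv_mul_cancel₀ hR.pos.ne', one_smul]
  have h4 : δ • M (R' g) = M (R' (a - R' a)) := by
    rw [hg, map_smul, map_smul, smul_smul, mul_inv_cancel₀ hR.pos.ne', one_smul]
  rw [h2, ← inner_sub_right, ← map_sub, sub_right_comm, h3, h4, real_inner_comm,
    hR.inner_apply hp hR']
  have n1 := hR'.norm_apply_le hp.symm a
  have n2 : ‖R (M (R' a))‖ ≤ ‖M‖ * ‖a‖ :=
    (hR.norm_apply_le hp _).trans ((M.le_opNorm _).trans (by gcongr))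
  have n3 : ‖M (R' (a - R' a))‖ ≤ ‖M‖ * ‖a‖ :=
    (M.le_opNorm _).trans (by
      gcongr
      exact (hR'.norm_apply_le hp.symm _).trans (hR'.norm_sub_le hp.symm a))
  calc _ ≤ ‖R (M (R' a)) - M (R' (a - R' a))‖ * ‖W' c‖ := real_inner_le_norm _ _
    _ ≤ (‖M‖ * ‖a‖ + ‖M‖ * ‖a‖) * ‖W' c‖ := by
        gcongr
        exact (norm_sub_le _ _).trans (add_le_add n2 n3)
    _ = _ := by ring

/-- Macroscopic coercivity. Split `v = R₁ v + (v - R₁ v)`: Poincaré bounds the first part by `‖W₁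
v‖`, and `⟨v - R₁ v, v⟩ = ‖W₁ v‖² + ‖v - R₁ v‖²`. -/
theorem norm_sq_le_of_inner_eq_zero (h₁ : IsResolvent A B 1 R₁ W₁) {v : H}
    (hv : inner ℝ v e = 0) :
    ‖v‖ ^ 2 ≤ 2 * (cP ^ 2 + 1) * inner ℝ (v - R₁ v) v := by
  have hp := h.toIsAdjointPair
  have hu := h.poincare (h₁.fst v) (by rw [h.inner_kernel h₁, hv])
  have h1 := h₁.inner_self hp v
  have h2 : ‖v - R₁ v‖ ^ 2 = ‖v‖ ^ 2 - 2 * inner ℝ (R₁ v) v + ‖R₁ v‖ ^ 2 := by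
    rw [norm_sub_sq_real, real_inner_comm]
  have h3 : inner ℝ (v - R₁ v) v = ‖W₁ v‖ ^ 2 + ‖v - R₁ v‖ ^ 2 := by
    rw [inner_sub_left, real_inner_self_eq_norm_sq]
    linarith
  have h4 : ‖v‖ ≤ ‖R₁ v‖ + ‖v - R₁ v‖ := by
    simpa using norm_add_le (R₁ v) (v - R₁ v)
  rw [h3]
  have h5 : ‖v‖ ^ 2 ≤ (cP * ‖W₁ v‖ + ‖v - R₁ v‖) ^ 2 := by
    exact pow_le_pow_left₀ (norm_nonneg _) (by linarith) 2
  refine h5.trans ?_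
  nlinarith [sq_nonneg (cP * ‖W₁ v‖ - ‖v - R₁ v‖), mul_nonneg (sq_nonneg cP)
    (sq_nonneg ‖v - R₁ v‖), sq_nonneg ‖W₁ v‖]

/-- Poincaré for the Yosida approximation of `B A`, with the same constant for every `δ`. With `z =
B A R u`, the forms are `‖R u‖² + δ ‖W u‖²` and `‖W u‖² + δ ‖z‖²`, compared term by term; `‖W u‖ ≤
cP ‖z‖` follows from `‖W u‖² = ⟨R u, z⟩`. -/
theorem inner_resolvent_le (hR : IsResolvent A B δ R W) {u : H} (hu : inner ℝ u e = 0) :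
    inner ℝ (R u) u ≤ cP ^ 2 * inner ℝ (δ⁻¹ • (u - R u)) u := by
  have hp := h.toIsAdjointPair
  set z := δ⁻¹ • (u - R u) with hz
  have h1 := h.poincare (hR.fst u) (by rw [h.inner_kernel hR, hu])
  have h2 := h.inner_eq (hR.fst u) (hR.snd u)
  rw [← hz, real_inner_self_eq_norm_sq] at h2
  have h3 : u = R u + δ • z := by
    rw [hz, smul_smul, mul_inv_cancel₀ hR.pos.ne', one_smul, add_sub_cancel]
  have h4 : inner ℝ z u = ‖W u‖ ^ 2 + δ * ‖z‖ ^ 2 := by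
    conv_lhs => rw [h3]
    rw [inner_add_right, inner_smul_right, real_inner_self_eq_norm_sq, real_inner_comm, ← h2]
  have hc := h.poincare_pos
  have h5 : ‖W u‖ ^ 2 ≤ cP ^ 2 * ‖z‖ ^ 2 := by
    have := real_inner_le_norm (R u) z
    have h6 : ‖W u‖ ^ 2 ≤ cP * ‖W u‖ * ‖z‖ := by
      rw [h2]; exact this.trans (by gcongr)
    by_cases h0 : ‖W u‖ = 0
    · rw [h0, zero_pow two_ne_zero]; positivity
    · have h7 : 0 < ‖W u‖ := lt_of_le_of_ne (norm_nonneg _) (Ne.symm h0)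
      have : ‖W u‖ ≤ cP * ‖z‖ := by
        refine le_of_mul_le_mul_left ?_ h7
        nlinarith
      calc ‖W u‖ ^ 2 ≤ (cP * ‖z‖) ^ 2 := by gcongr
        _ = _ := by ring
  have h8 : ‖R u‖ ^ 2 ≤ cP ^ 2 * ‖W u‖ ^ 2 := by
    calc ‖R u‖ ^ 2 ≤ (cP * ‖W u‖) ^ 2 := by gcongr
      _ = _ := by ring
  rw [hR.inner_self hp, h4]
  nlinarith [hR.pos]

end HermitePair

end HermitePair

end VFP

namespace VFP

/-! ### From weak derivatives to derivatives of quadratic quantities -/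

section Derivatives

variable {H : Type*} [NormedAddCommGroup H] [InnerProductSpace ℝ H]

/-- Tested against any vector, `y - ∫ F` has zero derivative, so `y` is a primitive of a continuous
function. -/
theorem hasDerivWithinAt_of_inner [CompleteSpace H] {y F : ℝ → H} (hF : ContinuousOn F (Ici 0))
    (h : ∀ ψ : H, ∀ t, 0 ≤ t →
      HasDerivWithinAt (fun s => inner ℝ (y s) ψ) (inner ℝ (F t) ψ) (Ici 0) t)
    {t : ℝ} (ht : 0 ≤ t) : HasDerivWithinAt y (F t) (Ici 0) t := by
  -- A continuous extension to the whole line, so that the fundamental theorem of calculus applies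
  -- at the endpoint `0` too.
  set G : ℝ → H := fun s => F (max 0 s) with hG
  have hGc : Continuous G :=
    hF.comp_continuous (by fun_prop) fun s => mem_Ici.2 (le_max_left _ _)
  have hGF : ∀ s, 0 ≤ s → G s = F s := fun s hs => by simp [hG, hs]
  set I : ℝ → H := fun s => ∫ x in (0 : ℝ)..s, G x with hI
  have hId : ∀ s, HasDerivAt I (G s) s := fun s =>
    intervalIntegral.integral_hasDerivAt_right (hGc.intervalIntegrable _ _)
      hGc.aestronglyMeasurable.stronglyMeasurableAtFilter hGc.continuousAt
  have key : ∀ s, 0 ≤ s → y s = y 0 + I s := by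
    intro s hs
    refine ext_inner_right ℝ fun ψ => ?_
    have hd : ∀ x, 0 ≤ x →
        HasDerivWithinAt (fun s => inner ℝ (y s) ψ - inner ℝ (I s) ψ) 0 (Ici 0) x := by
      intro x hx
      have h1 := (h ψ x hx).fun_sub (((hId x).inner ℝ (hasDerivAt_const x ψ)).hasDerivWithinAt)
      simpa [hGF x hx] using h1
    have h2 := constant_of_has_deriv_right_zero (a := 0) (b := s)
      (fun x hx => ((hd x hx.1).continuousWithinAt).mono Icc_subset_Ici_self)
      (fun x hx => (hd x hx.1).mono (Ici_subset_Ici.2 hx.1)) s ⟨hs, le_rfl⟩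
    have h3 : I 0 = 0 := by simp [hI]
    rw [h3, inner_zero_left, sub_zero] at h2
    rw [inner_add_left]
    linarith
  have h4 : HasDerivWithinAt (fun s => y 0 + I s) (F t) (Ici 0) t := by
    rw [← hGF t ht]
    exact ((hId t).const_add (y 0)).hasDerivWithinAt
  exact h4.congr (fun s hs => key s hs) (key t ht)

/-- A product rule in which `D` need only be continuous and differentiable against the frozen vector
`y t`: the slope splits as `⟨D x, slope y⟩` plus the slope of `⟨D, y t⟩`. -/
theorem hasDerivWithinAt_inner_of_weak {y D : ℝ → H} {y' : H} {d : ℝ} {s : Set ℝ} {t : ℝ}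
    (hy : HasDerivWithinAt y y' s t) (hD : ContinuousWithinAt D s t)
    (h : HasDerivWithinAt (fun x => inner ℝ (D x) (y t)) d s t) :
    HasDerivWithinAt (fun x => inner ℝ (D x) (y x)) (inner ℝ (D t) y' + d) s t := by
  rw [hasDerivWithinAt_iff_tendsto_slope] at hy h ⊢
  have h1 : Tendsto D (𝓝[s \ {t}] t) (𝓝 (D t)) := hD.mono_left (nhdsWithin_mono _ sdiff_subset)
  refine ((h1.inner (𝕜 := ℝ) hy).add h).congr fun x => ?_
  simp only [slope_def_module, smul_eq_mul, inner_smul_right, inner_sub_right]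
  ring

/-- By symmetry the increment is `⟨S D x - S D t, D x + D t⟩`, so differentiability of the smoothed
`S D` and continuity of `D` suffice. -/
theorem hasDerivWithinAt_inner_of_symm {S : H →L[ℝ] H}
    (hS : ∀ f g, inner ℝ (S f) g = inner ℝ f (S g)) {D : ℝ → H} {F : H} {s : Set ℝ} {t : ℝ}
    (hy : HasDerivWithinAt (fun x => S (D x)) F s t) (hD : ContinuousWithinAt D s t) :
    HasDerivWithinAt (fun x => inner ℝ (S (D x)) (D x)) (2 * inner ℝ F (D t)) s t := by
  rw [hasDerivWithinAt_iff_tendsto_slope] at hy ⊢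
  have h1 : Tendsto D (𝓝[s \ {t}] t) (𝓝 (D t)) := hD.mono_left (nhdsWithin_mono _ sdiff_subset)
  have h2 := hy.inner (𝕜 := ℝ) (h1.add_const (D t))
  rw [inner_add_right, ← two_mul] at h2
  refine h2.congr fun x => ?_
  simp only [slope_def_module, smul_eq_mul, inner_smul_left, inner_sub_left, inner_add_right,
    conj_trivial]
  rw [hS (D x) (D t), real_inner_comm (S (D t)) (D x)]
  ring

end Derivatives

/-! ### Dini derivatives and Grönwall inequalities -/

section UpperSlope

/-- The upper right Dini derivative of `f` is at most `g` on `[0, ∞)`. -/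
def UpperSlopeLE (f g : ℝ → ℝ) : Prop :=
  ∀ t, 0 ≤ t → ∀ c, g t < c → ∀ᶠ z in 𝓝[>] t, (z - t)⁻¹ * (f z - f t) < c

theorem UpperSlopeLE.of_hasDerivWithinAt {f f' : ℝ → ℝ}
    (h : ∀ t, 0 ≤ t → HasDerivWithinAt f (f' t) (Ici 0) t) : UpperSlopeLE f f' := by
  intro t ht c hc
  have h1 := (hasDerivWithinAt_iff_tendsto_slope.1 ((h t ht).mono (Ici_subset_Ici.2 ht)))
  rw [show Ici t \ {t} = Ioi t from Ici_sdiff_left] at h1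
  filter_upwards [h1.eventually_lt_const hc] with z hz
  rwa [slope_def_module, smul_eq_mul] at hz

theorem UpperSlopeLE.mono {f g g' : ℝ → ℝ} (h : UpperSlopeLE f g)
    (hg : ∀ t, 0 ≤ t → g t ≤ g' t) : UpperSlopeLE f g' :=
  fun t ht c hc => h t ht c ((hg t ht).trans_lt hc)

theorem UpperSlopeLE.add {f g f' g' : ℝ → ℝ} (hf : UpperSlopeLE f f') (hg : UpperSlopeLE g g') :
    UpperSlopeLE (fun t => f t + g t) (fun t => f' t + g' t) := by
  intro t ht c hc
  have h1 := hf t ht (f' t + (c - (f' t + g' t)) / 2) (by linarith)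
  have h2 := hg t ht (g' t + (c - (f' t + g' t)) / 2) (by linarith)
  filter_upwards [h1, h2] with z h1 h2
  have : (z - t)⁻¹ * (f z + g z - (f t + g t))
      = (z - t)⁻¹ * (f z - f t) + (z - t)⁻¹ * (g z - g t) := by ring
  linarith

theorem UpperSlopeLE.const_mul {f f' : ℝ → ℝ} (hf : UpperSlopeLE f f') {a : ℝ} (ha : 0 < a) :
    UpperSlopeLE (fun t => a * f t) (fun t => a * f' t) := by
  intro t ht c hc
  have h1 := hf t ht (c / a) (by rw [lt_div_iff₀ ha]; linarith)
  filter_upwards [h1] with z h1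
  rw [lt_div_iff₀ ha] at h1
  linarith

/-- Limits of the regularized energies satisfy integral inequalities but need not be differentiable;
this is why Dini derivatives are used. -/
theorem UpperSlopeLE.of_integral {f g : ℝ → ℝ} (hg : ContinuousOn g (Ici 0))
    (h : ∀ s t, 0 ≤ s → s ≤ t → f t - f s ≤ ∫ x in s..t, g x) : UpperSlopeLE f g := by
  set G : ℝ → ℝ := fun s => g (max 0 s) with hG
  have hGc : Continuous G := hg.comp_continuous (by fun_prop) fun s => mem_Ici.2 (le_max_left _ _)
  have hGF : ∀ s, 0 ≤ s → G s = g s := fun s hs => by simp [hG, hs]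
  intro t ht c hc
  have hd : HasDerivAt (fun z => ∫ x in t..z, G x) (G t) t :=
    intervalIntegral.integral_hasDerivAt_right (hGc.intervalIntegrable _ _)
      hGc.aestronglyMeasurable.stronglyMeasurableAtFilter hGc.continuousAt
  have h1 := (hasDerivWithinAt_iff_tendsto_slope.1 (hd.hasDerivWithinAt (s := Ici t)))
  rw [show Ici t \ {t} = Ioi t from Ici_sdiff_left, hGF t ht] at h1
  filter_upwards [h1.eventually_lt_const hc, self_mem_nhdsWithin] with z hz hzt
  have hzt : t < z := hzt
  rw [slope_def_module, smul_eq_mul, intervalIntegral.integral_same, sub_zero] at hz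
  refine lt_of_le_of_lt ?_ hz
  have h2 : ∫ x in t..z, g x = ∫ x in t..z, G x := by
    refine intervalIntegral.integral_congr fun x hx => ?_
    rw [uIcc_of_le hzt.le] at hx
    exact (hGF x (ht.trans hx.1)).symm
  rw [← h2]
  exact mul_le_mul_of_nonneg_left (h t z ht hzt.le) (inv_nonneg.2 (sub_nonneg.2 hzt.le))

/-- A Grönwall inequality with an exponentially decaying source and a constant error. -/
theorem UpperSlopeLE.le_exp {f g : ℝ → ℝ} {lam ν S η T : ℝ} (hlam : 0 < lam) (hν : lam ≠ ν)
    (hη : 0 ≤ η) (hf : ContinuousOn f (Ici 0)) (h : UpperSlopeLE f g)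
    (hg : ∀ t, 0 ≤ t → t ≤ T → g t ≤ -lam * f t + S * Real.exp (-(ν * t)) + η) {t : ℝ}
    (ht : 0 ≤ t) (htT : t ≤ T) :
    f t ≤ Real.exp (-(lam * t)) * (f 0 + S / (ν - lam))
      - S / (ν - lam) * Real.exp (-(ν * t)) + η / lam := by
  have hνl : ν - lam ≠ 0 := sub_ne_zero.2 hν.symm
  -- Adding `q exp (-ν t)` to `f` removes the decaying source, since `S - ν q = -lam q`.
  set q := S / (ν - lam) with hq
  have hqS : q * (ν - lam) = S := div_mul_cancel₀ _ hνl
  have hE : ∀ x, HasDerivAt (fun x => q * Real.exp (-(ν * x)))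
      (q * (Real.exp (-(ν * x)) * -ν)) x := fun x => by
    have h1 : HasDerivAt (fun x : ℝ => -(ν * x)) (-ν) x := by
      simpa using ((hasDerivAt_id x).const_mul ν).fun_neg
    exact h1.exp.const_mul q
  have hE' : UpperSlopeLE (fun x => q * Real.exp (-(ν * x)))
      (fun x => q * (Real.exp (-(ν * x)) * -ν)) :=
    UpperSlopeLE.of_hasDerivWithinAt fun x _ => (hE x).hasDerivWithinAt
  have h1 := h.add hE'
  have hcont : ContinuousOn (fun x => f x + q * Real.exp (-(ν * x))) (Icc 0 t) :=
    (hf.mono Icc_subset_Ici_self).add (by fun_prop)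
  have := le_gronwallBound_of_liminf_deriv_right_le (K := -lam) (ε := η) hcont
    (fun x hx c hc => (h1 x hx.1 c hc).frequently) le_rfl (fun x hx => by
      have h2 := hg x hx.1 (hx.2.le.trans htT)
      rw [← hqS] at h2
      nlinarith) t ⟨ht, le_rfl⟩
  rw [gronwallBound_of_K_ne_0 (neg_ne_zero.2 hlam.ne')] at this
  simp only [sub_zero, mul_zero, neg_zero, Real.exp_zero, mul_one] at this
  have h3 : η / -lam * (Real.exp (-lam * t) - 1) ≤ η / lam := by
    have : 0 ≤ η / lam * Real.exp (-lam * t) := by positivity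
    rw [div_neg]
    nlinarith
  rw [← neg_mul]
  nlinarith [Real.exp_pos (-lam * t)]

theorem UpperSlopeLE.le_exp_of_le {f g : ℝ → ℝ} {lam η T : ℝ} (hlam : 0 < lam)
    (hη : 0 ≤ η) (hf : ContinuousOn f (Ici 0)) (h : UpperSlopeLE f g)
    (hg : ∀ t, 0 ≤ t → t ≤ T → g t ≤ -lam * f t + η) {t : ℝ} (ht : 0 ≤ t) (htT : t ≤ T) :
    f t ≤ Real.exp (-(lam * t)) * f 0 + η / lam := by
  have := h.le_exp (ν := lam + 1) (S := 0) hlam (by linarith) hη hf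
    (fun t ht htT => by simpa using hg t ht htT) ht htT
  simpa using this

end UpperSlope

end VFP

namespace VFP

/-! ### Cutoff in the Hermite index -/

section Truncation

/-- A piecewise linear cutoff of the Hermite modes. -/
noncomputable def cutoff (N k : ℕ) : ℝ := max (1 - (k : ℝ) / N) 0

theorem cutoff_nonneg (N k : ℕ) : 0 ≤ cutoff N k := le_max_right _ _

theorem cutoff_le_one (N k : ℕ) : cutoff N k ≤ 1 :=
  max_le (by linarith [show (0 : ℝ) ≤ (k : ℝ) / N by positivity]) zero_le_one

theorem cutoff_zero (N : ℕ) : cutoff N 0 = 1 := by simp [cutoff]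

theorem cutoff_of_le {N k : ℕ} (hN : 0 < N) (hk : N ≤ k) : cutoff N k = 0 := by
  refine max_eq_right ?_
  have : (N : ℝ) ≤ k := by exact_mod_cast hk
  rw [sub_nonpos, le_div_iff₀ (by exact_mod_cast hN)]
  linarith

theorem cutoff_succ_le (N k : ℕ) : cutoff N (k + 1) ≤ cutoff N k := by
  refine max_le_max ?_ le_rfl
  gcongr
  simp

/-- The slope of the cutoff is `1 / N` where it is nonzero, and there the transport coefficient
`√(k+1)` is at most `√N`. Hence the truncation error vanishes. -/
theorem cutoff_sub_mul_le {N : ℕ} (hN : 0 < N) (k : ℕ) :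
    (cutoff N k - cutoff N (k + 1)) * √((k : ℝ) + 1) ≤ (√N)⁻¹ := by
  have hN' : (0 : ℝ) < N := by exact_mod_cast hN
  rcases le_or_gt N k with h | h
  · rw [cutoff_of_le hN h, cutoff_of_le hN (h.trans k.le_succ), sub_zero, zero_mul]
    positivity
  · have h1 : ((k + 1 : ℕ) : ℝ) ≤ N := by exact_mod_cast h
    have h2 : cutoff N k = 1 - (k : ℝ) / N := max_eq_left (by
      rw [sub_nonneg, div_le_one hN']; push_cast at h1; linarith)
    have h3 : cutoff N (k + 1) = 1 - ((k + 1 : ℕ) : ℝ) / N := max_eq_left (by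
      rw [sub_nonneg, div_le_one hN']; exact h1)
    rw [h2, h3]
    have h4 : √((k : ℝ) + 1) ≤ √N := Real.sqrt_le_sqrt (by exact_mod_cast h1)
    have h5 : (1 - (k : ℝ) / N - (1 - ((k + 1 : ℕ) : ℝ) / N)) = (N : ℝ)⁻¹ := by
      push_cast; field_simp; ring
    rw [h5]
    calc (N : ℝ)⁻¹ * √((k : ℝ) + 1) ≤ (N : ℝ)⁻¹ * √N := by gcongr
      _ = (√N)⁻¹ := by
        have : √(N : ℝ) ≠ 0 := (Real.sqrt_pos.2 hN').ne'
        field_simp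
        rw [Real.sq_sqrt hN'.le]

theorem tendsto_cutoff (k : ℕ) : Tendsto (fun N => cutoff N k) atTop (𝓝 1) := by
  have h1 : Tendsto (fun N : ℕ => (k : ℝ) / N) atTop (𝓝 0) := tendsto_const_div_atTop_nhds_zero_nat _
  have := (tendsto_const_nhds (x := (1 : ℝ))).sub h1 |>.max (tendsto_const_nhds (x := (0 : ℝ)))
  simpa [cutoff] using this

/-- Summation by parts for the truncated Hermite system. -/
theorem sum_cutoff_shift {N : ℕ} {w : ℕ → ℝ} (hwN : w N = 0) {g : ℕ → ℝ} (hg : g 0 = 0) :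
    ∑ k ∈ Finset.range N, w (k + 1) * g (k + 1) = ∑ k ∈ Finset.range N, w k * g k := by
  have h1 := Finset.sum_range_succ' (fun k => w k * g k) N
  rw [Finset.sum_range_succ, hwN, hg] at h1
  linarith

/-- `P k` and `Q k` are the flux between modes `k` and `k + 1` as seen from mode `k` and from mode
`k + 1`. Summation by parts leaves `(wₖ - wₖ₊₁) P k + wₖ₊₁ (P k - Q k)`. The first part is the
truncation error. The second is a commutator: Young's inequality hides its growing factor `√(k+1)`
in the damping `(k+1) x (k+1)²`. The pair `(0, 1)` is kept apart, since mode `0` is regularized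
differently or left out. -/
theorem sum_transport_le {N : ℕ} (hN : 0 < N) {P Q x a y : ℕ → ℝ} {C m θ r Y A : ℝ}
    (hr : 0 ≤ r) (hθ : 0 < θ) (hC : 0 ≤ C)
    (hP : ∀ k, |P k| ≤ C * (a k * a (k + 1)))
    (hPQ : ∀ k, 1 ≤ k → P k - Q k ≤ m * x (k + 1) * y k) (hy : y 0 = 0)
    (hA : ∑ k ∈ Finset.range N, a k * a (k + 1) ≤ A)
    (hY : ∑ k ∈ Finset.range N, y k ^ 2 ≤ Y) :
    ∑ k ∈ Finset.range N, cutoff N k * (2 * (r * (√((k : ℝ) + 1) * P k - √k * Q (k - 1))))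
      ≤ 2 * r * (√N)⁻¹ * C * A + 2 * r * cutoff N 1 * (P 0 - Q 0)
        + θ * ∑ k ∈ Finset.range N, cutoff N k * (k * x k ^ 2) + r ^ 2 * m ^ 2 / θ * Y := by
  have hwN : cutoff N N = 0 := cutoff_of_le hN le_rfl
  have s1 := sum_cutoff_shift hwN (g := fun k => √k * Q (k - 1)) (by simp)
  have s2 := sum_cutoff_shift hwN (g := fun k => k * x k ^ 2) (by simp)
  simp only [Nat.add_sub_cancel, Nat.cast_add, Nat.cast_one] at s1 s2
  have e1 : ∑ k ∈ Finset.range N, cutoff N k * (2 * (r * (√((k : ℝ) + 1) * P k - √k * Q (k - 1))))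
      = ∑ k ∈ Finset.range N, 2 * r * √((k : ℝ) + 1) * (cutoff N k * P k
        - cutoff N (k + 1) * Q k) := by
    have : ∀ k : ℕ, cutoff N k * (2 * (r * (√((k : ℝ) + 1) * P k - √k * Q (k - 1))))
      = 2 * r * (cutoff N k * (√((k : ℝ) + 1) * P k)) - 2 * r * (cutoff N k * (√k * Q (k - 1))) := by
      intro k; ring
    simp_rw [this]
    rw [Finset.sum_sub_distrib, ← Finset.mul_sum _ (fun k : ℕ => cutoff N k * (√k * Q (k - 1))), ← s1,
      Finset.mul_sum, ← Finset.sum_sub_distrib]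
    refine Finset.sum_congr rfl fun k _ => ?_
    ring
  have e2 : ∑ k ∈ Finset.range N, (if k = 0 then 2 * r * cutoff N 1 * (P 0 - Q 0) else 0)
      = 2 * r * cutoff N 1 * (P 0 - Q 0) := by
    rw [Finset.sum_ite_eq' (Finset.range N) 0 (fun _ => 2 * r * cutoff N 1 * (P 0 - Q 0))]
    simp [hN]
  have key : ∀ k : ℕ, 2 * r * √((k : ℝ) + 1) * (cutoff N k * P k - cutoff N (k + 1) * Q k)
      ≤ 2 * r * (√N)⁻¹ * C * (a k * a (k + 1))
        + (if k = 0 then 2 * r * cutoff N 1 * (P 0 - Q 0) else 0)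
        + θ * (cutoff N (k + 1) * ((k + 1) * x (k + 1) ^ 2)) + r ^ 2 * m ^ 2 / θ * y k ^ 2 := by
    intro k
    have hw0 := cutoff_nonneg N (k + 1)
    have hw1 := cutoff_le_one N (k + 1)
    have hwd : 0 ≤ cutoff N k - cutoff N (k + 1) := sub_nonneg.2 (cutoff_succ_le N k)
    have hs : √((k : ℝ) + 1) ^ 2 = (k : ℝ) + 1 := Real.sq_sqrt (by positivity)
    have hs0 := Real.sqrt_nonneg ((k : ℝ) + 1)
    have t1 : (cutoff N k - cutoff N (k + 1)) * √((k : ℝ) + 1) * P k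
        ≤ (√N)⁻¹ * (C * (a k * a (k + 1))) := by
      refine (mul_le_mul_of_nonneg_left ((le_abs_self _).trans (hP k))
        (mul_nonneg hwd hs0)).trans ?_
      exact mul_le_mul_of_nonneg_right (cutoff_sub_mul_le hN k) ((abs_nonneg _).trans (hP k))
    have t2 : 2 * r * √((k : ℝ) + 1) * (cutoff N (k + 1) * (P k - Q k))
        ≤ (if k = 0 then 2 * r * cutoff N 1 * (P 0 - Q 0) else 0)
        + θ * (cutoff N (k + 1) * ((k + 1) * x (k + 1) ^ 2)) + r ^ 2 * m ^ 2 / θ * y k ^ 2 := by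
      rcases Nat.eq_zero_or_pos k with rfl | hk
      · simp only [if_true, hy, Nat.cast_zero, zero_add, Real.sqrt_one] at hw0 ⊢
        have : 0 ≤ θ * (cutoff N 1 * (1 * x 1 ^ 2)) := by positivity
        nlinarith
      · rw [if_neg hk.ne', zero_add]
        have u1 : 2 * r * √((k : ℝ) + 1) * (P k - Q k)
            ≤ θ * ((k + 1) * x (k + 1) ^ 2) + r ^ 2 * m ^ 2 / θ * y k ^ 2 := by
          have u2 : 2 * r * √((k : ℝ) + 1) * (P k - Q k)
              ≤ 2 * r * √((k : ℝ) + 1) * (m * x (k + 1) * y k) :=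
            mul_le_mul_of_nonneg_left (hPQ k hk) (by positivity)
          refine u2.trans ?_
          have u3 : θ * ((k + 1) * x (k + 1) ^ 2) + r ^ 2 * m ^ 2 / θ * y k ^ 2
              - 2 * r * √((k : ℝ) + 1) * (m * x (k + 1) * y k)
              = (θ * √((k : ℝ) + 1) * x (k + 1) - r * m * y k) ^ 2 / θ := by
            generalize √((k : ℝ) + 1) = S at hs
            rw [← hs]; field_simp; ring
          have u4 : 0 ≤ (θ * √((k : ℝ) + 1) * x (k + 1) - r * m * y k) ^ 2 / θ := by positivity
          linarith
        have u5 : 0 ≤ r ^ 2 * m ^ 2 / θ * y k ^ 2 := by positivity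
        calc 2 * r * √((k : ℝ) + 1) * (cutoff N (k + 1) * (P k - Q k))
            = cutoff N (k + 1) * (2 * r * √((k : ℝ) + 1) * (P k - Q k)) := by ring
          _ ≤ cutoff N (k + 1) * (θ * ((k + 1) * x (k + 1) ^ 2) + r ^ 2 * m ^ 2 / θ * y k ^ 2) := by
            gcongr
          _ ≤ _ := by nlinarith
    have : 2 * r * √((k : ℝ) + 1) * (cutoff N k * P k - cutoff N (k + 1) * Q k)
        = 2 * r * ((cutoff N k - cutoff N (k + 1)) * √((k : ℝ) + 1) * P k)
          + 2 * r * √((k : ℝ) + 1) * (cutoff N (k + 1) * (P k - Q k)) := by ring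
    rw [this]
    nlinarith
  rw [e1]
  refine (Finset.sum_le_sum fun k _ => key k).trans ?_
  rw [Finset.sum_add_distrib, Finset.sum_add_distrib, Finset.sum_add_distrib, e2,
    ← Finset.mul_sum, ← Finset.mul_sum, ← Finset.mul_sum, s2]
  have v1 : 2 * r * (√N)⁻¹ * C * ∑ k ∈ Finset.range N, a k * a (k + 1)
      ≤ 2 * r * (√N)⁻¹ * C * A := by gcongr
  have v2 : r ^ 2 * m ^ 2 / θ * ∑ k ∈ Finset.range N, y k ^ 2 ≤ r ^ 2 * m ^ 2 / θ * Y := by gcongr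
  linarith

end Truncation

/-! ### Square summable sequences and their microscopic part -/

section Sequences

variable {H : Type*} [NormedAddCommGroup H]

theorem norm_coe_le (v : lp (fun _ : ℕ => H) 2) (k : ℕ) : ‖v k‖ ≤ ‖v‖ :=
  lp.norm_apply_le_norm (by norm_num) v k

theorem summable_norm_sq (v : lp (fun _ : ℕ => H) 2) : Summable fun k => ‖v k‖ ^ 2 := by
  simpa using (lp.memℓp v).summable (by norm_num)

theorem norm_sq_eq_tsum (v : lp (fun _ : ℕ => H) 2) : ‖v‖ ^ 2 = ∑' k, ‖v k‖ ^ 2 := by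
  simpa using lp.norm_rpow_eq_tsum (p := 2) (by norm_num) v

/-- `‖v_⊥‖²` for `v_⊥ = (0, v₁, v₂, …)`. -/
noncomputable def perpSq (v : lp (fun _ : ℕ => H) 2) : ℝ := ‖v‖ ^ 2 - ‖v 0‖ ^ 2

theorem perpSq_eq_tsum (v : lp (fun _ : ℕ => H) 2) : perpSq v = ∑' k, ‖v (k + 1)‖ ^ 2 := by
  rw [perpSq, norm_sq_eq_tsum, (summable_norm_sq v).tsum_eq_zero_add]
  ring

theorem perpSq_nonneg (v : lp (fun _ : ℕ => H) 2) : 0 ≤ perpSq v := by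
  rw [perpSq_eq_tsum]; positivity

theorem norm_sq_le_perpSq (v : lp (fun _ : ℕ => H) 2) (k : ℕ) : ‖v (k + 1)‖ ^ 2 ≤ perpSq v := by
  rw [perpSq_eq_tsum]
  exact ((summable_nat_add_iff 1).2 (summable_norm_sq v)).le_tsum k fun _ _ => by positivity

theorem norm_sq_eq_add_perpSq (v : lp (fun _ : ℕ => H) 2) : ‖v‖ ^ 2 = ‖v 0‖ ^ 2 + perpSq v := by
  rw [perpSq]; ring

theorem sum_mul_succ_le (v : lp (fun _ : ℕ => H) 2) (N : ℕ) :
    ∑ k ∈ Finset.range N, ‖v k‖ * ‖v (k + 1)‖ ≤ ‖v‖ ^ 2 := by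
  have h1 : ∑ k ∈ Finset.range N, ‖v k‖ ^ 2 ≤ ‖v‖ ^ 2 := by
    rw [norm_sq_eq_tsum]
    exact (summable_norm_sq v).sum_le_tsum _ fun _ _ => by positivity
  have h2 : ∑ k ∈ Finset.range N, ‖v (k + 1)‖ ^ 2 ≤ ‖v‖ ^ 2 := by
    refine le_trans ?_ (show perpSq v ≤ ‖v‖ ^ 2 by rw [perpSq]; nlinarith [sq_nonneg ‖v 0‖])
    rw [perpSq_eq_tsum]
    exact ((summable_nat_add_iff 1).2 (summable_norm_sq v)).sum_le_tsum _ fun _ _ => by positivity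
  have h3 : ∑ k ∈ Finset.range N, ‖v k‖ * ‖v (k + 1)‖
      ≤ ∑ k ∈ Finset.range N, (‖v k‖ ^ 2 + ‖v (k + 1)‖ ^ 2) / 2 :=
    Finset.sum_le_sum fun k _ => by nlinarith [sq_nonneg (‖v k‖ - ‖v (k + 1)‖)]
  rw [← Finset.sum_div, Finset.sum_add_distrib] at h3
  linarith

theorem sum_perp_le (v : lp (fun _ : ℕ => H) 2) (N : ℕ) :
    ∑ k ∈ Finset.range N, (if k = 0 then 0 else ‖v k‖) ^ 2 ≤ perpSq v := by
  cases N with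
  | zero => simpa using perpSq_nonneg v
  | succ N =>
    rw [Finset.sum_range_succ', perpSq_eq_tsum]
    simp only [Nat.add_eq_zero_iff, one_ne_zero, and_false, if_false, if_true]
    simpa using
      ((summable_nat_add_iff 1).2 (summable_norm_sq v)).sum_le_tsum _ fun _ _ => by positivity

theorem continuousOn_apply {D : ℝ → lp (fun _ : ℕ => H) 2} {s : Set ℝ} (hD : ContinuousOn D s)
    (k : ℕ) : ContinuousOn (fun t => D t k) s := by
  have : LipschitzWith 1 (fun v : lp (fun _ : ℕ => H) 2 => v k) := by
    refine LipschitzWith.of_dist_le_mul fun u v => ?_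
    rw [dist_eq_norm, dist_eq_norm, NNReal.coe_one, one_mul, ← Pi.sub_apply, ← lp.coeFn_sub]
    exact lp.norm_apply_le_norm (by norm_num) (u - v) k
  exact this.continuous.comp_continuousOn hD

theorem continuousOn_perpSq {D : ℝ → lp (fun _ : ℕ => H) 2} {s : Set ℝ}
    (hD : ContinuousOn D s) : ContinuousOn (fun t => perpSq (D t)) s :=
  (hD.norm.pow 2).sub ((continuousOn_apply hD 0).norm.pow 2)

end Sequences

end VFP

namespace VFP

/-! ### Weak solutions of the Hermite system and the truncated energy -/

section Hermite

variable {H : Type*} [NormedAddCommGroup H] [InnerProductSpace ℝ H]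

/-- Weak solutions of `∂ₜ Dₖ + r (√k A Dₖ₋₁ - √(k+1) B Dₖ₊₁) = -k Dₖ`. -/
structure IsWeakSol (A : Submodule ℝ (H × H)) (b : H →L[ℝ] H) (r : ℝ)
    (D : ℝ → lp (fun _ : ℕ => H) 2) : Prop where
  continuousOn : ContinuousOn D (Ici 0)
  weak : ∀ (k : ℕ) (φ w : H), (φ, w) ∈ A → ∀ t : ℝ, 0 ≤ t →
    HasDerivWithinAt (fun s : ℝ => inner ℝ (D s k) φ)
      (-r * (√(k : ℝ) * inner ℝ (D t (k - 1)) (b φ - w)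
          - √((k : ℝ) + 1) * inner ℝ (D t (k + 1)) w) - k * inner ℝ (D t k) φ) (Ici 0) t

variable {A B : Submodule ℝ (H × H)} {b M : H →L[ℝ] H} {e : H} {cP δ r : ℝ}
  {R W R' W' : H →L[ℝ] H} {D : ℝ → lp (fun _ : ℕ => H) 2}

/-- The adjoint `T` of `S` maps into the domain of `A`, so the weak equation can be tested with `T
ψ` for every `ψ`. All operators that appear are then bounded, and `S Dₖ` is differentiable in norm.
-/
theorem IsWeakSol.exists_deriv [CompleteSpace H] (hD : IsWeakSol A b r D)
    {S T TA : H →L[ℝ] H} (hT : ∀ ψ, (T ψ, TA ψ) ∈ A)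
    (hS : ∀ f ψ, inner ℝ (S f) ψ = inner ℝ f (T ψ)) (k : ℕ) :
    ∃ F : ℝ → H, (∀ t, 0 ≤ t → HasDerivWithinAt (fun s => S (D s k)) (F t) (Ici 0) t) ∧
      ∀ t ψ, inner ℝ (F t) ψ = -r * (√(k : ℝ) * inner ℝ (D t (k - 1)) (b (T ψ) - TA ψ)
          - √((k : ℝ) + 1) * inner ℝ (D t (k + 1)) (TA ψ)) - k * inner ℝ (D t k) (T ψ) := by
  set F : ℝ → H := fun t => (-r) • (√(k : ℝ) •
    (ContinuousLinearMap.adjoint (b.comp T - TA)) (D t (k - 1))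
    - √((k : ℝ) + 1) • (ContinuousLinearMap.adjoint TA) (D t (k + 1)))
    - (k : ℝ) • (ContinuousLinearMap.adjoint T) (D t k) with hF
  have hFi : ∀ t ψ, inner ℝ (F t) ψ = -r * (√(k : ℝ) * inner ℝ (D t (k - 1)) (b (T ψ) - TA ψ)
          - √((k : ℝ) + 1) * inner ℝ (D t (k + 1)) (TA ψ)) - k * inner ℝ (D t k) (T ψ) := by
    intro t ψ
    simp only [hF, inner_sub_left, inner_smul_left, conj_trivial,
      ContinuousLinearMap.adjoint_inner_left]
    rfl
  refine ⟨F, fun t ht => hasDerivWithinAt_of_inner ?_ (fun ψ s hs => ?_) ht, hFi⟩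
  · have c := fun k => continuousOn_apply hD.continuousOn k
    exact (((((ContinuousLinearMap.continuous _).comp_continuousOn (c _)).const_smul _).sub
      (((ContinuousLinearMap.continuous _).comp_continuousOn (c _)).const_smul _)).const_smul _).sub
      (((ContinuousLinearMap.continuous _).comp_continuousOn (c _)).const_smul _)
  · simp only [hS, hFi]
    exact hD.weak k (T ψ) (TA ψ) (hT ψ) s hs

/-- The derivative of a quadratic form of a mode under a smoothing symmetric operator. -/
theorem IsWeakSol.hasDeriv_inner_symm [CompleteSpace H] (hD : IsWeakSol A b r D)
    {S SA : H →L[ℝ] H} (hT : ∀ ψ, (S ψ, SA ψ) ∈ A)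
    (hS : ∀ f ψ, inner ℝ (S f) ψ = inner ℝ f (S ψ)) (k : ℕ) {t : ℝ} (ht : 0 ≤ t) :
    HasDerivWithinAt (fun s => inner ℝ (S (D s k)) (D s k))
      (2 * (-r * (√(k : ℝ) * inner ℝ (D t (k - 1)) (b (S (D t k)) - SA (D t k))
          - √((k : ℝ) + 1) * inner ℝ (D t (k + 1)) (SA (D t k)))
        - k * inner ℝ (S (D t k)) (D t k))) (Ici 0) t := by
  obtain ⟨F, hF, hFi⟩ := hD.exists_deriv hT hS k
  have := hasDerivWithinAt_inner_of_symm hS (hF t ht) (continuousOn_apply hD.continuousOn k t ht)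
  rw [hFi, ← hS] at this
  exact this

theorem IsWeakSol.hasDeriv_norm_sq [CompleteSpace H] (hD : IsWeakSol A b r D)
    {S T TA : H →L[ℝ] H} (hT : ∀ ψ, (T ψ, TA ψ) ∈ A)
    (hS : ∀ f ψ, inner ℝ (S f) ψ = inner ℝ f (T ψ)) (k : ℕ) {t : ℝ} (ht : 0 ≤ t) :
    HasDerivWithinAt (fun s => ‖S (D s k)‖ ^ 2)
      (2 * (-r * (√(k : ℝ) * inner ℝ (D t (k - 1)) (b (T (S (D t k))) - TA (S (D t k)))
          - √((k : ℝ) + 1) * inner ℝ (D t (k + 1)) (TA (S (D t k))))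
        - k * ‖S (D t k)‖ ^ 2)) (Ici 0) t := by
  obtain ⟨F, hF, hFi⟩ := hD.exists_deriv hT hS k
  have := (hF t ht).norm_sq
  rw [real_inner_comm, hFi, ← hS, real_inner_self_eq_norm_sq] at this
  exact this

/-- Truncated and regularized `‖v_⊥‖²`. -/
noncomputable def perpEnergy (R' : H →L[ℝ] H) (N : ℕ) (v : lp (fun _ : ℕ => H) 2) : ℝ :=
  ∑ k ∈ Finset.range N, cutoff N k * (if k = 0 then 0 else inner ℝ (R' (v k)) (v k))

theorem perpEnergy_nonneg (h : IsAdjointPair A B) (hR' : IsResolvent B A δ R' W') (N : ℕ)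
    (v : lp (fun _ : ℕ => H) 2) : 0 ≤ perpEnergy R' N v := by
  refine Finset.sum_nonneg fun k _ => mul_nonneg (cutoff_nonneg N k) ?_
  split_ifs
  · exact le_rfl
  · rw [hR'.inner_self h.symm]
    have := hR'.pos
    positivity

theorem inner_resolvent_le_norm_sq (h : IsAdjointPair A B) (hR' : IsResolvent B A δ R' W')
    (x : H) : inner ℝ (R' x) x ≤ ‖x‖ ^ 2 := by
  rw [hR'.inner_self h.symm]; exact hR'.norm_sq_le h.symm x

theorem perpEnergy_le (h : IsAdjointPair A B) (hR' : IsResolvent B A δ R' W') (N : ℕ)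
    (v : lp (fun _ : ℕ => H) 2) : perpEnergy R' N v ≤ perpSq v := by
  refine le_trans (Finset.sum_le_sum fun k _ => ?_) (sum_perp_le v N)
  split_ifs with hk
  · simp
  · refine (mul_le_mul_of_nonneg_left (inner_resolvent_le_norm_sq h hR' _)
      (cutoff_nonneg N k)).trans ?_
    nlinarith [cutoff_le_one N k, sq_nonneg ‖v k‖]

theorem continuousOn_perpEnergy (N : ℕ) {s : Set ℝ} (hD : ContinuousOn D s) :
    ContinuousOn (fun t => perpEnergy R' N (D t)) s := by
  unfold perpEnergy
  refine continuousOn_finsetSum _ fun k _ => continuousOn_const.mul ?_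
  split_ifs
  · exact continuousOn_const
  · exact (R'.continuous.comp_continuousOn (continuousOn_apply hD k)).inner
      (continuousOn_apply hD k)

theorem tendsto_perpEnergy (h : IsAdjointPair A B) {δ : ℕ → ℝ} {R' W' : ℕ → H →L[ℝ] H}
    (hR' : ∀ n, IsResolvent B A (δ n) (R' n) (W' n)) (hδ : Tendsto δ atTop (𝓝 0)) {N : ℕ → ℕ}
    (hN : ∀ n, 0 < N n) (hNt : Tendsto N atTop atTop) (v : lp (fun _ : ℕ => H) 2) :
    Tendsto (fun n => perpEnergy (R' n) (N n) v) atTop (𝓝 (perpSq v)) := by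
  have h1 : perpSq v = ∑' k, if k = 0 then 0 else ‖v k‖ ^ 2 := by
    have hs : Summable fun k => if k = 0 then 0 else ‖v k‖ ^ 2 :=
      Summable.of_nonneg_of_le (fun k => by positivity)
        (fun k => by split_ifs; exacts [by positivity, le_rfl]) (summable_norm_sq v)
    rw [hs.tsum_eq_zero_add, perpSq_eq_tsum]
    simp
  have h2 : ∀ n, perpEnergy (R' n) (N n) v = ∑' k, cutoff (N n) k *
      (if k = 0 then 0 else inner ℝ (R' n (v k)) (v k)) := fun n => by
    rw [perpEnergy, tsum_eq_sum]
    intro k hk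
    rw [cutoff_of_le (hN n) (by simpa using hk), zero_mul]
  simp_rw [h1, h2]
  refine tendsto_tsum_of_dominated_convergence (bound := fun k => ‖v k‖ ^ 2)
    (summable_norm_sq v) (fun k => ?_) (Eventually.of_forall fun n k => ?_)
  · have h3 := (tendsto_cutoff k).comp hNt
    split_ifs with hk
    · simp
    · have h4 := (IsResolvent.tendsto h.symm hR' hδ (v k)).inner (𝕜 := ℝ)
        (tendsto_const_nhds (x := v k))
      rw [real_inner_self_eq_norm_sq] at h4
      simpa using h3.mul h4
  · split_ifs with hk
    · simp
    · have h5 : 0 ≤ inner ℝ (R' n (v k)) (v k) := by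
        rw [(hR' n).inner_self h.symm]
        have := (hR' n).pos
        positivity
      rw [Real.norm_of_nonneg (mul_nonneg (cutoff_nonneg _ _) h5)]
      calc _ ≤ 1 * ‖v k‖ ^ 2 := mul_le_mul (cutoff_le_one _ _)
            (inner_resolvent_le_norm_sq h (hR' n) _) h5 zero_le_one
        _ = _ := one_mul _

variable [CompleteSpace H] (h : HermitePair A B b M e cP)
include h

/-- The truncated `L²` estimate. -/
theorem IsWeakSol.exists_deriv_perpEnergy (hD : IsWeakSol A b r D) (hr : 0 < r)
    (hR : IsResolvent A B δ R W) (hR' : IsResolvent B A δ R' W') (hδ1 : δ ≤ 1) {N : ℕ}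
    (hN : 0 < N) {t : ℝ} (ht : 0 ≤ t) :
    ∃ d, HasDerivWithinAt (fun s => perpEnergy R' N (D s)) d (Ici 0) t ∧
      d ≤ -(2 - √δ) * perpEnergy R' N (D t) - 2 * r * cutoff N 1 * inner ℝ (D t 1) (W (D t 0))
        + (2 * r * (√N)⁻¹ * (‖b‖ + (√δ)⁻¹) + r ^ 2 * ‖M‖ ^ 2 * √δ) * ‖D t‖ ^ 2 := by
  have hp := h.toIsAdjointPair
  have hmem : ∀ ψ, (R' ψ, (b.comp R' - W') ψ) ∈ A := fun ψ => h.add_right (hR'.fst ψ)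
  -- In `P k` the mode `k ≥ 1` carries `A R'`. In `Q k` the operator `A R` arises as the adjoint of
  -- `B R'` acting on mode `k + 1`. The two differ by the commutator of the resolvents.
  set P : ℕ → ℝ := fun k =>
    if k = 0 then 0 else inner ℝ (D t (k + 1)) (b (R' (D t k)) - W' (D t k)) with hP
  set Q : ℕ → ℝ := fun k => inner ℝ (D t (k + 1)) (W (D t k)) with hQ
  set E : ℕ → ℝ := fun k => if k = 0 then 0 else inner ℝ (R' (D t k)) (D t k) with hE
  have hs := Real.sqrt_pos.2 hR.pos
  have hE0 : ∀ k, 0 ≤ E k := fun k => by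
    simp only [hE]
    split_ifs
    · exact le_rfl
    · rw [hR'.inner_self hp.symm]
      have := hR'.pos
      positivity
  have hderiv : ∀ k, HasDerivWithinAt
      (fun s => if k = 0 then 0 else inner ℝ (R' (D s k)) (D s k))
      (2 * (r * (√((k : ℝ) + 1) * P k - √k * Q (k - 1))) - 2 * (k * E k)) (Ici 0) t := by
    intro k
    rcases Nat.eq_zero_or_pos k with rfl | hk
    · simpa [hP, hE] using hasDerivWithinAt_const t (Ici 0) (0 : ℝ)
    · simp only [hP, hQ, hE, if_neg hk.ne']
      have h1 := hD.hasDeriv_inner_symm hmem (fun f ψ => hR'.symm hp.symm f ψ) k ht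
      convert h1 using 1
      rw [Nat.sub_add_cancel hk]
      have h2 : inner ℝ (D t k) (W (D t (k - 1))) = inner ℝ (D t (k - 1)) (W' (D t k)) := by
        rw [real_inner_comm, hR.inner_apply hp hR']
      simp only [sub_apply, ContinuousLinearMap.comp_apply, sub_sub_cancel]
      rw [h2]
      ring
  refine ⟨_, HasDerivWithinAt.fun_sum fun k _ => (hderiv k).const_mul (cutoff N k), ?_⟩
  -- With `m = √δ ‖M‖` and `θ = √δ` Young's inequality costs a fraction `√δ` of the damping and
  -- leaves the error `r² ‖M‖² √δ`; both vanish with `δ`.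
  have hsum := sum_transport_le (N := N) hN (P := P) (Q := Q) (x := fun k => √(E k))
    (a := fun k => ‖D t k‖) (y := fun k => if k = 0 then 0 else ‖D t k‖)
    (C := ‖b‖ + (√δ)⁻¹) (m := √δ * ‖M‖) (θ := √δ) (r := r) (Y := ‖D t‖ ^ 2) (A := ‖D t‖ ^ 2)
    hr.le hs (by positivity) (fun k => ?_) (fun k hk => ?_) (by simp) (sum_mul_succ_le _ _)
    ((sum_perp_le _ _).trans (by rw [perpSq]; nlinarith [sq_nonneg ‖D t 0‖]))
  · have e1 : ∑ k ∈ Finset.range N, cutoff N k *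
        (2 * (r * (√((k : ℝ) + 1) * P k - √k * Q (k - 1))) - 2 * (k * E k))
        = ∑ k ∈ Finset.range N, cutoff N k * (2 * (r * (√((k : ℝ) + 1) * P k - √k * Q (k - 1))))
          - 2 * ∑ k ∈ Finset.range N, cutoff N k * (k * E k) := by
      rw [Finset.mul_sum, ← Finset.sum_sub_distrib]
      exact Finset.sum_congr rfl fun k _ => by ring
    simp only [Real.sq_sqrt (hE0 _)] at hsum
    have e2 : P 0 - Q 0 = - inner ℝ (D t 1) (W (D t 0)) := by simp [hP, hQ]
    have e3 : perpEnergy R' N (D t) ≤ ∑ k ∈ Finset.range N, cutoff N k * (k * E k) := by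
      refine Finset.sum_le_sum fun k _ => mul_le_mul_of_nonneg_left ?_ (cutoff_nonneg N k)
      change E k ≤ k * E k
      rcases Nat.eq_zero_or_pos k with rfl | hk
      · simp [hE]
      · have : (1 : ℝ) ≤ k := by exact_mod_cast hk
        nlinarith [hE0 k]
    have e4 : r ^ 2 * (√δ * ‖M‖) ^ 2 / √δ = r ^ 2 * ‖M‖ ^ 2 * √δ := by
      field_simp
    rw [e1]
    rw [e2, e4] at hsum
    have e5 : √δ ≤ 1 := Real.sqrt_le_one.2 hδ1
    nlinarith
  · simp only [hP]
    split_ifs with hk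
    · rw [abs_zero]; positivity
    · refine (abs_real_inner_le_norm _ _).trans ?_
      have n1 : ‖b (R' (D t k)) - W' (D t k)‖ ≤ (‖b‖ + (√δ)⁻¹) * ‖D t k‖ := by
        refine (norm_sub_le _ _).trans ?_
        rw [add_mul]
        refine add_le_add ((b.le_opNorm _).trans ?_) (hR'.norm_apply_snd_le hp.symm _)
        gcongr
        exact hR'.norm_apply_le hp.symm _
      calc _ ≤ ‖D t (k + 1)‖ * ((‖b‖ + (√δ)⁻¹) * ‖D t k‖) := by gcongr
        _ = _ := by ring
  · have hk' : k ≠ 0 := by omega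
    simp only [hP, hQ, hE, if_neg hk', if_neg k.succ_ne_zero]
    exact h.inner_commutator_le hR hR' _ _

end Hermite

end VFP

/-! ### Removing the regularization: the `L²` estimates -/

namespace VFP

/-- Integrate the differential inequalities, pass to the limit by dominated convergence and
differentiate again in the Dini sense. -/
theorem UpperSlopeLE.of_tendsto {f ψ g : ℝ → ℝ} {fn ψn : ℕ → ℝ → ℝ}
    (hd : ∀ n t, 0 ≤ t → ∃ d, HasDerivWithinAt (fn n) d (Ici 0) t ∧ d ≤ ψn n t)
    (hψn : ∀ n, ContinuousOn (ψn n) (Ici 0))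
    (hf : ∀ t, 0 ≤ t → Tendsto (fun n => fn n t) atTop (𝓝 (f t)))
    (hψ : ∀ t, 0 ≤ t → Tendsto (fun n => ψn n t) atTop (𝓝 (ψ t)))
    (hg : ContinuousOn g (Ici 0)) (hb : ∀ n t, 0 ≤ t → |ψn n t| ≤ g t)
    (hψc : ContinuousOn ψ (Ici 0)) : UpperSlopeLE f ψ := by
  refine UpperSlopeLE.of_integral hψc fun s t hs hst => ?_
  have hsub : Icc s t ⊆ Ici (0 : ℝ) := fun x hx => hs.trans hx.1
  have hn : ∀ n, fn n t - fn n s ≤ ∫ x in s..t, ψn n x := by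
    intro n
    choose! d hd1 hd2 using hd n
    refine intervalIntegral.sub_le_integral_of_hasDeriv_right_of_le (g' := d) hst
      (fun x hx => ((hd1 x (hsub hx)).continuousWithinAt).mono hsub)
      (fun x hx => (hd1 x (hsub (Ioo_subset_Icc_self hx))).mono ?_)
      (((hψn n).mono hsub).integrableOn_Icc)
      (fun x hx => hd2 x (hsub (Ioo_subset_Icc_self hx)))
    exact fun y hy => mem_Ici.2 ((mem_Ici.1 (hsub (Ioo_subset_Icc_self hx))).trans (le_of_lt hy))
  have hI : Tendsto (fun n => ∫ x in s..t, ψn n x) atTop (𝓝 (∫ x in s..t, ψ x)) := by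
    refine intervalIntegral.tendsto_integral_filter_of_dominated_convergence g
      (Eventually.of_forall fun n => ?_) (Eventually.of_forall fun n => ?_) ?_ ?_
    · rw [uIoc_of_le hst]
      exact (((hψn n).mono hsub).mono Ioc_subset_Icc_self).aestronglyMeasurable measurableSet_Ioc
    · refine Eventually.of_forall fun x hx => ?_
      rw [uIoc_of_le hst] at hx
      exact hb n x (hsub (Ioc_subset_Icc_self hx))
    · refine ContinuousOn.intervalIntegrable ?_
      rw [uIcc_of_le hst]
      exact hg.mono hsub
    · refine Eventually.of_forall fun x hx => ?_
      rw [uIoc_of_le hst] at hx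
      exact hψ x (hsub (Ioc_subset_Icc_self hx))
  exact le_of_tendsto_of_tendsto' ((hf t (hs.trans hst)).sub (hf s hs)) hI hn

section Hermite

variable {H : Type*} [NormedAddCommGroup H] [InnerProductSpace ℝ H]
variable {A B : Submodule ℝ (H × H)} {b M : H →L[ℝ] H} {e : H} {cP δ r : ℝ}
  {R W R' W' : H →L[ℝ] H} {D : ℝ → lp (fun _ : ℕ => H) 2}

variable [CompleteSpace H]

/-- Resolvents with parameters tending to `0`, and cutoffs for which the truncation error
vanishes. -/
theorem IsAdjointPair.exists_seq (h : IsAdjointPair A B) (β m r : ℝ) :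
    ∃ (δ : ℕ → ℝ) (R W R' W' : ℕ → H →L[ℝ] H) (N : ℕ → ℕ),
      (∀ n, IsResolvent A B (δ n) (R n) (W n)) ∧ (∀ n, IsResolvent B A (δ n) (R' n) (W' n)) ∧
      (∀ n, δ n ≤ 1) ∧ (∀ n, 0 < N n) ∧ Tendsto δ atTop (𝓝 0) ∧ Tendsto N atTop atTop ∧
      Tendsto (fun n => 2 * r * (√(N n))⁻¹ * (β + (√(δ n))⁻¹) + r ^ 2 * m ^ 2 * √(δ n))
        atTop (𝓝 0) ∧ Tendsto (fun n => 2 * r * (√(N n))⁻¹ * (√(δ n))⁻¹) atTop (𝓝 0) := by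
  set u : ℕ → ℝ := fun n => ((n : ℝ) + 1)⁻¹ with hu
  have hu0 : ∀ n, 0 < u n := fun n => by positivity
  have hut : Tendsto u atTop (𝓝 0) := by simpa [hu] using tendsto_one_div_add_atTop_nhds_zero_nat (𝕜 := ℝ)
  have hδ : ∀ n, 0 < u n ^ 2 := fun n => pow_pos (hu0 n) 2
  choose R W hR using fun n => h.exists_isResolvent (hδ n)
  choose R' W' hR' using fun n => h.symm.exists_isResolvent (hδ n)
  have e1 : ∀ n, √(u n ^ 2) = u n := fun n => Real.sqrt_sq (hu0 n).le
  have e2 : ∀ n : ℕ, (√(((n + 1) ^ 4 : ℕ) : ℝ))⁻¹ = u n ^ 2 := fun n => by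
    rw [show (((n + 1) ^ 4 : ℕ) : ℝ) = (((n : ℝ) + 1) ^ 2) ^ 2 by push_cast; ring,
      Real.sqrt_sq (by positivity), hu, inv_pow]
  -- With `√δ = u` and `1 / √N = u²`, the factor `1 / √N` beats the blow-up `1 / √δ` of `‖W‖`.
  refine ⟨fun n => u n ^ 2, R, W, R', W', fun n => (n + 1) ^ 4, hR, hR', fun n => ?_, fun n => ?_,
    ?_, ?_, ?_, ?_⟩
  · exact pow_le_one₀ (hu0 n).le (inv_le_one_of_one_le₀ (by
      have : (0 : ℝ) ≤ n := n.cast_nonneg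
      linarith))
  · positivity
  · simpa using hut.pow 2
  · exact tendsto_atTop_mono (fun n => (Nat.le_succ n).trans (Nat.le_self_pow (by norm_num) _))
      tendsto_id
  · simp_rw [e1, e2]
    have : ∀ n, 2 * r * u n ^ 2 * (β + (u n)⁻¹) + r ^ 2 * m ^ 2 * u n
        = 2 * r * β * (u n ^ 2) + 2 * r * u n + r ^ 2 * m ^ 2 * u n := fun n => by
      have := (hu0 n).ne'
      field_simp
    simp_rw [this]
    simpa using (((hut.pow 2).const_mul (2 * r * β)).add (hut.const_mul (2 * r))).add
      (hut.const_mul (r ^ 2 * m ^ 2))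
  · simp_rw [e1, e2]
    have : ∀ n, 2 * r * u n ^ 2 * (u n)⁻¹ = 2 * r * u n := fun n => by
      have := (hu0 n).ne'
      field_simp
    simp_rw [this]
    simpa using hut.const_mul (2 * r)

variable (h : HermitePair A B b M e cP)
include h

/-- The `L²` estimate for `D_⊥`. -/
theorem IsWeakSol.upperSlope_perpSq (hD : IsWeakSol A b r D) (hr : 0 < r) {g : ℝ → ℝ}
    (hg : ContinuousOn g (Ici 0))
    (hW : ∀ δ R W, IsResolvent A B δ R W → δ ≤ 1 → ∀ t, 0 ≤ t → ‖W (D t 0)‖ ≤ g t) :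
    UpperSlopeLE (fun t => perpSq (D t))
      (fun t => -2 * perpSq (D t) + 2 * r * g t * √(perpSq (D t))) := by
  have hp := h.toIsAdjointPair
  obtain ⟨δ, R, W, R', W', N, hR, hR', hδ1, hN, hδ, hNt, herr, -⟩ := hp.exists_seq ‖b‖ ‖M‖ r
  set err : ℕ → ℝ := fun n => 2 * r * (√(N n))⁻¹ * (‖b‖ + (√(δ n))⁻¹) + r ^ 2 * ‖M‖ ^ 2 * √(δ n)
    with herr'
  have herr0 : ∀ n, 0 ≤ err n := fun n => by positivity
  obtain ⟨Ce, hCe⟩ := herr.bddAbove_range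
  have hCe' : ∀ n, err n ≤ Ce := fun n => hCe ⟨n, rfl⟩
  have cD := hD.continuousOn
  have cP := continuousOn_perpSq cD
  have hg0 : ∀ t, 0 ≤ t → 0 ≤ g t := fun t ht => (norm_nonneg _).trans (hW _ _ _ (hR 0) (hδ1 0) t ht)
  refine UpperSlopeLE.of_tendsto (fn := fun n t => perpEnergy (R' n) (N n) (D t))
    (ψn := fun n t => -(2 - √(δ n)) * perpEnergy (R' n) (N n) (D t)
      + 2 * r * g t * √(perpSq (D t)) + err n * ‖D t‖ ^ 2)
    (g := fun t => 2 * perpSq (D t) + 2 * r * g t * √(perpSq (D t)) + Ce * ‖D t‖ ^ 2)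
    (fun n t ht => ?_) (fun n => ?_) (fun t ht => ?_) (fun t ht => ?_) ?_ (fun n t ht => ?_) ?_
  · obtain ⟨d, hd, hle⟩ := hD.exists_deriv_perpEnergy h hr (hR n) (hR' n) (hδ1 n) (hN n) ht
    refine ⟨d, hd, hle.trans ?_⟩
    have h1 := abs_real_inner_le_norm (D t 1) (W n (D t 0))
    have h2 : ‖D t 1‖ ≤ √(perpSq (D t)) := Real.le_sqrt_of_sq_le (norm_sq_le_perpSq (D t) 0)
    have h3 : |inner ℝ (D t 1) (W n (D t 0))| ≤ √(perpSq (D t)) * g t :=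
      h1.trans (mul_le_mul h2 (hW _ _ _ (hR n) (hδ1 n) t ht) (norm_nonneg _) (Real.sqrt_nonneg _))
    have h4 := cutoff_nonneg (N n) 1
    have h5 := cutoff_le_one (N n) 1
    have h6 : -(cutoff (N n) 1 * inner ℝ (D t 1) (W n (D t 0))) ≤ √(perpSq (D t)) * g t := by
      have h7 := (neg_le_abs (cutoff (N n) 1 * inner ℝ (D t 1) (W n (D t 0))))
      rw [abs_mul, abs_of_nonneg h4] at h7
      refine h7.trans ?_
      calc _ ≤ 1 * (√(perpSq (D t)) * g t) := mul_le_mul h5 h3 (abs_nonneg _) zero_le_one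
        _ = _ := one_mul _
    nlinarith
  · exact ((continuousOn_const.mul (continuousOn_perpEnergy _ cD)).add
      ((continuousOn_const.mul hg).mul cP.sqrt)).add (continuousOn_const.mul (cD.norm.pow 2))
  · exact tendsto_perpEnergy hp hR' hδ hN hNt _
  · have h1 := tendsto_perpEnergy hp hR' hδ hN hNt (D t)
    have h2 : Tendsto (fun n => -(2 - √(δ n))) atTop (𝓝 (-2)) := by
      simpa using ((hδ.sqrt).const_sub 2).neg
    simpa using ((h2.mul h1).add_const (2 * r * g t * √(perpSq (D t)))).add
      (herr.mul_const (‖D t‖ ^ 2))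
  · exact ((continuousOn_const.mul cP).add
      ((continuousOn_const.mul hg).mul cP.sqrt)).add (continuousOn_const.mul (cD.norm.pow 2))
  · have h1 := perpEnergy_nonneg hp (hR' n) (N n) (D t)
    have h2 := perpEnergy_le hp (hR' n) (N n) (D t)
    have h3 : √(δ n) ≤ 1 := Real.sqrt_le_one.2 (hδ1 n)
    have h4 := Real.sqrt_nonneg (δ n)
    have h5 : 0 ≤ 2 * r * g t * √(perpSq (D t)) := by
      have := hg0 t ht
      positivity
    have h6 : err n * ‖D t‖ ^ 2 ≤ Ce * ‖D t‖ ^ 2 := by gcongr; exact hCe' n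
    have h7 : 0 ≤ err n * ‖D t‖ ^ 2 := mul_nonneg (herr0 n) (sq_nonneg _)
    rw [abs_le]
    constructor <;> nlinarith
  · exact (continuousOn_const.mul cP).add ((continuousOn_const.mul hg).mul cP.sqrt)

/-- The `L²` estimate. -/
theorem IsWeakSol.upperSlope_norm_sq (hD : IsWeakSol A b r D) (hr : 0 < r) :
    UpperSlopeLE (fun t => ‖D t‖ ^ 2) (fun t => -2 * perpSq (D t)) := by
  have hp := h.toIsAdjointPair
  obtain ⟨δ, R, W, R', W', N, hR, hR', hδ1, hN, hδ, hNt, herr, herr2⟩ := hp.exists_seq ‖b‖ ‖M‖ r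
  set err : ℕ → ℝ := fun n => 2 * r * (√(N n))⁻¹ * (‖b‖ + (√(δ n))⁻¹) + r ^ 2 * ‖M‖ ^ 2 * √(δ n)
    + 2 * r * (√(N n))⁻¹ * (√(δ n))⁻¹ with herr'
  have herr3 : Tendsto err atTop (𝓝 0) := by simpa using herr.add herr2
  have herr0 : ∀ n, 0 ≤ err n := fun n => by positivity
  obtain ⟨Ce, hCe⟩ := herr3.bddAbove_range
  have hCe' : ∀ n, err n ≤ Ce := fun n => hCe ⟨n, rfl⟩
  have cD := hD.continuousOn
  have cP := continuousOn_perpSq cD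
  refine UpperSlopeLE.of_tendsto
    (fn := fun n t => perpEnergy (R' n) (N n) (D t) + inner ℝ (R n (D t 0)) (D t 0))
    (ψn := fun n t => -(2 - √(δ n)) * perpEnergy (R' n) (N n) (D t) + err n * ‖D t‖ ^ 2)
    (g := fun t => 2 * perpSq (D t) + Ce * ‖D t‖ ^ 2)
    (fun n t ht => ?_) (fun n => ?_) (fun t ht => ?_) (fun t ht => ?_) ?_ (fun n t ht => ?_) ?_
  · obtain ⟨d, hd, hle⟩ := hD.exists_deriv_perpEnergy h hr (hR n) (hR' n) (hδ1 n) (hN n) ht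
    have hd2 := hD.hasDeriv_inner_symm (hR n).fst (fun f ψ => (hR n).symm hp f ψ) 0 ht
    refine ⟨_, hd.add hd2, ?_⟩
    have h1 := abs_real_inner_le_norm (D t 1) (W n (D t 0))
    have h3 : |inner ℝ (D t 1) (W n (D t 0))| ≤ (√(δ n))⁻¹ * ‖D t‖ ^ 2 := by
      refine h1.trans ?_
      have n1 := (hR n).norm_apply_snd_le hp (D t 0)
      have n2 := norm_coe_le (D t) 0
      have n3 := norm_coe_le (D t) 1
      have n4 : 0 ≤ (√(δ n))⁻¹ := by positivity
      calc _ ≤ ‖D t‖ * ((√(δ n))⁻¹ * ‖D t‖) := by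
            gcongr
            exact n1.trans (by gcongr)
        _ = _ := by ring
    -- Mode `0` contributes `2 r ⟨D₁, W D₀⟩`, which cancels the boundary flux of `perpEnergy` except
    -- for the cutoff weight of mode `1`.
    have h4 : 1 - cutoff (N n) 1 ≤ (√(N n))⁻¹ := by
      simpa [cutoff_zero] using cutoff_sub_mul_le (hN n) 0
    have h5 := cutoff_le_one (N n) 1
    have h6 : (1 - cutoff (N n) 1) * inner ℝ (D t 1) (W n (D t 0))
        ≤ (√(N n))⁻¹ * ((√(δ n))⁻¹ * ‖D t‖ ^ 2) := by
      refine (mul_le_mul_of_nonneg_left ((le_abs_self _).trans h3) (by linarith)).trans ?_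
      gcongr
    simp only [Nat.cast_zero, Real.sqrt_zero, zero_mul, zero_add, Real.sqrt_one, one_mul, zero_sub,
      sub_zero]
    have h7 : 2 * r * ((1 - cutoff (N n) 1) * inner ℝ (D t 1) (W n (D t 0)))
        ≤ 2 * r * ((√(N n))⁻¹ * ((√(δ n))⁻¹ * ‖D t‖ ^ 2)) := by gcongr
    simp only [herr']
    linarith
  · exact (continuousOn_const.mul (continuousOn_perpEnergy _ cD)).add
      (continuousOn_const.mul (cD.norm.pow 2))
  · rw [norm_sq_eq_add_perpSq, add_comm]
    refine (tendsto_perpEnergy hp hR' hδ hN hNt _).add ?_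
    have := (IsResolvent.tendsto hp hR hδ (D t 0)).inner (𝕜 := ℝ)
        (tendsto_const_nhds (x := D t 0))
    rwa [real_inner_self_eq_norm_sq] at this
  · have h1 := tendsto_perpEnergy hp hR' hδ hN hNt (D t)
    have h2 : Tendsto (fun n => -(2 - √(δ n))) atTop (𝓝 (-2)) := by
      simpa using ((hδ.sqrt).const_sub 2).neg
    simpa using (h2.mul h1).add (herr3.mul_const (‖D t‖ ^ 2))
  · exact (continuousOn_const.mul cP).add (continuousOn_const.mul (cD.norm.pow 2))
  · have h1 := perpEnergy_nonneg hp (hR' n) (N n) (D t)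
    have h2 := perpEnergy_le hp (hR' n) (N n) (D t)
    have h3 : √(δ n) ≤ 1 := Real.sqrt_le_one.2 (hδ1 n)
    have h4 := Real.sqrt_nonneg (δ n)
    have h6 : err n * ‖D t‖ ^ 2 ≤ Ce * ‖D t‖ ^ 2 := by gcongr; exact hCe' n
    have h7 : 0 ≤ err n * ‖D t‖ ^ 2 := mul_nonneg (herr0 n) (sq_nonneg _)
    rw [abs_le]
    constructor <;> nlinarith
  · exact continuousOn_const.mul cP

end Hermite

end VFP

namespace VFP

/-! ### Hypocoercivity in `L²` -/

section Hypocoercivity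

variable {H : Type*} [NormedAddCommGroup H] [InnerProductSpace ℝ H]
variable {A B : Submodule ℝ (H × H)} {b M : H →L[ℝ] H} {e : H} {cP δ r α K : ℝ}
  {R W R' W' R₁ W₁ R₁' W₁' : H →L[ℝ] H} {D : ℝ → lp (fun _ : ℕ => H) 2}

/-- The modified `L²` functional. -/
noncomputable def l2Func (W₁ : H →L[ℝ] H) (r α : ℝ) (v : lp (fun _ : ℕ => H) 2) : ℝ :=
  ‖v‖ ^ 2 + 2 * α * r * inner ℝ (v 1) (W₁ (v 0))

/-- The coercivity constant of `1 - R₁`. -/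
noncomputable def gapConst (cP : ℝ) : ℝ := 1 / (2 * (cP ^ 2 + 1))

theorem gapConst_pos (cP : ℝ) : 0 < gapConst cP := by unfold gapConst; positivity

theorem gapConst_le (cP : ℝ) : gapConst cP ≤ 1 / 2 := by
  unfold gapConst
  rw [div_le_div_iff₀ (by positivity) (by norm_num)]
  nlinarith [sq_nonneg cP]

/-- The largeness constant in the modified `L²` functional. -/
noncomputable def l2Const (β cP : ℝ) : ℝ :=
  2 + 2 * (√2 * (β + 1)) ^ 2 / gapConst cP + 2 / gapConst cP

theorem l2Const_ge (β cP : ℝ) : 2 ≤ l2Const β cP := by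
  have := gapConst_pos cP
  have h1 : 0 ≤ 2 * (√2 * (β + 1)) ^ 2 / gapConst cP := by positivity
  have h2 : 0 ≤ 2 / gapConst cP := by positivity
  unfold l2Const; linarith

theorem mul_le_half_of_small (hα : 0 < α) (hαr : α * (2 * (1 + r ^ 2)) ≤ 1) :
    α * r ≤ 1 / 4 ∧ α * r ^ 2 ≤ 1 / 2 := by
  constructor <;> nlinarith [sq_nonneg (r - 1)]

theorem small_of_l2Const {β : ℝ} (hα : 0 < α) (hαr : α * (l2Const β cP * (1 + r ^ 2)) ≤ 1) :
    α * (2 * (1 + r ^ 2)) ≤ 1 := by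
  refine le_trans ?_ hαr
  have := l2Const_ge β cP
  gcongr

theorem abs_l2Func_sub_le (h : IsAdjointPair A B) (h₁ : IsResolvent A B 1 R₁ W₁) (hr : 0 < r)
    (hα : 0 < α) (hαr : α * (2 * (1 + r ^ 2)) ≤ 1) (v : lp (fun _ : ℕ => H) 2) :
    |l2Func W₁ r α v - ‖v‖ ^ 2| ≤ 1 / 2 * ‖v‖ ^ 2 := by
  have h1 := (mul_le_half_of_small hα hαr).1
  have h2 : ‖W₁ (v 0)‖ ≤ ‖v 0‖ := by simpa using h₁.norm_apply_snd_le h (v 0)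
  have h3 := abs_real_inner_le_norm (v 1) (W₁ (v 0))
  have h4 : |inner ℝ (v 1) (W₁ (v 0))| ≤ ‖v‖ ^ 2 := by
    refine h3.trans ?_
    calc _ ≤ ‖v‖ * ‖v‖ := by
          gcongr
          · exact norm_coe_le v 1
          · exact h2.trans (norm_coe_le v 0)
      _ = _ := by ring
  rw [l2Func, add_sub_cancel_left, abs_mul, abs_of_pos (by positivity : 0 < 2 * α * r)]
  have := mul_le_mul h1 h4 (abs_nonneg _) (by norm_num)
  nlinarith

theorem HermitePair.gap_mul_le (h : HermitePair A B b M e cP)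
    (h₁ : IsResolvent A B 1 R₁ W₁) {v : H} (hv : inner ℝ v e = 0) :
    gapConst cP * ‖v‖ ^ 2 ≤ inner ℝ (v - R₁ v) v := by
  have := h.norm_sq_le_of_inner_eq_zero h₁ hv
  rw [gapConst, one_div, inv_mul_le_iff₀ (by positivity)]
  linarith

variable [CompleteSpace H] (h : HermitePair A B b M e cP)
include h

/-- The source `-r A D₀` of `D₁`, paired with `W₁ D₀`, gives `-r ⟨D₀, B W₁ D₀⟩`, and `B W₁ = 1 - R₁`
is coercive. The other terms involve only the bounded operators `A W₁ = b W₁ - (1 - R₁)`, `A W₁' = 1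
- R₁'` and `W₁`. -/
theorem IsWeakSol.exists_deriv_mixed (hD : IsWeakSol A b r D)
    (h₁ : IsResolvent A B 1 R₁ W₁) (h₁' : IsResolvent B A 1 R₁' W₁') (hr : 0 < r)
    {t : ℝ} (ht : 0 ≤ t) (hDe : inner ℝ (D t 0) e = 0) :
    ∃ d, HasDerivWithinAt (fun s => inner ℝ (D s 1) (W₁ (D s 0))) d (Ici 0) t ∧
      d ≤ r * (-gapConst cP * ‖D t 0‖ ^ 2 + perpSq (D t)
        + √2 * (‖b‖ + 1) * √(perpSq (D t)) * ‖D t 0‖) + √(perpSq (D t)) * ‖D t 0‖ := by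
  have hp := h.toIsAdjointPair
  have hT : ∀ ψ, (W₁' ψ, (ContinuousLinearMap.id ℝ H - R₁') ψ) ∈ A := fun ψ => by
    simpa using h₁'.snd ψ
  obtain ⟨F, hF, hFi⟩ := hD.exists_deriv hT (fun f ψ => h₁.inner_apply hp h₁' f ψ) 0
  have hw : (W₁ (D t 0), b (W₁ (D t 0)) - (D t 0 - R₁ (D t 0))) ∈ A :=
    h.add_right (by simpa using h₁.snd (D t 0))
  have hd := hD.weak 1 _ _ hw t ht
  refine ⟨_, hasDerivWithinAt_inner_of_weak (hF t ht)
    (continuousOn_apply hD.continuousOn 1 t ht) hd, ?_⟩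
  rw [real_inner_comm, hFi, sub_sub_cancel]
  simp only [Nat.cast_zero, Real.sqrt_zero, zero_mul, zero_add, Real.sqrt_one, one_mul, zero_sub,
    sub_zero, Nat.cast_one, Nat.sub_self, sub_apply, ContinuousLinearMap.id_apply]
  rw [show (1 : ℝ) + 1 = 2 by norm_num]
  have hY1 : ‖D t 1‖ ^ 2 ≤ perpSq (D t) := norm_sq_le_perpSq (D t) 0
  have hY2 : ‖D t 2‖ ^ 2 ≤ perpSq (D t) := norm_sq_le_perpSq (D t) 1
  have n1 : ‖D t 1‖ ≤ √(perpSq (D t)) := Real.le_sqrt_of_sq_le hY1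
  have n2 : ‖D t 2‖ ≤ √(perpSq (D t)) := Real.le_sqrt_of_sq_le hY2
  have n3 : ‖W₁ (D t 0)‖ ≤ ‖D t 0‖ := by simpa using h₁.norm_apply_snd_le hp (D t 0)
  have g1 : inner ℝ (D t 1) (D t 1 - R₁' (D t 1)) ≤ perpSq (D t) := by
    refine (real_inner_le_norm _ _).trans (le_trans ?_ hY1)
    rw [pow_two]
    gcongr
    exact h₁'.norm_sub_le hp.symm _
  have g2 := h.gap_mul_le h₁ hDe
  rw [real_inner_comm] at g2
  have g3 : inner ℝ (D t 2) (b (W₁ (D t 0)) - (D t 0 - R₁ (D t 0)))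
      ≤ √(perpSq (D t)) * ((‖b‖ + 1) * ‖D t 0‖) := by
    refine (real_inner_le_norm _ _).trans ?_
    gcongr
    refine (norm_sub_le _ _).trans ?_
    rw [add_mul, one_mul]
    exact add_le_add ((b.le_opNorm _).trans (by gcongr)) (h₁.norm_sub_le hp _)
  have g4 : -inner ℝ (D t 1) (W₁ (D t 0)) ≤ √(perpSq (D t)) * ‖D t 0‖ := by
    refine (neg_le_abs _).trans ((abs_real_inner_le_norm _ _).trans ?_)
    gcongr
  have g5 := mul_le_mul_of_nonneg_left g3 (Real.sqrt_nonneg 2)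
  nlinarith

/-- The damping `-2 ‖D_⊥‖²` pays for the microscopic terms of the mixed derivative: after Young
their total is at most `‖D_⊥‖²`, which is the smallness condition on `α` with `l2Const`. The factor
`2 / 3` comes from `l2Func ≤ 3 / 2 ‖v‖²`. -/
theorem IsWeakSol.upperSlope_l2Func (hD : IsWeakSol A b r D)
    (h₁ : IsResolvent A B 1 R₁ W₁) (h₁' : IsResolvent B A 1 R₁' W₁') (hr : 0 < r)
    (hDe : ∀ t, 0 ≤ t → inner ℝ (D t 0) e = 0)
    (hα : 0 < α) (hαr : α * (l2Const ‖b‖ cP * (1 + r ^ 2)) ≤ 1) :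
    UpperSlopeLE (fun t => l2Func W₁ r α (D t)) (fun t => -(1 / 2) * perpSq (D t)
      - 2 / 3 * gapConst cP * (α * r ^ 2) * l2Func W₁ r α (D t)) := by
  have hp := h.toIsAdjointPair
  have hsm := small_of_l2Const hα hαr
  have hE := hD.upperSlope_norm_sq h hr
  choose! d hd hle using fun t ht => hD.exists_deriv_mixed h h₁ h₁' hr ht (hDe t ht)
  have hS := hE.add ((UpperSlopeLE.of_hasDerivWithinAt hd).const_mul
    (show 0 < 2 * α * r by positivity))
  refine hS.mono fun t ht => ?_
  have hc := gapConst_pos cP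
  have hc2 := gapConst_le cP
  have hl := hle t ht
  have hY := perpSq_nonneg (D t)
  have hf := (abs_le.1 (abs_l2Func_sub_le hp h₁ hr hα hsm (D t))).2
  have hEY := norm_sq_eq_add_perpSq (D t)
  have hss := mul_le_half_of_small hα hsm
  set Y := perpSq (D t)
  set x := ‖D t 0‖
  set c := gapConst cP
  set q := √2 * (‖b‖ + 1)
  have hsq : √Y ^ 2 = Y := Real.sq_sqrt hY
  have h1 : 2 * α * r * d t ≤ 2 * α * r * (r * (-c * x ^ 2 + Y + q * √Y * x) + √Y * x) := by
    gcongr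
  have h2 : 2 * (q * √Y * x) ≤ c / 2 * x ^ 2 + 2 * q ^ 2 / c * Y := by
    have : c / 2 * x ^ 2 + 2 * q ^ 2 / c * Y - 2 * (q * √Y * x)
        = (c * x - 2 * q * √Y) ^ 2 / (2 * c) := by
      generalize √Y = S at hsq
      rw [← hsq]; field_simp; ring
    have h0 : 0 ≤ (c * x - 2 * q * √Y) ^ 2 / (2 * c) := by positivity
    linarith
  have h3 : 2 * r * (√Y * x) ≤ r ^ 2 * (c / 2 * x ^ 2) + 2 / c * Y := by
    have : r ^ 2 * (c / 2 * x ^ 2) + 2 / c * Y - 2 * r * (√Y * x)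
        = (c * (r * x) - 2 * √Y) ^ 2 / (2 * c) := by
      generalize √Y = S at hsq
      rw [← hsq]; field_simp; ring
    have h0 : 0 ≤ (c * (r * x) - 2 * √Y) ^ 2 / (2 * c) := by positivity
    linarith
  have h4 : α * (2 * r ^ 2 + 2 * q ^ 2 / c * r ^ 2 + 2 / c) * Y ≤ 1 * Y := by
    refine mul_le_mul_of_nonneg_right (le_trans ?_ hαr) hY
    refine mul_le_mul_of_nonneg_left ?_ hα.le
    have e1 : 0 ≤ 2 * q ^ 2 / c := by positivity
    have e2 : 0 ≤ 2 / c := by positivity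
    change _ ≤ (2 + 2 * q ^ 2 / c + 2 / c) * (1 + r ^ 2)
    nlinarith [sq_nonneg r]
  have h5 : 2 * α * r * d t ≤ Y - α * r ^ 2 * c * x ^ 2 := by
    have e1 := mul_le_mul_of_nonneg_left h2 (show 0 ≤ α * r ^ 2 by positivity)
    have e2 := mul_le_mul_of_nonneg_left h3 hα.le
    nlinarith
  have h6 : α * r ^ 2 * c ≤ 1 / 2 := by nlinarith [hss.2]
  have h7 : 2 / 3 * c * (α * r ^ 2) * l2Func W₁ r α (D t) ≤ c * (α * r ^ 2) * ‖D t‖ ^ 2 := by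
    have : 0 ≤ c * (α * r ^ 2) := by positivity
    nlinarith
  nlinarith

end Hypocoercivity

end VFP

namespace VFP

/-! ### The truncated `H¹` energy -/

section HOne

variable {H : Type*} [NormedAddCommGroup H] [InnerProductSpace ℝ H]
variable {A B : Submodule ℝ (H × H)} {b M : H →L[ℝ] H} {e : H} {cP δ r α K : ℝ}
  {R W R' W' R₁ W₁ R₁' W₁' : H →L[ℝ] H} {D : ℝ → lp (fun _ : ℕ => H) 2}

/-- Truncated and regularized `‖ℬ v‖²`. -/
noncomputable def h1Energy (W W' : H →L[ℝ] H) (N : ℕ) (v : lp (fun _ : ℕ => H) 2) : ℝ :=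
  ∑ k ∈ Finset.range N, cutoff N k * (if k = 0 then ‖W (v k)‖ ^ 2 else ‖W' (v k)‖ ^ 2)

/-- Its part with positive index. -/
noncomputable def h1Perp (W' : H →L[ℝ] H) (N : ℕ) (v : lp (fun _ : ℕ => H) 2) : ℝ :=
  ∑ k ∈ Finset.range N, cutoff N k * (if k = 0 then 0 else ‖W' (v k)‖ ^ 2)

theorem h1Energy_eq {N : ℕ} (hN : 0 < N) (v : lp (fun _ : ℕ => H) 2) :
    h1Energy W W' N v = ‖W (v 0)‖ ^ 2 + h1Perp W' N v := by
  obtain ⟨n, rfl⟩ := Nat.exists_eq_succ_of_ne_zero hN.ne'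
  rw [h1Energy, h1Perp, Finset.sum_range_succ', Finset.sum_range_succ']
  simp [cutoff_zero, add_comm]

/-- Modes `1` and `2` enter the mixed `H¹` term and must be controlled by the truncated dissipation;
`N ≥ 4` gives them weight at least `1 / 2`. -/
theorem le_h1Perp {N : ℕ} (hN : 4 ≤ N) (v : lp (fun _ : ℕ => H) 2) :
    ‖W' (v 1)‖ ^ 2 + ‖W' (v 2)‖ ^ 2 ≤ 2 * h1Perp W' N v := by
  have hN0 : (4 : ℝ) ≤ N := by exact_mod_cast hN
  have hc1 : 1 / 2 ≤ cutoff N 1 := le_max_of_le_left (by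
    push_cast; rw [le_sub_comm, div_le_iff₀ (by linarith)]; linarith)
  have hc2 : 1 / 2 ≤ cutoff N 2 := le_max_of_le_left (by
    push_cast; rw [le_sub_comm, div_le_iff₀ (by linarith)]; linarith)
  have : ∑ k ∈ ({1, 2} : Finset ℕ), cutoff N k * (if k = 0 then 0 else ‖W' (v k)‖ ^ 2)
      ≤ h1Perp W' N v := by
    refine Finset.sum_le_sum_of_subset_of_nonneg ?_ fun k _ _ => ?_
    · intro k hk
      simp only [Finset.mem_insert, Finset.mem_singleton] at hk
      rw [Finset.mem_range]
      omega
    · have := cutoff_nonneg N k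
      positivity
  rw [Finset.sum_pair (by norm_num)] at this
  simp only [one_ne_zero, if_false, OfNat.ofNat_ne_zero] at this
  nlinarith [sq_nonneg ‖W' (v 1)‖, sq_nonneg ‖W' (v 2)‖]

theorem h1Perp_nonneg (N : ℕ) (v : lp (fun _ : ℕ => H) 2) : 0 ≤ h1Perp W' N v := by
  refine Finset.sum_nonneg fun k _ => mul_nonneg (cutoff_nonneg N k) ?_
  positivity

theorem continuousOn_h1Energy (N : ℕ) {s : Set ℝ} (hD : ContinuousOn D s) :
    ContinuousOn (fun t => h1Energy W W' N (D t)) s := by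
  unfold h1Energy
  refine continuousOn_finsetSum _ fun k _ => continuousOn_const.mul ?_
  split_ifs
  · exact (W.continuous.comp_continuousOn (continuousOn_apply hD k)).norm.pow 2
  · exact (W'.continuous.comp_continuousOn (continuousOn_apply hD k)).norm.pow 2

/-- Intertwining moves the resolvents outside the unbounded operators, where they are contractions;
the initial energy is thus bounded uniformly in `δ` and `N`. -/
theorem h1Energy_le_tsum (h : IsAdjointPair A B) (hR : IsResolvent A B δ R W)
    (hR' : IsResolvent B A δ R' W') {v : lp (fun _ : ℕ => H) 2} {g : ℕ → H}
    (h0 : (v 0, g 0) ∈ A) (hk : ∀ k, k ≠ 0 → (v k, g k) ∈ B)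
    (hg : Summable fun k => ‖g k‖ ^ 2) (N : ℕ) : h1Energy W W' N v ≤ ∑' k, ‖g k‖ ^ 2 := by
  refine le_trans (Finset.sum_le_sum fun k _ => ?_)
    (hg.sum_le_tsum (Finset.range N) fun _ _ => by positivity)
  have h1 : (if k = 0 then ‖W (v k)‖ ^ 2 else ‖W' (v k)‖ ^ 2) ≤ ‖g k‖ ^ 2 := by
    split_ifs with hk0
    · subst hk0
      rw [hR.apply_of_mem h hR' h0]
      gcongr
      exact hR'.norm_apply_le h.symm _
    · rw [hR'.apply_of_mem h.symm hR (hk k hk0)]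
      gcongr
      exact hR.norm_apply_le h _
  calc _ ≤ 1 * ‖g k‖ ^ 2 := mul_le_mul (cutoff_le_one _ _) h1 (by positivity) zero_le_one
    _ = _ := one_mul _

variable [CompleteSpace H] (h : HermitePair A B b M e cP)
include h

/-- The truncated and regularized `H¹` estimate. -/
theorem IsWeakSol.exists_deriv_h1Energy (hD : IsWeakSol A b r D) (hr : 0 < r)
    (hR : IsResolvent A B δ R W) (hR' : IsResolvent B A δ R' W') {N : ℕ}
    (hN : 0 < N) {t : ℝ} (ht : 0 ≤ t) :
    ∃ d, HasDerivWithinAt (fun s => h1Energy W W' N (D s)) d (Ici 0) t ∧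
      d ≤ -h1Perp W' N (D t) + 4 * ‖M‖ ^ 2 * r ^ 2 * perpSq (D t)
        + 2 * r * (√N)⁻¹ * (δ⁻¹ * (‖b‖ + (√δ)⁻¹)) * ‖D t‖ ^ 2 := by
  have hp := h.toIsAdjointPair
  have hδ0 := hR.pos
  have hs := Real.sqrt_pos.2 hδ0
  have hT0 : ∀ ψ, (W' ψ, (δ⁻¹ • (ContinuousLinearMap.id ℝ H - R')) ψ) ∈ A := fun ψ => by
    simpa using hR'.snd ψ
  have hT1 : ∀ ψ, (W ψ, (b.comp W - δ⁻¹ • (ContinuousLinearMap.id ℝ H - R)) ψ) ∈ A := fun ψ => by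
    simpa using h.add_right (hR.snd ψ)
  set P : ℕ → ℝ := fun k =>
    if k = 0 then inner ℝ (D t (k + 1)) (δ⁻¹ • (W (D t k) - R' (W (D t k))))
    else inner ℝ (D t (k + 1)) (b (W (W' (D t k))) - δ⁻¹ • (W' (D t k) - R (W' (D t k)))) with hP
  set Q : ℕ → ℝ := fun k => inner ℝ (D t (k + 1)) (W (δ⁻¹ • (D t k - R (D t k)))) with hQ
  set E : ℕ → ℝ := fun k => ‖W' (D t k)‖ with hE
  have hderiv : ∀ k, HasDerivWithinAt
      (fun s => if k = 0 then ‖W (D s k)‖ ^ 2 else ‖W' (D s k)‖ ^ 2)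
      (2 * (r * (√((k : ℝ) + 1) * P k - √k * Q (k - 1))) - 2 * (k * E k ^ 2)) (Ici 0) t := by
    intro k
    rcases Nat.eq_zero_or_pos k with rfl | hk
    · simp only [if_true]
      have h1 := hD.hasDeriv_norm_sq hT0 (fun f ψ => hR.inner_apply hp hR' f ψ) 0 ht
      convert h1 using 1
      simp [hP]
    · simp only [hP, hQ, hE, if_neg hk.ne']
      have h1 := hD.hasDeriv_norm_sq hT1 (fun f ψ => hR'.inner_apply hp.symm hR f ψ) k ht
      convert h1 using 1
      rw [Nat.sub_add_cancel hk]
      have h2 : inner ℝ (D t k) (W (δ⁻¹ • (D t (k - 1) - R (D t (k - 1)))))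
          = inner ℝ (D t (k - 1)) (δ⁻¹ • (W' (D t k) - R (W' (D t k)))) := by
        rw [real_inner_comm, hR.inner_apply hp hR', inner_smul_left, inner_smul_right,
          inner_sub_left, inner_sub_right, hR.symm hp]
        simp
      simp only [sub_apply, ContinuousLinearMap.comp_apply, sub_sub_cancel,
        smul_apply, ContinuousLinearMap.id_apply]
      rw [h2]
      ring
  refine ⟨_, HasDerivWithinAt.fun_sum fun k _ => (hderiv k).const_mul (cutoff N k), ?_⟩
  have hsum := sum_transport_le (N := N) hN (P := P) (Q := Q) (x := E)
    (a := fun k => ‖D t k‖) (y := fun k => if k = 0 then 0 else ‖D t k‖)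
    (C := δ⁻¹ * (‖b‖ + (√δ)⁻¹)) (m := 2 * ‖M‖) (θ := 1) (r := r) (Y := perpSq (D t))
    (A := ‖D t‖ ^ 2)
    hr.le one_pos (by positivity) (fun k => ?_) (fun k hk => ?_) (by simp) (sum_mul_succ_le _ _)
    (sum_perp_le _ _)
  · have e1 : ∑ k ∈ Finset.range N, cutoff N k *
        (2 * (r * (√((k : ℝ) + 1) * P k - √k * Q (k - 1))) - 2 * (k * E k ^ 2))
        = ∑ k ∈ Finset.range N, cutoff N k * (2 * (r * (√((k : ℝ) + 1) * P k - √k * Q (k - 1))))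
          - 2 * ∑ k ∈ Finset.range N, cutoff N k * (k * E k ^ 2) := by
      rw [Finset.mul_sum, ← Finset.sum_sub_distrib]
      exact Finset.sum_congr rfl fun k _ => by ring
    -- No commutator arises between modes `0` and `1`: here `A B A R`-type expressions agree exactly
    -- through `W R = R' W`.
    have e2 : P 0 - Q 0 = 0 := by
      simp only [hP, hQ, if_true, map_smul, map_sub]
      rw [hR.comm_apply hp hR', sub_self]
    have e3 : h1Perp W' N (D t) ≤ ∑ k ∈ Finset.range N, cutoff N k * (k * E k ^ 2) := by
      refine Finset.sum_le_sum fun k _ => mul_le_mul_of_nonneg_left ?_ (cutoff_nonneg N k)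
      rcases Nat.eq_zero_or_pos k with rfl | hk
      · simp
      · have : (1 : ℝ) ≤ k := by exact_mod_cast hk
        rw [if_neg hk.ne']
        nlinarith [sq_nonneg (E k)]
    rw [e1]
    rw [e2] at hsum
    have e4 : r ^ 2 * (2 * ‖M‖) ^ 2 / 1 = 4 * ‖M‖ ^ 2 * r ^ 2 := by ring
    rw [e4] at hsum
    linarith
  · have i1 : (√δ)⁻¹ * (√δ)⁻¹ = δ⁻¹ := by rw [← mul_inv, Real.mul_self_sqrt hδ0.le]
    have key : ∀ x : H, ‖x‖ ≤ δ⁻¹ * (‖b‖ + (√δ)⁻¹) * ‖D t k‖ →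
        |inner ℝ (D t (k + 1)) x| ≤ δ⁻¹ * (‖b‖ + (√δ)⁻¹) * (‖D t k‖ * ‖D t (k + 1)‖) := by
      intro x hx
      refine (abs_real_inner_le_norm _ _).trans ?_
      calc _ ≤ ‖D t (k + 1)‖ * (δ⁻¹ * (‖b‖ + (√δ)⁻¹) * ‖D t k‖) := by gcongr
        _ = _ := by ring
    simp only [hP]
    split_ifs with hk
    · refine key _ ?_
      rw [norm_smul, Real.norm_of_nonneg (by positivity)]
      have n1 : ‖W (D t k) - R' (W (D t k))‖ ≤ (√δ)⁻¹ * ‖D t k‖ :=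
        (hR'.norm_sub_le hp.symm _).trans (hR.norm_apply_snd_le hp _)
      calc _ ≤ δ⁻¹ * ((√δ)⁻¹ * ‖D t k‖) := by gcongr
        _ ≤ δ⁻¹ * ((‖b‖ + (√δ)⁻¹) * ‖D t k‖) := by
          gcongr
          linarith [norm_nonneg b]
        _ = _ := by ring
    · refine key _ ((norm_sub_le _ _).trans ?_)
      have n1 : ‖W' (D t k)‖ ≤ (√δ)⁻¹ * ‖D t k‖ := hR'.norm_apply_snd_le hp.symm _
      have n2 : ‖W (W' (D t k))‖ ≤ δ⁻¹ * ‖D t k‖ := by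
        rw [← i1, mul_assoc]
        exact (hR.norm_apply_snd_le hp _).trans (by gcongr)
      rw [norm_smul, Real.norm_of_nonneg (show (0 : ℝ) ≤ δ⁻¹ by positivity)]
      calc _ ≤ ‖b‖ * (δ⁻¹ * ‖D t k‖) + δ⁻¹ * ((√δ)⁻¹ * ‖D t k‖) := by
            refine add_le_add ((b.le_opNorm _).trans (by gcongr)) ?_
            gcongr
            exact (hR.norm_sub_le hp _).trans n1
        _ = _ := by ring
  · have hk' : k ≠ 0 := by omega
    simp only [hP, hQ, hE, if_neg hk']
    exact h.inner_commutator_snd_le hR hR' _ _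

/-- This is the regularized derivative of `⟨A D₀, D₁⟩`. The equation for `D₁` yields `-r ‖A D₀‖²`,
the equation for `D₀` yields `r ‖B D₁‖²`, and the flux from `D₂` is moved onto `B D₂` at the price
of the factor `1 + ‖M‖`. -/
theorem IsWeakSol.exists_deriv_h1Mixed (hD : IsWeakSol A b r D) (hr : 0 < r)
    (hR : IsResolvent A B δ R W) (hR' : IsResolvent B A δ R' W') (hδ1 : δ ≤ 1)
    {t : ℝ} (ht : 0 ≤ t) :
    ∃ d, HasDerivWithinAt (fun s => inner ℝ (W (D s 0)) (R' (D s 1))) d (Ici 0) t ∧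
      d ≤ r * (‖W' (D t 1)‖ ^ 2 - ‖W (D t 0)‖ ^ 2
        + √2 * (1 + ‖M‖) * ‖W' (D t 2)‖ * ‖W (D t 0)‖) + √(perpSq (D t)) * ‖W (D t 0)‖ := by
  have hp := h.toIsAdjointPair
  have hT0 : ∀ ψ, (W' ψ, (δ⁻¹ • (ContinuousLinearMap.id ℝ H - R')) ψ) ∈ A := fun ψ => by
    simpa using hR'.snd ψ
  have hT1 : ∀ ψ, (R' ψ, (b.comp R' - W') ψ) ∈ A := fun ψ => h.add_right (hR'.fst ψ)
  obtain ⟨F, hF, hFi⟩ := hD.exists_deriv hT0 (fun f ψ => hR.inner_apply hp hR' f ψ) 0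
  obtain ⟨G, hG, hGi⟩ := hD.exists_deriv hT1 (fun f ψ => hR'.symm hp.symm f ψ) 1
  refine ⟨_, (hF t ht).inner ℝ (hG t ht), ?_⟩
  rw [real_inner_comm, hGi, hFi]
  simp only [Nat.cast_zero, Real.sqrt_zero, zero_mul, zero_add, Real.sqrt_one, one_mul, zero_sub,
    sub_zero, Nat.cast_one, Nat.sub_self, sub_apply, ContinuousLinearMap.id_apply,
    ContinuousLinearMap.comp_apply, sub_sub_cancel, smul_apply]
  rw [show (1 : ℝ) + 1 = 2 by norm_num]
  have e1 : inner ℝ (D t 1) (δ⁻¹ • (R' (D t 1) - R' (R' (D t 1)))) = ‖W' (D t 1)‖ ^ 2 := by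
    rw [← map_sub, ← hR.apply_snd hp hR', real_inner_comm, hR.inner_apply hp hR',
      real_inner_self_eq_norm_sq]
  have e2 : inner ℝ (D t 0) (W' (W (D t 0))) = ‖W (D t 0)‖ ^ 2 := by
    rw [← hR.inner_apply hp hR', real_inner_self_eq_norm_sq]
  have e3 : inner ℝ (D t 2) (b (R' (W (D t 0))) - W' (W (D t 0)))
      ≤ (1 + ‖M‖) * ‖W' (D t 2)‖ * ‖W (D t 0)‖ := by
    refine (le_abs_self _).trans ((h.inner_left_resolvent_le hR hR' _ _).trans ?_)
    gcongr
    nlinarith [norm_nonneg M]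
  have e4 : -inner ℝ (D t 1) (R' (W (D t 0))) ≤ √(perpSq (D t)) * ‖W (D t 0)‖ := by
    refine (neg_le_abs _).trans ((abs_real_inner_le_norm _ _).trans ?_)
    gcongr
    · exact Real.le_sqrt_of_sq_le (norm_sq_le_perpSq (D t) 0)
    · exact hR'.norm_apply_le hp.symm _
  have e5 := mul_le_mul_of_nonneg_left e3 (Real.sqrt_nonneg 2)
  rw [e1, e2]
  nlinarith

end HOne

end VFP

namespace VFP

/-! ### Decay of the `H¹` functional and of `D_⊥` -/

section Decay

variable {H : Type*} [NormedAddCommGroup H] [InnerProductSpace ℝ H]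
variable {A B : Submodule ℝ (H × H)} {b M : H →L[ℝ] H} {e : H} {cP δ r α K : ℝ}
  {R W R' W' R₁ W₁ R₁' W₁' : H →L[ℝ] H} {D : ℝ → lp (fun _ : ℕ => H) 2}

/-- The modified `H¹` functional. -/
noncomputable def h1Func (W W' R' W₁ : H →L[ℝ] H) (N : ℕ) (r α K : ℝ)
    (v : lp (fun _ : ℕ => H) 2) : ℝ :=
  h1Energy W W' N v + 2 * α * r * inner ℝ (W (v 0)) (R' (v 1)) + K * l2Func W₁ r α v

/-- The largeness constant in the modified `H¹` functional. -/
noncomputable def h1Const (m : ℝ) : ℝ := 8 + 16 * (1 + m) ^ 2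

theorem l2Func_bounds (h : IsAdjointPair A B) (h₁ : IsResolvent A B 1 R₁ W₁) (hr : 0 < r)
    (hα : 0 < α) (hαr : α * (2 * (1 + r ^ 2)) ≤ 1) (v : lp (fun _ : ℕ => H) 2) :
    1 / 2 * ‖v‖ ^ 2 ≤ l2Func W₁ r α v ∧ l2Func W₁ r α v ≤ 3 / 2 * ‖v‖ ^ 2 := by
  have := abs_le.1 (abs_l2Func_sub_le h h₁ hr hα hαr v)
  constructor <;> linarith

theorem h1Func_bounds (h : IsAdjointPair A B) (h₁ : IsResolvent A B 1 R₁ W₁)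
    (hR' : IsResolvent B A δ R' W') (hr : 0 < r)
    (hα : 0 < α) (hαr : α * (2 * (1 + r ^ 2)) ≤ 1) (hK : 2 ≤ K) {N : ℕ} (hN : 0 < N)
    (v : lp (fun _ : ℕ => H) 2) :
    3 / 4 * (h1Energy W W' N v + K * l2Func W₁ r α v) ≤ h1Func W W' R' W₁ N r α K v ∧
      h1Func W W' R' W₁ N r α K v ≤ 5 / 4 * (h1Energy W W' N v + K * l2Func W₁ r α v) := by
  have h1 := (mul_le_half_of_small hα hαr).1
  have hf := (l2Func_bounds h h₁ hr hα hαr v).1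
  have h2 : |inner ℝ (W (v 0)) (R' (v 1))| ≤ ‖W (v 0)‖ * ‖v‖ := by
    refine (abs_real_inner_le_norm _ _).trans ?_
    gcongr
    exact (hR'.norm_apply_le h.symm _).trans (norm_coe_le v 1)
  have h3 : |2 * α * r * inner ℝ (W (v 0)) (R' (v 1))|
      ≤ 1 / 4 * (‖W (v 0)‖ ^ 2 + ‖v‖ ^ 2) := by
    rw [abs_mul, abs_of_pos (by positivity : 0 < 2 * α * r)]
    have := mul_le_mul h1 h2 (abs_nonneg _) (by norm_num)
    nlinarith [sq_nonneg (‖W (v 0)‖ - ‖v‖)]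
  have h4 := h1Energy_eq (W := W) (W' := W') hN v
  have h5 := h1Perp_nonneg (W' := W') N v
  have h6 : ‖v‖ ^ 2 ≤ K * l2Func W₁ r α v := by nlinarith [sq_nonneg ‖v‖]
  have h7 := abs_le.1 h3
  unfold h1Func
  constructor <;> linarith

theorem continuousOn_l2Func {s : Set ℝ} (hD : ContinuousOn D s) :
    ContinuousOn (fun t => l2Func W₁ r α (D t)) s := by
  unfold l2Func
  exact (hD.norm.pow 2).add (continuousOn_const.mul
    ((continuousOn_apply hD 1).inner (W₁.continuous.comp_continuousOn (continuousOn_apply hD 0))))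

theorem continuousOn_h1Func (N : ℕ) {s : Set ℝ} (hD : ContinuousOn D s) :
    ContinuousOn (fun t => h1Func W W' R' W₁ N r α K (D t)) s := by
  unfold h1Func
  exact ((continuousOn_h1Energy N hD).add (continuousOn_const.mul
    ((W.continuous.comp_continuousOn (continuousOn_apply hD 0)).inner
      (R'.continuous.comp_continuousOn (continuousOn_apply hD 1))))).add
        (continuousOn_const.mul (continuousOn_l2Func hD))

theorem small_of_h1Const {m : ℝ} (hα : 0 < α) (hαr : α * (h1Const m * (1 + r ^ 2)) ≤ 1) :
    α * r ^ 2 * (2 + 4 * (1 + m) ^ 2) ≤ 1 / 4 ∧ α * r ^ 2 ≤ 1 / 8 := by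
  unfold h1Const at hαr
  have : 0 ≤ α * (8 + 16 * (1 + m) ^ 2) := by positivity
  have : 0 ≤ α * (1 + r ^ 2) * (1 + m) ^ 2 := by positivity
  constructor <;> nlinarith

/-- The dissipation `-K Y / 2` absorbs the commutator loss `4 m² r² Y` and the loss `2 α Y` of the
mixed term and still leaves `-Y`; this is the condition on `K`. The rate is reduced to `4 / 9`
because `F ≤ 5 / 4 (Z + K f)` and `4 / 9 · 5 / 4 ≤ 2 / 3`. -/
theorem h1_slope_aux {d d' f F Z Zp Y z x₁ x₂ c m E : ℝ} (hα : 0 < α) (hr : 0 < r) (hc : 0 < c)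
    (hc2 : c ≤ 1 / 2) (hY : 0 ≤ Y) (hZp0 : 0 ≤ Zp) (hf : 0 ≤ K * f)
    (hs : α * r ^ 2 * (2 + 4 * (1 + m) ^ 2) ≤ 1 / 4 ∧ α * r ^ 2 ≤ 1 / 8)
    (hK : 8 * m ^ 2 * r ^ 2 + 4 * α + 2 ≤ K)
    (hl : d ≤ -Zp + 4 * m ^ 2 * r ^ 2 * Y + E)
    (hl' : d' ≤ r * (x₁ ^ 2 - z ^ 2 + √2 * (1 + m) * x₂ * z) + √Y * z)
    (hF : F ≤ 5 / 4 * (Z + K * f)) (hZ : Z = z ^ 2 + Zp) (hZp : x₁ ^ 2 + x₂ ^ 2 ≤ 2 * Zp) :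
    d + 2 * α * r * d' + K * (-(1 / 2) * Y - 2 / 3 * c * (α * r ^ 2) * f)
      ≤ -(1 / 4) * Zp - Y - 4 / 9 * c * (α * r ^ 2) * F + E := by
  have hsq : √Y ^ 2 = Y := Real.sq_sqrt hY
  have h1 : 2 * α * r * d' ≤ 2 * α * r * (r * (x₁ ^ 2 - z ^ 2 + √2 * (1 + m) * x₂ * z)
      + √Y * z) := by gcongr
  have h2 : 2 * (√2 * (1 + m) * x₂ * z) ≤ 1 / 2 * z ^ 2 + 4 * (1 + m) ^ 2 * x₂ ^ 2 := by
    have e1 : (√2 * (1 + m) * x₂) ^ 2 = 2 * (1 + m) ^ 2 * x₂ ^ 2 := by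
      rw [mul_pow, mul_pow, Real.sq_sqrt (by norm_num)]
    have e2 := sq_nonneg (z - 2 * (√2 * (1 + m) * x₂))
    rw [sub_sq, mul_pow, e1] at e2
    linarith
  have h3 : 2 * r * (√Y * z) ≤ 1 / 2 * r ^ 2 * z ^ 2 + 2 * Y := by
    have e2 := sq_nonneg (r * z - 2 * √Y)
    rw [sub_sq, mul_pow, mul_pow, hsq] at e2
    linarith
  have h4 : 2 * α * r * d' ≤ 1 / 2 * Zp - α * r ^ 2 * z ^ 2 + 2 * α * Y := by
    have e1 := mul_le_mul_of_nonneg_left h2 (show 0 ≤ α * r ^ 2 by positivity)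
    have e2 := mul_le_mul_of_nonneg_left h3 hα.le
    have e3 := mul_le_mul_of_nonneg_right hs.1 (show 0 ≤ x₁ ^ 2 + x₂ ^ 2 by positivity)
    have e4 : 0 ≤ α * r ^ 2 * x₂ ^ 2 := by positivity
    have e5 : 0 ≤ α * r ^ 2 * (4 * (1 + m) ^ 2) * x₁ ^ 2 := by positivity
    linarith
  have e0 : 0 ≤ α * r ^ 2 := by positivity
  have h5 : 4 / 9 * c * (α * r ^ 2) * F ≤ 2 / 3 * c * (α * r ^ 2) * (Z + K * f) := by
    have e1 : 0 ≤ c * (α * r ^ 2) := by positivity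
    have e2 : 0 ≤ Z + K * f := by rw [hZ]; positivity
    linarith [mul_le_mul_of_nonneg_left hF e1, mul_nonneg e1 e2]
  have h6 : 2 / 3 * c * (α * r ^ 2) * Z ≤ α * r ^ 2 * z ^ 2 + 1 / 4 * Zp := by
    have e1 : 2 / 3 * c ≤ 1 := by linarith
    have e2 : 2 / 3 * c * (α * r ^ 2) * Z ≤ 1 * (α * r ^ 2) * Z := by
      have : 0 ≤ Z := by rw [hZ]; positivity
      gcongr
    rw [hZ] at e2 ⊢
    have e3 : α * r ^ 2 * Zp ≤ 1 / 8 * Zp := mul_le_mul_of_nonneg_right hs.2 hZp0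
    linarith
  have h7 : (4 * m ^ 2 * r ^ 2 + 2 * α - 1 / 2 * K) * Y ≤ -1 * Y :=
    mul_le_mul_of_nonneg_right (by linarith) hY
  linarith

theorem h1Func_zero_le (hp : IsAdjointPair A B) (h₁ : IsResolvent A B 1 R₁ W₁)
    (hR : IsResolvent A B δ R W) (hR' : IsResolvent B A δ R' W') (hr : 0 < r)
    (hα : 0 < α) (hαr : α * (2 * (1 + r ^ 2)) ≤ 1) (hK : 2 ≤ K) {N : ℕ} (hN : 0 < N)
    {v : lp (fun _ : ℕ => H) 2} {g : ℕ → H}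
    (h0 : (v 0, g 0) ∈ A) (hk : ∀ k, k ≠ 0 → (v k, g k) ∈ B)
    (hg : Summable fun k => ‖g k‖ ^ 2) :
    h1Func W W' R' W₁ N r α K v ≤ 2 * K * (∑' k, ‖g k‖ ^ 2 + ‖v‖ ^ 2) := by
  have h1 := (h1Func_bounds (W := W) hp h₁ hR' hr hα hαr hK hN v).2
  have h2 := (l2Func_bounds hp h₁ hr hα hαr v).2
  have h3 := h1Energy_le_tsum hp hR hR' h0 hk hg N
  have h4 : 0 ≤ ∑' k, ‖g k‖ ^ 2 := by positivity
  have h5 := mul_le_mul_of_nonneg_left h2 (show 0 ≤ K by linarith)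
  have h6 : 0 ≤ K * ‖v‖ ^ 2 := mul_nonneg (by linarith) (sq_nonneg _)
  nlinarith

variable [CompleteSpace H] (h : HermitePair A B b M e cP)
include h

/-- The terms `-h1Perp / 4` and `-perpSq` are superfluous for the decay of the functional itself;
they are kept to absorb the errors in the estimate of the corrected zeroth mode. -/
theorem IsWeakSol.upperSlope_h1Func (hD : IsWeakSol A b r D)
    (h₁ : IsResolvent A B 1 R₁ W₁) (h₁' : IsResolvent B A 1 R₁' W₁') (hr : 0 < r)
    (hDe : ∀ t, 0 ≤ t → inner ℝ (D t 0) e = 0)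
    (hα : 0 < α) (hαr : α * (l2Const ‖b‖ cP * (1 + r ^ 2)) ≤ 1)
    (hαr' : α * (h1Const ‖M‖ * (1 + r ^ 2)) ≤ 1)
    (hK : 8 * ‖M‖ ^ 2 * r ^ 2 + 4 * α + 2 ≤ K)
    (hR : IsResolvent A B δ R W) (hR' : IsResolvent B A δ R' W') (hδ1 : δ ≤ 1) {N : ℕ}
    (hN : 4 ≤ N) :
    UpperSlopeLE (fun t => h1Func W W' R' W₁ N r α K (D t)) (fun t =>
      -(1 / 4) * h1Perp W' N (D t) - perpSq (D t)
      - 4 / 9 * gapConst cP * (α * r ^ 2) * h1Func W W' R' W₁ N r α K (D t)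
      + 2 * r * (√N)⁻¹ * (δ⁻¹ * (‖b‖ + (√δ)⁻¹)) * ‖D t‖ ^ 2) := by
  have hp := h.toIsAdjointPair
  have hsm := small_of_l2Const hα hαr
  have hN0 : 0 < N := by omega
  have hK2 : 2 ≤ K := by linarith [show 0 ≤ 8 * ‖M‖ ^ 2 * r ^ 2 by positivity]
  choose! d hd hle using fun t ht => hD.exists_deriv_h1Energy h hr hR hR' hN0 (t := t) ht
  choose! d' hd' hle' using fun t ht => hD.exists_deriv_h1Mixed h hr hR hR' hδ1 (t := t) ht
  have hf := hD.upperSlope_l2Func h h₁ h₁' hr hDe hα hαr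
  have hS := ((UpperSlopeLE.of_hasDerivWithinAt hd).add
    ((UpperSlopeLE.of_hasDerivWithinAt hd').const_mul
      (show 0 < 2 * α * r by positivity))).add (hf.const_mul (show 0 < K by linarith))
  refine hS.mono fun t ht => ?_
  have hl := hle t ht
  have hl' := hle' t ht
  have hF := (h1Func_bounds (W := W) hp h₁ hR' hr hα hsm hK2 hN0 (D t)).2
  have hf0 := (l2Func_bounds hp h₁ hr hα hsm (D t)).1
  have hZ := h1Energy_eq (W := W) (W' := W') hN0 (D t)
  have hZp := le_h1Perp (W' := W') hN (D t)
  have hZp0 := h1Perp_nonneg (W' := W') N (D t)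
  have hY := perpSq_nonneg (D t)
  have hc := gapConst_pos cP
  have hc2 := gapConst_le cP
  have hs := small_of_h1Const hα hαr'
  have hhf : 0 ≤ K * l2Func W₁ r α (D t) :=
    mul_nonneg (by linarith) ((by positivity : (0 : ℝ) ≤ 1 / 2 * ‖D t‖ ^ 2).trans hf0)
  exact h1_slope_aux hα hr hc hc2 hY hZp0 hhf hs hK hl hl' hF hZ hZp

/-- The constant `3` is the ratio of the bounds `3 / 2` and `1 / 2` between `l2Func` and `‖v‖²`. -/
theorem IsWeakSol.norm_sq_le (hD : IsWeakSol A b r D)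
    (h₁ : IsResolvent A B 1 R₁ W₁) (h₁' : IsResolvent B A 1 R₁' W₁') (hr : 0 < r)
    (hDe : ∀ t, 0 ≤ t → inner ℝ (D t 0) e = 0)
    (hα : 0 < α) (hαr : α * (l2Const ‖b‖ cP * (1 + r ^ 2)) ≤ 1) {t : ℝ} (ht : 0 ≤ t) :
    ‖D t‖ ^ 2 ≤ 3 * ‖D 0‖ ^ 2 * Real.exp (-(2 / 3 * gapConst cP * (α * r ^ 2) * t)) := by
  have hp := h.toIsAdjointPair
  have hsm := small_of_l2Const hα hαr
  have hc := gapConst_pos cP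
  have hf := hD.upperSlope_l2Func h h₁ h₁' hr hDe hα hαr
  have := hf.le_exp_of_le (lam := 2 / 3 * gapConst cP * (α * r ^ 2)) (η := 0) (T := t)
    (by positivity) le_rfl (continuousOn_l2Func hD.continuousOn)
    (fun s _ _ => by linarith [perpSq_nonneg (D s)]) ht le_rfl
  have h1 := (l2Func_bounds hp h₁ hr hα hsm (D t)).1
  have h2 := (l2Func_bounds hp h₁ hr hα hsm (D 0)).2
  have h3 := mul_le_mul_of_nonneg_left h2
    (Real.exp_pos (-(2 / 3 * gapConst cP * (α * r ^ 2) * t))).le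
  rw [zero_div, add_zero] at this
  linarith

theorem IsWeakSol.norm_sq_le_const (hD : IsWeakSol A b r D)
    (h₁ : IsResolvent A B 1 R₁ W₁) (h₁' : IsResolvent B A 1 R₁' W₁') (hr : 0 < r)
    (hDe : ∀ t, 0 ≤ t → inner ℝ (D t 0) e = 0)
    (hα : 0 < α) (hαr : α * (l2Const ‖b‖ cP * (1 + r ^ 2)) ≤ 1) {t : ℝ} (ht : 0 ≤ t) :
    ‖D t‖ ^ 2 ≤ 3 * ‖D 0‖ ^ 2 := by
  refine (hD.norm_sq_le h h₁ h₁' hr hDe hα hαr ht).trans ?_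
  have hc := gapConst_pos cP
  refine mul_le_of_le_one_right (by positivity) (Real.exp_le_one_iff.2 ?_)
  have : 0 ≤ 2 / 3 * gapConst cP * (α * r ^ 2) * t := by positivity
  linarith

/-- The `H¹` decay of the zeroth mode. -/
theorem IsWeakSol.norm_snd_sq_le (hD : IsWeakSol A b r D)
    (h₁ : IsResolvent A B 1 R₁ W₁) (h₁' : IsResolvent B A 1 R₁' W₁') (hr : 0 < r)
    (hDe : ∀ t, 0 ≤ t → inner ℝ (D t 0) e = 0)
    (hα : 0 < α) (hαr : α * (l2Const ‖b‖ cP * (1 + r ^ 2)) ≤ 1)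
    (hαr' : α * (h1Const ‖M‖ * (1 + r ^ 2)) ≤ 1)
    (hK : 8 * ‖M‖ ^ 2 * r ^ 2 + 4 * α + 2 ≤ K)
    {g : ℕ → H} (h0 : (D 0 0, g 0) ∈ A) (hk : ∀ k, k ≠ 0 → (D 0 k, g k) ∈ B)
    (hg : Summable fun k => ‖g k‖ ^ 2)
    (hR : IsResolvent A B δ R W) (hδ1 : δ ≤ 1) {t : ℝ} (ht : 0 ≤ t) :
    ‖W (D t 0)‖ ^ 2 ≤ 3 * K * (∑' k, ‖g k‖ ^ 2 + ‖D 0‖ ^ 2)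
      * Real.exp (-(4 / 9 * gapConst cP * (α * r ^ 2) * t)) := by
  have hp := h.toIsAdjointPair
  have hsm := small_of_l2Const hα hαr
  have hc := gapConst_pos cP
  have hδ0 := hR.pos
  have hK2 : 2 ≤ K := by linarith [show 0 ≤ 8 * ‖M‖ ^ 2 * r ^ 2 by positivity]
  obtain ⟨R', W', hR'⟩ := hp.symm.exists_isResolvent hR.pos
  set lam := 4 / 9 * gapConst cP * (α * r ^ 2) with hlam
  have hlam0 : 0 < lam := by positivity
  set q := 2 * r * (δ⁻¹ * (‖b‖ + (√δ)⁻¹)) * (3 * ‖D 0‖ ^ 2) with hq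
  have hq0 : 0 ≤ q := by positivity
  have key : ∀ N : ℕ, 4 ≤ N → ‖W (D t 0)‖ ^ 2 ≤
      4 / 3 * (Real.exp (-(lam * t)) * (2 * K * (∑' k, ‖g k‖ ^ 2 + ‖D 0‖ ^ 2))
        + (√N)⁻¹ * q / lam) := by
    intro N hN
    have hN0 : 0 < N := by omega
    have hF := hD.upperSlope_h1Func h h₁ h₁' hr hDe hα hαr hαr' hK hR hR' hδ1 hN
    have h1 := hF.le_exp_of_le (lam := lam) (η := (√N)⁻¹ * q) (T := t) hlam0 (by positivity)
      (continuousOn_h1Func N hD.continuousOn) (fun s hs _ => by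
        have e1 := hD.norm_sq_le_const h h₁ h₁' hr hDe hα hαr hs
        have e2 := mul_le_mul_of_nonneg_left e1
          (show 0 ≤ 2 * r * (√(N : ℝ))⁻¹ * (δ⁻¹ * (‖b‖ + (√δ)⁻¹)) by positivity)
        have e3 := perpSq_nonneg (D s)
        have e4 := h1Perp_nonneg (W' := W') N (D s)
        rw [hlam, hq]
        linarith) ht le_rfl
    have h2 := (h1Func_bounds (W := W) hp h₁ hR' hr hα hsm hK2 hN0 (D t)).1
    have h3 := h1Energy_eq (W := W) (W' := W') hN0 (D t)
    have h4 := h1Perp_nonneg (W' := W') N (D t)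
    have h5 : 0 ≤ K * l2Func W₁ r α (D t) := mul_nonneg (by linarith)
      ((l2Func_bounds hp h₁ hr hα hsm (D t)).1.trans' (by positivity))
    have h6 := h1Func_zero_le hp h₁ hR hR' hr hα hsm hK2 hN0 h0 hk hg
    have h7 := mul_le_mul_of_nonneg_left h6 (Real.exp_pos (-(lam * t))).le
    linarith
  -- The truncation error contains `δ⁻¹`, so `N` tends to infinity at fixed `δ`; the resulting bound
  -- no longer depends on `δ`.
  have hlim : Tendsto (fun N : ℕ => 4 / 3 * (Real.exp (-(lam * t))
      * (2 * K * (∑' k, ‖g k‖ ^ 2 + ‖D 0‖ ^ 2)) + (√N)⁻¹ * q / lam)) atTop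
      (𝓝 (4 / 3 * (Real.exp (-(lam * t)) * (2 * K * (∑' k, ‖g k‖ ^ 2 + ‖D 0‖ ^ 2)) + 0))) := by
    refine Tendsto.const_mul _ (Tendsto.const_add _ ?_)
    have e1 : Tendsto (fun N : ℕ => (√(N : ℝ))⁻¹) atTop (𝓝 0) :=
      (Real.tendsto_sqrt_atTop.comp tendsto_natCast_atTop_atTop).inv_tendsto_atTop
    simpa using (e1.mul_const q).div_const lam
  have hle := ge_of_tendsto hlim (eventually_atTop.2 ⟨4, key⟩)
  have h8 : 0 ≤ K * (∑' k, ‖g k‖ ^ 2 + ‖D 0‖ ^ 2) * Real.exp (-(lam * t)) := by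
    have : 0 ≤ ∑' k, ‖g k‖ ^ 2 := by positivity
    have : 0 ≤ K := by linarith
    positivity
  linarith

/-- The decay of `D_⊥`. -/
theorem IsWeakSol.perpSq_le (hD : IsWeakSol A b r D)
    (h₁ : IsResolvent A B 1 R₁ W₁) (h₁' : IsResolvent B A 1 R₁' W₁') (hr : 0 < r)
    (hDe : ∀ t, 0 ≤ t → inner ℝ (D t 0) e = 0)
    (hα : 0 < α) (hαr : α * (l2Const ‖b‖ cP * (1 + r ^ 2)) ≤ 1)
    (hαr' : α * (h1Const ‖M‖ * (1 + r ^ 2)) ≤ 1)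
    (hK : 8 * ‖M‖ ^ 2 * r ^ 2 + 4 * α + 2 ≤ K)
    {g : ℕ → H} (h0 : (D 0 0, g 0) ∈ A) (hk : ∀ k, k ≠ 0 → (D 0 k, g k) ∈ B)
    (hg : Summable fun k => ‖g k‖ ^ 2) {t : ℝ} (ht : 0 ≤ t) :
    perpSq (D t) ≤ perpSq (D 0) * Real.exp (-t)
      + 6 * K * r ^ 2 * (∑' k, ‖g k‖ ^ 2 + ‖D 0‖ ^ 2)
        * Real.exp (-(4 / 9 * gapConst cP * (α * r ^ 2) * t)) := by
  have hc := gapConst_pos cP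
  have hc2 := gapConst_le cP
  have hK2 : 2 ≤ K := by linarith [show 0 ≤ 8 * ‖M‖ ^ 2 * r ^ 2 by positivity]
  have hs := small_of_h1Const hα hαr'
  set lam := 4 / 9 * gapConst cP * (α * r ^ 2) with hlam
  have hlam0 : 0 < lam := by positivity
  have hlam1 : lam ≤ 1 / 2 := by
    have : gapConst cP * (α * r ^ 2) ≤ 1 / 2 * (1 / 8) :=
      mul_le_mul hc2 hs.2 (by positivity) (by norm_num)
    rw [hlam]; linarith
  set Q := 3 * K * (∑' k, ‖g k‖ ^ 2 + ‖D 0‖ ^ 2) with hQ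
  have hQ0 : 0 ≤ Q := by
    have : 0 ≤ ∑' k, ‖g k‖ ^ 2 := by positivity
    have : 0 ≤ K := by linarith
    positivity
  set γ : ℝ → ℝ := fun s => √(Q * Real.exp (-(lam * s))) with hγ
  have hγ2 : ∀ s, γ s ^ 2 = Q * Real.exp (-(lam * s)) := fun s => Real.sq_sqrt (by positivity)
  have hslope := hD.upperSlope_perpSq h hr (g := γ) (by fun_prop)
    (fun δ R W hR hδ1 s hs => Real.le_sqrt_of_sq_le
      (hD.norm_snd_sq_le h h₁ h₁' hr hDe hα hαr hαr' hK h0 hk hg hR hδ1 hs))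
  -- Young's inequality `2 r γ √Y ≤ Y + r² γ²` halves the damping rate to `1`. Since `lam ≤ 1 / 2`,
  -- the denominator `1 - lam` is at least `1 / 2`.
  have h1 := hslope.le_exp (lam := 1) (ν := lam) (S := r ^ 2 * Q) (η := 0) (T := t) one_pos
    (by linarith) le_rfl (continuousOn_perpSq hD.continuousOn) (fun s _ _ => by
      have e1 := Real.sq_sqrt (perpSq_nonneg (D s))
      have e2 := sq_nonneg (√(perpSq (D s)) - r * γ s)
      have e3 := hγ2 s
      have e4 : r ^ 2 * γ s ^ 2 = r ^ 2 * Q * Real.exp (-(lam * s)) := by rw [e3]; ring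
      nlinarith) ht le_rfl
  rw [one_mul, zero_div, add_zero] at h1
  have h2 : 0 ≤ r ^ 2 * Q / (1 - lam) := div_nonneg (by positivity) (by linarith)
  have h3 : r ^ 2 * Q / (1 - lam) ≤ 2 * (r ^ 2 * Q) := by
    rw [div_le_iff₀ (by linarith)]
    nlinarith [show 0 ≤ r ^ 2 * Q by positivity]
  have h4 : r ^ 2 * Q / (lam - 1) = -(r ^ 2 * Q / (1 - lam)) := by
    rw [← div_neg, neg_sub]
  rw [h4] at h1
  have h5 := mul_nonneg h2 (Real.exp_pos (-t)).le
  have h6 := mul_le_mul_of_nonneg_right h3 (Real.exp_pos (-(lam * t))).le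
  rw [hQ] at h6
  nlinarith

end Decay

end VFP

namespace VFP

/-! ### The limit flow and the corrected zeroth mode -/

section Diffusion

variable {H : Type*} [NormedAddCommGroup H] [InnerProductSpace ℝ H]

/-- Weak solutions of `∂ₜ u + m B A u = 0`. -/
structure IsWeakHeatSol (A B : Submodule ℝ (H × H)) (m : ℝ) (u : ℝ → H) : Prop where
  continuousOn : ContinuousOn u (Ici 0)
  weak : ∀ φ w z : H, (φ, w) ∈ A → (w, z) ∈ B → ∀ t : ℝ, 0 ≤ t →
    HasDerivWithinAt (fun s : ℝ => inner ℝ (u s) φ) (-m * inner ℝ (u t) z) (Ici 0) t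

variable {A B : Submodule ℝ (H × H)} {b M : H →L[ℝ] H} {e : H} {cP δ r α K m : ℝ}
  {R W R' W' R₁ W₁ R₁' W₁' : H →L[ℝ] H} {D : ℝ → lp (fun _ : ℕ => H) 2} {u : ℝ → H}

theorem IsWeakHeatSol.hasDeriv [CompleteSpace H] (h : IsAdjointPair A B)
    (hu : IsWeakHeatSol A B m u) (hR : IsResolvent A B δ R W) {t : ℝ} (ht : 0 ≤ t) :
    HasDerivWithinAt (fun s => R (u s)) (-m • δ⁻¹ • (u t - R (u t))) (Ici 0) t := by
  refine hasDerivWithinAt_of_inner (F := fun t => -m • δ⁻¹ • (u t - R (u t))) ?_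
    (fun ψ s hs => ?_) ht
  · exact ((hu.continuousOn.sub (R.continuous.comp_continuousOn
      hu.continuousOn)).const_smul _).const_smul _
  · have := hu.weak (R ψ) (W ψ) _ (hR.fst ψ) (hR.snd ψ) s hs
    simp only [hR.symm h]
    convert this using 1
    simp only [inner_smul_left, inner_smul_right, inner_sub_left, inner_sub_right, conj_trivial,
      hR.symm h]

/-- The regularized square `⟨R u, u⟩` decays at the rate `2 m / cP²` for every `δ` by the Poincaré
inequality for the Yosida approximation; then `δ` tends to zero. -/
theorem IsWeakHeatSol.norm_sq_le [CompleteSpace H] (h : HermitePair A B b M e cP) (hm : 0 < m)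
    (hu : IsWeakHeatSol A B m u) (hue : ∀ t, 0 ≤ t → inner ℝ (u t) e = 0) {t : ℝ} (ht : 0 ≤ t) :
    ‖u t‖ ^ 2 ≤ ‖u 0‖ ^ 2 * Real.exp (-(2 * m / cP ^ 2 * t)) := by
  have hp := h.toIsAdjointPair
  have hc := h.poincare_pos
  obtain ⟨δ, R, W, R', W', N, hR, hR', hδ1, hN, hδ, -⟩ := hp.exists_seq 0 0 0
  have key : ∀ n, inner ℝ (R n (u t)) (u t) ≤ ‖u 0‖ ^ 2 * Real.exp (-(2 * m / cP ^ 2 * t)) := by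
    intro n
    have hd := fun s (hs : 0 ≤ s) => hasDerivWithinAt_inner_of_symm ((hR n).symm hp)
      (hu.hasDeriv hp (hR n) hs) (hu.continuousOn s hs)
    have h1 := (UpperSlopeLE.of_hasDerivWithinAt hd).le_exp_of_le (lam := 2 * m / cP ^ 2) (η := 0)
      (T := t) (by positivity) le_rfl
      (f := fun s => inner ℝ (R n (u s)) (u s))
      (((R n).continuous.comp_continuousOn hu.continuousOn).inner hu.continuousOn)
      (fun s hs _ => by
        have h2 := h.inner_resolvent_le (hR n) (hue s hs)
        rw [inner_smul_left, conj_trivial, add_zero]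
        have h3 : 2 * m / cP ^ 2 * inner ℝ (R n (u s)) (u s)
            ≤ 2 * m / cP ^ 2 * (cP ^ 2 * inner ℝ ((δ n)⁻¹ • (u s - R n (u s))) (u s)) := by
          gcongr
        have h4 : 2 * m / cP ^ 2 * (cP ^ 2 * inner ℝ ((δ n)⁻¹ • (u s - R n (u s))) (u s))
            = 2 * m * inner ℝ ((δ n)⁻¹ • (u s - R n (u s))) (u s) := by field_simp
        linarith) ht le_rfl
    have h5 := inner_resolvent_le_norm_sq hp.symm (hR n) (u 0)
    rw [zero_div, add_zero] at h1
    refine h1.trans ?_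
    rw [mul_comm]
    exact mul_le_mul_of_nonneg_right h5 (Real.exp_pos _).le
  have h6 := (IsResolvent.tendsto hp hR hδ (u t)).inner (𝕜 := ℝ) (tendsto_const_nhds (x := u t))
  rw [real_inner_self_eq_norm_sq] at h6
  exact le_of_tendsto' h6 key

theorem IsWeakHeatSol.inner_kernel [CompleteSpace H] (h : HermitePair A B b M e cP)
    (hu : IsWeakHeatSol A B m u) {t : ℝ} (ht : 0 ≤ t) : inner ℝ (u t) e = inner ℝ (u 0) e := by
  have hd := fun s (hs : 0 ≤ s) => hu.weak e 0 0 h.kernel B.zero_mem s hs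
  simp only [inner_zero_right, mul_zero] at hd
  exact constant_of_has_deriv_right_zero (a := 0) (b := t)
      (fun x hx => ((hd x hx.1).continuousWithinAt).mono Icc_subset_Ici_self)
      (fun x hx => (hd x hx.1).mono (Ici_subset_Ici.2 hx.1)) t ⟨ht, le_rfl⟩

theorem IsWeakSol.inner_kernel [CompleteSpace H] (h : HermitePair A B b M e cP)
    (hD : IsWeakSol A b r D) {t : ℝ} (ht : 0 ≤ t) : inner ℝ (D t 0) e = inner ℝ (D 0 0) e := by
  have hd := fun s (hs : 0 ≤ s) => hD.weak 0 e 0 h.kernel s hs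
  simp only [inner_zero_right, mul_zero, CharP.cast_eq_zero, Real.sqrt_zero, zero_mul, sub_zero]
    at hd
  exact constant_of_has_deriv_right_zero (a := 0) (b := t)
      (fun x hx => ((hd x hx.1).continuousWithinAt).mono Icc_subset_Ici_self)
      (fun x hx => (hd x hx.1).mono (Ici_subset_Ici.2 hx.1)) t ⟨ht, le_rfl⟩

/-- The corrected and regularized zeroth mode. -/
noncomputable def corrector (R W' : H →L[ℝ] H) (r : ℝ) (v : lp (fun _ : ℕ => H) 2) (x : H) : H :=
  R (v 0 - x) + r • W' (v 1)

theorem continuousOn_corrector {s : Set ℝ} (hD : ContinuousOn D s) (hu : ContinuousOn u s) :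
    ContinuousOn (fun t => corrector R W' r (D t) (u t)) s :=
  (R.continuous.comp_continuousOn ((continuousOn_apply hD 0).sub hu)).add
    ((W'.continuous.comp_continuousOn (continuousOn_apply hD 1)).const_smul r)

/-- The squared `H⁻¹` norm, up to equivalence. -/
theorem inner_resolvent_add_le (h : IsAdjointPair A B) (h₁ : IsResolvent A B 1 R₁ W₁) (x y : H) :
    inner ℝ (R₁ (x + y)) (x + y) ≤ 2 * inner ℝ (R₁ x) x + 2 * inner ℝ (R₁ y) y := by
  have h1 := h₁.inner_self h (x - y)
  rw [map_sub, inner_sub_left, inner_sub_right, inner_sub_right] at h1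
  rw [map_add, inner_add_left, inner_add_right, inner_add_right]
  nlinarith [sq_nonneg ‖R₁ x - R₁ y‖, sq_nonneg ‖W₁ (x - y)‖]

/-- The form of `R₁` gains the derivative that `W' = B R'` loses: `R₁ W' = W₁' R'` and `W₁ W' = (1 -
R₁') R'` are contractions. Hence adding `r W' D₁` changes the `H⁻¹` size only by `O(r ‖D‖)`. -/
theorem inner_resolvent_snd_le (h : IsAdjointPair A B)
    (hR' : IsResolvent B A δ R' W') (h₁ : IsResolvent A B 1 R₁ W₁)
    (h₁' : IsResolvent B A 1 R₁' W₁') (x : H) :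
    inner ℝ (R₁ (W' x)) (W' x) ≤ 2 * ‖x‖ ^ 2 := by
  rw [h₁.inner_self h, one_mul]
  have e1 : R₁ (W' x) = W₁' (R' x) := (h₁'.apply_of_mem h.symm h₁ (hR'.fst x)).symm
  have e2 : W₁ (W' x) = R' x - R₁' (R' x) := by
    rw [h₁.apply_of_mem h h₁' (hR'.snd x), hR'.apply_generator h.symm h₁']
  have n0 := hR'.norm_apply_le h.symm x
  have n1 : ‖R₁ (W' x)‖ ≤ ‖x‖ := by
    rw [e1]
    simpa using (h₁'.norm_apply_snd_le h.symm (R' x)).trans (by simpa using n0)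
  have n2 : ‖W₁ (W' x)‖ ≤ ‖x‖ := by
    rw [e2]
    exact (h₁'.norm_sub_le h.symm _).trans n0
  have n3 : ‖R₁ (W' x)‖ ^ 2 ≤ ‖x‖ ^ 2 := by gcongr
  have n4 : ‖W₁ (W' x)‖ ^ 2 ≤ ‖x‖ ^ 2 := by gcongr
  linarith

theorem inner_corrector_le (h : IsAdjointPair A B)
    (hR' : IsResolvent B A δ R' W') (h₁ : IsResolvent A B 1 R₁ W₁)
    (h₁' : IsResolvent B A 1 R₁' W₁') (v : lp (fun _ : ℕ => H) 2) (x : H) :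
    inner ℝ (R₁ (corrector R W' r v x)) (corrector R W' r v x)
      ≤ 2 * inner ℝ (R₁ (R (v 0 - x))) (R (v 0 - x)) + 4 * r ^ 2 * ‖v‖ ^ 2 := by
  refine (inner_resolvent_add_le h h₁ _ _).trans ?_
  rw [← map_smul]
  have h1 := inner_resolvent_snd_le h hR' h₁ h₁' (r • v 1)
  rw [norm_smul, mul_pow, Real.norm_eq_abs, sq_abs] at h1
  have h2 : r ^ 2 * ‖v 1‖ ^ 2 ≤ r ^ 2 * ‖v‖ ^ 2 := by
    gcongr; exact norm_coe_le v 1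
  linarith

theorem inner_le_corrector (h : IsAdjointPair A B)
    (hR' : IsResolvent B A δ R' W') (h₁ : IsResolvent A B 1 R₁ W₁)
    (h₁' : IsResolvent B A 1 R₁' W₁') (v : lp (fun _ : ℕ => H) 2) (x : H) :
    inner ℝ (R₁ (R (v 0 - x))) (R (v 0 - x))
      ≤ 2 * inner ℝ (R₁ (corrector R W' r v x)) (corrector R W' r v x)
        + 4 * r ^ 2 * ‖v‖ ^ 2 := by
  have e : R (v 0 - x) = corrector R W' r v x + W' ((-r) • v 1) := by
    rw [corrector, map_smul, neg_smul, add_neg_cancel_right]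
  have h0 := inner_resolvent_add_le h h₁ (corrector R W' r v x) (W' ((-r) • v 1))
  rw [← e] at h0
  have h1 := inner_resolvent_snd_le h hR' h₁ h₁' ((-r) • v 1)
  rw [norm_smul, mul_pow, Real.norm_eq_abs, sq_abs, neg_sq] at h1
  have h2 : r ^ 2 * ‖v 1‖ ^ 2 ≤ r ^ 2 * ‖v‖ ^ 2 := by
    gcongr; exact norm_coe_le v 1
  linarith

/-- Young's inequality puts every product containing `ξ` into the coercive term `-2 c r² ξ²`, with
`c r² ξ²` left for the decay. What remains in `r η` and `√Yp` is of order `r² (1 + r²)`, which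
determines `μ`, and is absorbed by the dissipation `Zp / 4 + Yp` in `F'`. Only the defect `(m / r² -
1) U` survives as a source. -/
theorem corrector_slope_aux {d U ξ η y Yp c p f Zp F F' lam μ E : ℝ} (hr : 0 < r) (hc : 0 < c)
    (hU : 0 ≤ U) (hp : 0 ≤ p) (hYp : 0 ≤ Yp) (hc2 : c ≤ 1)
    (hy : y ≤ ξ + r * η)
    (hf : f ≤ y ^ 2) (hy0 : 0 ≤ y)
    (hd : d ≤ 2 * (-r ^ 2 * (c * ξ ^ 2 - r * ξ * η) + (|m - r ^ 2| * U + p * r ^ 2 * √Yp) * y))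
    (hμ : μ = (8 * (4 / c + 3) + (4 / c + 1) * p ^ 2) * (r ^ 2 * (1 + r ^ 2)))
    (hZ : η ^ 2 ≤ 2 * Zp) (hlam : lam ≤ c / 2 * r ^ 2) (hf0 : 0 ≤ f)
    (hF : F' ≤ -(1 / 4) * Zp - Yp - lam * F + E) :
    d + μ * F' ≤ -lam * (f + μ * F) + r ^ 2 * ((4 / c + 1) * ((m / r ^ 2 - 1) ^ 2 * U ^ 2))
      + μ * E := by
  set θ := |m / r ^ 2 - 1| with hθ
  have hθ0 : 0 ≤ θ := abs_nonneg _
  have hθr : |m - r ^ 2| = r ^ 2 * θ := by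
    have e : m - r ^ 2 = r ^ 2 * (m / r ^ 2 - 1) := by field_simp
    rw [e, abs_mul, abs_of_pos (show 0 < r ^ 2 by positivity)]
  rw [hθr] at hd
  rw [← sq_abs (m / r ^ 2 - 1), ← hθ]
  set s := √Yp
  have hs : s ^ 2 = Yp := Real.sq_sqrt hYp
  have hs0 : 0 ≤ s := Real.sqrt_nonneg _
  have y1 : ∀ a, 2 * (ξ * a) ≤ c / 4 * ξ ^ 2 + 4 / c * a ^ 2 := fun a => by
    have : c / 4 * ξ ^ 2 + 4 / c * a ^ 2 - 2 * (ξ * a) = (c * ξ - 4 * a) ^ 2 / (4 * c) := by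
      field_simp; ring
    have h0 : 0 ≤ (c * ξ - 4 * a) ^ 2 / (4 * c) := by positivity
    linarith
  have d1 : d ≤ r ^ 2 * (-(2 * c) * ξ ^ 2 + 2 * (ξ * (r * η)) + 2 * ((θ * U + p * s) * (ξ + r * η)))
      := by
    have : (r ^ 2 * θ * U + p * r ^ 2 * s) * y ≤ (r ^ 2 * θ * U + p * r ^ 2 * s) * (ξ + r * η) := by
      gcongr
    linarith
  have k1 := y1 (r * η)
  have k2 := y1 (θ * U)
  have k3 := y1 (p * s)
  have k4 := two_mul_le_add_sq (θ * U) (r * η)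
  have k5 := two_mul_le_add_sq (p * s) (r * η)
  have d2 : -(2 * c) * ξ ^ 2 + 2 * (ξ * (r * η)) + 2 * ((θ * U + p * s) * (ξ + r * η))
      ≤ -c * ξ ^ 2 + (4 / c + 2) * (r * η) ^ 2 + (4 / c + 1) * (p * s) ^ 2
        + (4 / c + 1) * (θ * U) ^ 2 := by
    have : 0 ≤ c * ξ ^ 2 := by positivity
    linarith
  have d3 : f ≤ 2 * ξ ^ 2 + 2 * (r * η) ^ 2 := by
    have : y ^ 2 ≤ (ξ + r * η) ^ 2 := by gcongr
    linarith [two_mul_le_add_sq ξ (r * η)]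
  have d4 : lam * f ≤ r ^ 2 * (c * ξ ^ 2 + (r * η) ^ 2) := by
    have e1 : lam * f ≤ c / 2 * r ^ 2 * f := by gcongr
    have e2 : c / 2 * r ^ 2 * f ≤ c / 2 * r ^ 2 * (2 * ξ ^ 2 + 2 * (r * η) ^ 2) := by gcongr
    have e3 : c * (r * η) ^ 2 ≤ 1 * (r * η) ^ 2 := by gcongr
    have e4 := mul_le_mul_of_nonneg_left e3 (sq_nonneg r)
    linarith
  have d5 := mul_le_mul_of_nonneg_left d2 (sq_nonneg r)
  have q0 : 0 ≤ 4 / c := by positivity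
  have hμ0 : 0 ≤ μ := by rw [hμ]; positivity
  have d6 := mul_le_mul_of_nonneg_left hF hμ0
  have d7 : r ^ 2 * ((4 / c + 3) * (r * η) ^ 2) ≤ μ * (1 / 8 * η ^ 2) := by
    have : 0 ≤ (4 / c + 1) * p ^ 2 * (r ^ 2 * (1 + r ^ 2)) * (1 / 8 * η ^ 2) := by positivity
    have : 0 ≤ (4 / c + 3) * r ^ 2 * η ^ 2 := by positivity
    rw [hμ]
    linarith
  have d8 : r ^ 2 * ((4 / c + 1) * (p * s) ^ 2) ≤ μ * Yp := by
    have e1 : 0 ≤ 8 * (4 / c + 3) * (r ^ 2 * (1 + r ^ 2)) * Yp := by positivity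
    have e2 : 0 ≤ (4 / c + 1) * p ^ 2 * r ^ 4 * Yp := by positivity
    rw [hμ, mul_pow, hs]
    linarith
  have d9 := mul_le_mul_of_nonneg_left hZ hμ0
  linarith

variable [CompleteSpace H] (h : HermitePair A B b M e cP)
include h

/-- Adding `r B D₁` to `D₀ - u` cancels the term `r B D₁` in the derivative of `D₀` against the
damping of `D₁`. What is left is `-r² B A (D₀ - u)`, the mismatch `(m - r²) B A u` and the flux from
`D₂`. Tested with `ψ = R₁ Y`, the operator `B A` becomes the bounded `1 - R₁`, and `A A ψ` is
bounded by `‖Y‖` because `A = b - B`. -/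
theorem IsWeakSol.exists_deriv_corrector (hD : IsWeakSol A b r D) (hr : 0 < r)
    (hu : IsWeakHeatSol A B m u)
    (h₁ : IsResolvent A B 1 R₁ W₁)
    (hR : IsResolvent A B δ R W) (hR' : IsResolvent B A δ R' W')
    {t : ℝ} (ht : 0 ≤ t) (hDe : inner ℝ (D t 0) e = 0) (hue : inner ℝ (u t) e = 0) :
    ∃ d, HasDerivWithinAt (fun s => inner ℝ (R₁ (corrector R W' r (D s) (u s)))
        (corrector R W' r (D s) (u s))) d (Ici 0) t ∧
      d ≤ 2 * (-r ^ 2 * (gapConst cP * ‖R (D t 0 - u t)‖ ^ 2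
            - r * ‖R (D t 0 - u t)‖ * ‖W' (D t 1)‖)
          + (|m - r ^ 2| * ‖u t‖ + √2 * (‖b‖ + 1) * r ^ 2 * √(perpSq (D t)))
            * ‖corrector R W' r (D t) (u t)‖) := by
  have hp := h.toIsAdjointPair
  have hT0 : ∀ ψ, (R ψ, W ψ) ∈ A := hR.fst
  have hT1 : ∀ ψ, (W ψ, (b.comp W - δ⁻¹ • (ContinuousLinearMap.id ℝ H - R)) ψ) ∈ A := fun ψ => by
    simpa using h.add_right (hR.snd ψ)
  obtain ⟨F, hF, hFi⟩ := hD.exists_deriv hT0 (fun f ψ => hR.symm hp f ψ) 0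
  obtain ⟨G, hG, hGi⟩ := hD.exists_deriv hT1 (fun f ψ => hR'.inner_apply hp.symm hR f ψ) 1
  have hU := hu.hasDeriv hp hR ht
  have hY : HasDerivWithinAt (fun s => corrector R W' r (D s) (u s))
      (F t - (-m • δ⁻¹ • (u t - R (u t))) + r • G t) (Ici 0) t := by
    have := ((hF t ht).fun_sub hU).fun_add ((hG t ht).const_smul r)
    refine this.congr_of_eventuallyEq (Eventually.of_forall fun s => ?_) ?_ <;>
      simp [corrector]
  have hRY := R₁.hasFDerivAt.comp_hasDerivWithinAt t hY
  set Y := corrector R W' r (D t) (u t) with hYdef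
  refine ⟨_, hasDerivWithinAt_inner_of_symm (h₁.symm hp) hRY hY.continuousWithinAt, ?_⟩
  rw [h₁.symm hp, ← hYdef]
  set ψ := R₁ Y with hψ
  have hg : δ⁻¹ • (ψ - R ψ) = R (Y - ψ) := hR.generator_apply hp h₁ Y
  have e1 : inner ℝ (-m • δ⁻¹ • (u t - R (u t))) ψ = -m * inner ℝ (u t) (R (Y - ψ)) := by
    rw [← hg]
    simp only [inner_smul_left, inner_smul_right, inner_sub_left, inner_sub_right, conj_trivial,
      hR.symm hp]
  have e0 : inner ℝ (F t - (-m • δ⁻¹ • (u t - R (u t))) + r • G t) ψ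
      = inner ℝ (F t) ψ - inner ℝ (-m • δ⁻¹ • (u t - R (u t))) ψ + r * inner ℝ (G t) ψ := by
    rw [inner_add_left, inner_sub_left, inner_smul_left (G t), conj_trivial]
  rw [e0, e1, hFi, hGi]
  simp only [Nat.cast_zero, Real.sqrt_zero, zero_mul, zero_add, Real.sqrt_one, one_mul, zero_sub,
    sub_zero, Nat.cast_one, Nat.sub_self, sub_apply, ContinuousLinearMap.id_apply,
    ContinuousLinearMap.comp_apply, sub_sub_cancel, smul_apply, hg]
  rw [show (1 : ℝ) + 1 = 2 by norm_num]
  set ξ := R (D t 0 - u t) with hξ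
  have hYeq : Y = ξ + r • W' (D t 1) := rfl
  have hξe : inner ℝ ξ e = 0 := by
    rw [hξ, h.inner_kernel hR, inner_sub_left, hDe, hue, sub_zero]
  have g1 : gapConst cP * ‖ξ‖ ^ 2 - r * ‖ξ‖ * ‖W' (D t 1)‖
      ≤ inner ℝ (D t 0 - u t) (R (Y - ψ)) := by
    rw [← hR.symm hp, ← hξ]
    have e2 : Y - ψ = (ξ - R₁ ξ) + r • (W' (D t 1) - R₁ (W' (D t 1))) := by
      rw [hψ, hYeq, map_add, map_smul, smul_sub]; abel
    rw [e2, inner_add_right, inner_smul_right]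
    have g2 := h.gap_mul_le h₁ hξe
    rw [real_inner_comm] at g2
    have g3 := abs_real_inner_le_norm ξ (W' (D t 1) - R₁ (W' (D t 1)))
    have g4 : |inner ℝ ξ (W' (D t 1) - R₁ (W' (D t 1)))| ≤ ‖ξ‖ * ‖W' (D t 1)‖ :=
      g3.trans (by gcongr; exact h₁.norm_sub_le hp _)
    have g5 := mul_le_mul_of_nonneg_left (neg_le_of_abs_le g4) hr.le
    linarith
  have n1 : ‖R (Y - ψ)‖ ≤ ‖Y‖ := (hR.norm_apply_le hp _).trans (h₁.norm_sub_le hp Y)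
  have g6 : (m - r ^ 2) * inner ℝ (u t) (R (Y - ψ)) ≤ |m - r ^ 2| * ‖u t‖ * ‖Y‖ := by
    refine (le_abs_self _).trans ?_
    rw [abs_mul, mul_assoc]
    gcongr
    exact (abs_real_inner_le_norm _ _).trans (by gcongr)
  have n2 : ‖W ψ‖ ≤ ‖Y‖ := by
    rw [hψ, hR.apply_of_mem hp hR' (h₁.fst Y)]
    refine (hR'.norm_apply_le hp.symm _).trans ?_
    simpa using h₁.norm_apply_snd_le hp Y
  have g7 : inner ℝ (D t 2) (b (W ψ) - R (Y - ψ))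
      ≤ √(perpSq (D t)) * ((‖b‖ + 1) * ‖Y‖) := by
    refine (real_inner_le_norm _ _).trans ?_
    gcongr
    · exact Real.le_sqrt_of_sq_le (norm_sq_le_perpSq (D t) 1)
    · refine (norm_sub_le _ _).trans ?_
      rw [add_mul, one_mul]
      exact add_le_add ((b.le_opNorm _).trans (by gcongr)) n1
  have g8 := mul_le_mul_of_nonneg_left g7 (show 0 ≤ √2 * r ^ 2 by positivity)
  have g9 := mul_le_mul_of_nonneg_left g1 (sq_nonneg r)
  rw [inner_sub_left (D t 0)] at g9
  linarith

end Diffusion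

end VFP

namespace VFP

/-! ### Decay of the difference in the `H⁻¹` form -/

section DiffusionDecay

variable {H : Type*} [NormedAddCommGroup H] [InnerProductSpace ℝ H]
variable {A B : Submodule ℝ (H × H)} {b M : H →L[ℝ] H} {e : H} {cP δ r α K m : ℝ}
  {R W R' W' R₁ W₁ R₁' W₁' : H →L[ℝ] H} {D : ℝ → lp (fun _ : ℕ => H) 2} {u : ℝ → H}

/-- The weight of the `H¹` functional in the estimate of the corrected zeroth mode. -/
noncomputable def correctorConst (β cP : ℝ) : ℝ :=
  8 * (4 / gapConst cP + 3) + (4 / gapConst cP + 1) * (√2 * (β + 1)) ^ 2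

theorem correctorConst_pos (β cP : ℝ) : 0 < correctorConst β cP := by
  have := gapConst_pos cP
  unfold correctorConst
  positivity

/-- The source in the corrected estimate decays like the square of the limit flow, strictly faster
than the target rate. The gap is proportional to `r²`, so it cancels the factor `r²` of the source
and leaves no resonance. -/
theorem rate_gap (hr : 0 < r) (hc : 0 < cP) (hα : 0 < α) (hα8 : α ≤ 1 / 8) :
    r ^ 2 / (2 * cP ^ 2) ≤ r ^ 2 / cP ^ 2 - 4 / 9 * gapConst cP * (α * r ^ 2) := by
  have h1 : gapConst cP ≤ 1 / (2 * cP ^ 2) := by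
    rw [gapConst]
    gcongr
    linarith
  have h2 : gapConst cP * (α * r ^ 2) ≤ 1 / (2 * cP ^ 2) * (1 / 8 * r ^ 2) := by
    have := gapConst_pos cP
    gcongr
  have h3 : 1 / (2 * cP ^ 2) * (1 / 8 * r ^ 2) = 1 / 16 * (r ^ 2 / cP ^ 2) := by
    field_simp; norm_num
  have h4 : r ^ 2 / (2 * cP ^ 2) = 1 / 2 * (r ^ 2 / cP ^ 2) := by field_simp
  have h5 : 0 ≤ r ^ 2 / cP ^ 2 := by positivity
  rw [h3] at h2
  rw [h4]
  linarith

variable [CompleteSpace H] (h : HermitePair A B b M e cP)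
include h

theorem IsWeakSol.inner_corrector_add_le (hD : IsWeakSol A b r D)
    (h₁ : IsResolvent A B 1 R₁ W₁) (h₁' : IsResolvent B A 1 R₁' W₁') (hr : 0 < r)
    (hDe : ∀ t, 0 ≤ t → inner ℝ (D t 0) e = 0)
    (hα : 0 < α) (hαr : α * (l2Const ‖b‖ cP * (1 + r ^ 2)) ≤ 1)
    (hαr' : α * (h1Const ‖M‖ * (1 + r ^ 2)) ≤ 1) (hα8 : α ≤ 1 / 8)
    (hK : 8 * ‖M‖ ^ 2 * r ^ 2 + 4 * α + 2 ≤ K)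
    (hu : IsWeakHeatSol A B m u) (hm : r ^ 2 / 2 ≤ m)
    (hue : ∀ t, 0 ≤ t → inner ℝ (u t) e = 0)
    (hR : IsResolvent A B δ R W) (hR' : IsResolvent B A δ R' W') (hδ1 : δ ≤ 1) {N : ℕ}
    (hN : 4 ≤ N) {μ : ℝ} (hμ : μ = correctorConst ‖b‖ cP * (r ^ 2 * (1 + r ^ 2)))
    {t : ℝ} (ht : 0 ≤ t) :
    inner ℝ (R₁ (corrector R W' r (D t) (u t))) (corrector R W' r (D t) (u t))
        + μ * h1Func W W' R' W₁ N r α K (D t)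
      ≤ Real.exp (-(4 / 9 * gapConst cP * (α * r ^ 2) * t)) *
          (inner ℝ (R₁ (corrector R W' r (D 0) (u 0))) (corrector R W' r (D 0) (u 0))
            + μ * h1Func W W' R' W₁ N r α K (D 0)
            + 2 * cP ^ 2 * (4 / gapConst cP + 1) * ((m / r ^ 2 - 1) ^ 2 * ‖u 0‖ ^ 2))
        + (√N)⁻¹ * (μ * (2 * r * (δ⁻¹ * (‖b‖ + (√δ)⁻¹)) * (3 * ‖D 0‖ ^ 2)))
          / (4 / 9 * gapConst cP * (α * r ^ 2)) := by
  have hp := h.toIsAdjointPair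
  have hsm := small_of_l2Const hα hαr
  have hc := gapConst_pos cP
  have hc2 := gapConst_le cP
  have hcP := h.poincare_pos
  have hδ0 := hR.pos
  have hK2 : 2 ≤ K := by linarith [show 0 ≤ 8 * ‖M‖ ^ 2 * r ^ 2 by positivity]
  have hN0 : 0 < N := by omega
  have hm0 : 0 < m := lt_of_lt_of_le (by positivity) hm
  have hμ0 : 0 < μ := by
    have := correctorConst_pos ‖b‖ cP
    rw [hμ]; positivity
  set lam := 4 / 9 * gapConst cP * (α * r ^ 2) with hlam
  have hlam0 : 0 < lam := by positivity
  have hgap := rate_gap hr hcP hα hα8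
  rw [← hlam] at hgap
  have hq : 0 < r ^ 2 / (2 * cP ^ 2) := by positivity
  set q := 2 * r * (δ⁻¹ * (‖b‖ + (√δ)⁻¹)) * (3 * ‖D 0‖ ^ 2) with hqdef
  have hq0 : 0 ≤ q := by positivity
  set Θ := (m / r ^ 2 - 1) ^ 2 * ‖u 0‖ ^ 2 with hΘ
  have hF := hD.upperSlope_h1Func h h₁ h₁' hr hDe hα hαr hαr' hK hR hR' hδ1 hN
  choose! d hd hle using fun t (ht : 0 ≤ t) =>
    hD.exists_deriv_corrector h hr hu h₁ hR hR' ht (hDe t ht) (hue t ht)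
  have hS := (UpperSlopeLE.of_hasDerivWithinAt hd).add (hF.const_mul hμ0)
  have cc := continuousOn_corrector (R := R) (W' := W') (r := r) hD.continuousOn hu.continuousOn
  have hcont : ContinuousOn (fun t => inner ℝ (R₁ (corrector R W' r (D t) (u t)))
      (corrector R W' r (D t) (u t)) + μ * h1Func W W' R' W₁ N r α K (D t)) (Ici 0) :=
    ((R₁.continuous.comp_continuousOn cc).inner cc).add
      (continuousOn_const.mul (continuousOn_h1Func N hD.continuousOn))
  -- The limit flow satisfies `‖u‖² ≤ ‖u 0‖² exp (-2 m s / cP²)`, and `m ≥ r² / 2` makes this at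
  -- least as fast as `ν`.
  have h1 := hS.le_exp (lam := lam) (ν := r ^ 2 / cP ^ 2)
    (S := r ^ 2 * ((4 / gapConst cP + 1) * Θ)) (η := (√N)⁻¹ * (μ * q)) (T := t) hlam0
    (by linarith) (by positivity)
    hcont (fun s hs _ => by
      have f1 := h₁.inner_self hp (corrector R W' r (D s) (u s))
      have f2 := inner_resolvent_le_norm_sq hp.symm h₁ (corrector R W' r (D s) (u s))
      have f3 : ‖corrector R W' r (D s) (u s)‖ ≤ ‖R (D s 0 - u s)‖ + r * ‖W' (D s 1)‖ := by
        refine (norm_add_le _ _).trans ?_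
        rw [norm_smul, Real.norm_of_nonneg hr.le]
      have f4 := le_h1Perp (W' := W') hN (D s)
      have f5 : 4 / 9 * gapConst cP * (α * r ^ 2) ≤ gapConst cP / 2 * r ^ 2 := by
        have : gapConst cP * (α * r ^ 2) ≤ gapConst cP * (1 / 8 * r ^ 2) := by gcongr
        linarith [show 0 ≤ gapConst cP * r ^ 2 by positivity]
      have f6 := corrector_slope_aux (U := ‖u s‖) (p := √2 * (‖b‖ + 1)) (m := m) hr hc
        (norm_nonneg _) (by positivity) (perpSq_nonneg (D s)) (by linarith) f3 f2 (norm_nonneg _)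
        (hle s hs) hμ (Zp := h1Perp W' N (D s)) (by linarith [sq_nonneg ‖W' (D s 2)‖])
        f5 (by rw [f1]; positivity) (F := h1Func W W' R' W₁ N r α K (D s))
        (E := 2 * r * (√(N : ℝ))⁻¹ * (δ⁻¹ * (‖b‖ + (√δ)⁻¹)) * ‖D s‖ ^ 2) le_rfl
      refine f6.trans ?_
      have f7 := hu.norm_sq_le h hm0 hue hs
      have f8 : Real.exp (-(2 * m / cP ^ 2 * s)) ≤ Real.exp (-(r ^ 2 / cP ^ 2 * s)) := by
        gcongr
        linarith
      have f9 : ‖u s‖ ^ 2 ≤ ‖u 0‖ ^ 2 * Real.exp (-(r ^ 2 / cP ^ 2 * s)) :=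
        f7.trans (by gcongr)
      have f10 : r ^ 2 * ((4 / gapConst cP + 1) * ((m / r ^ 2 - 1) ^ 2 * ‖u s‖ ^ 2))
          ≤ r ^ 2 * ((4 / gapConst cP + 1) * ((m / r ^ 2 - 1) ^ 2
            * (‖u 0‖ ^ 2 * Real.exp (-(r ^ 2 / cP ^ 2 * s))))) := by gcongr
      have e1 := hD.norm_sq_le_const h h₁ h₁' hr hDe hα hαr hs
      have f11 : μ * (2 * r * (√(N : ℝ))⁻¹ * (δ⁻¹ * (‖b‖ + (√δ)⁻¹)) * ‖D s‖ ^ 2)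
          ≤ μ * (2 * r * (√(N : ℝ))⁻¹ * (δ⁻¹ * (‖b‖ + (√δ)⁻¹)) * (3 * ‖D 0‖ ^ 2)) := by
        gcongr
      rw [hqdef, hΘ, ← hlam]
      linarith) ht le_rfl
  refine h1.trans ?_
  have g1 : r ^ 2 * ((4 / gapConst cP + 1) * Θ) / (r ^ 2 / cP ^ 2 - lam)
      ≤ 2 * cP ^ 2 * (4 / gapConst cP + 1) * Θ := by
    rw [div_le_iff₀ (by linarith)]
    have : 2 * cP ^ 2 * (4 / gapConst cP + 1) * Θ * (r ^ 2 / (2 * cP ^ 2))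
        = r ^ 2 * ((4 / gapConst cP + 1) * Θ) := by field_simp
    rw [← this]
    have : 0 ≤ 2 * cP ^ 2 * (4 / gapConst cP + 1) * Θ := by positivity
    gcongr
  have g2 : 0 ≤ r ^ 2 * ((4 / gapConst cP + 1) * Θ) / (r ^ 2 / cP ^ 2 - lam)
      * Real.exp (-(r ^ 2 / cP ^ 2 * t)) := by
    refine mul_nonneg (div_nonneg (by positivity) (by linarith)) (Real.exp_pos _).le
  have g3 := mul_le_mul_of_nonneg_left g1 (Real.exp_pos (-(lam * t))).le
  linarith

/-- The corrector is removed at both ends of the time interval at the cost of multiples of `r²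
‖D‖²`, which decay by the `L²` estimate. First `N` tends to infinity and then `δ` to zero. -/
theorem IsWeakSol.inner_resolvent_sub_le (hD : IsWeakSol A b r D)
    (h₁ : IsResolvent A B 1 R₁ W₁) (h₁' : IsResolvent B A 1 R₁' W₁') (hr : 0 < r)
    (hDe : ∀ t, 0 ≤ t → inner ℝ (D t 0) e = 0)
    (hα : 0 < α) (hαr : α * (l2Const ‖b‖ cP * (1 + r ^ 2)) ≤ 1)
    (hαr' : α * (h1Const ‖M‖ * (1 + r ^ 2)) ≤ 1) (hα8 : α ≤ 1 / 8)
    (hK : 8 * ‖M‖ ^ 2 * r ^ 2 + 4 * α + 2 ≤ K)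
    {g : ℕ → H} (h0 : (D 0 0, g 0) ∈ A) (hk : ∀ k, k ≠ 0 → (D 0 k, g k) ∈ B)
    (hg : Summable fun k => ‖g k‖ ^ 2)
    (hu : IsWeakHeatSol A B m u) (hm : r ^ 2 / 2 ≤ m)
    (hue : ∀ t, 0 ≤ t → inner ℝ (u t) e = 0) {t : ℝ} (ht : 0 ≤ t) :
    inner ℝ (R₁ (D t 0 - u t)) (D t 0 - u t)
      ≤ Real.exp (-(4 / 9 * gapConst cP * (α * r ^ 2) * t)) *
          (4 * inner ℝ (R₁ (D 0 0 - u 0)) (D 0 0 - u 0)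
            + (20 * r ^ 2 + 4 * (correctorConst ‖b‖ cP * (r ^ 2 * (1 + r ^ 2))) * K)
              * (∑' k, ‖g k‖ ^ 2 + ‖D 0‖ ^ 2)
            + 4 * cP ^ 2 * (4 / gapConst cP + 1) * ((m / r ^ 2 - 1) ^ 2 * ‖u 0‖ ^ 2)) := by
  have hp := h.toIsAdjointPair
  have hsm := small_of_l2Const hα hαr
  have hc := gapConst_pos cP
  have hK2 : 2 ≤ K := by linarith [show 0 ≤ 8 * ‖M‖ ^ 2 * r ^ 2 by positivity]
  set μ := correctorConst ‖b‖ cP * (r ^ 2 * (1 + r ^ 2)) with hμ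
  have hμ0 : 0 < μ := by
    have := correctorConst_pos ‖b‖ cP
    rw [hμ]; positivity
  set lam := 4 / 9 * gapConst cP * (α * r ^ 2) with hlam
  have hlam0 : 0 < lam := by positivity
  set S := 2 * cP ^ 2 * (4 / gapConst cP + 1) * ((m / r ^ 2 - 1) ^ 2 * ‖u 0‖ ^ 2) with hS
  set Q := ∑' k, ‖g k‖ ^ 2 + ‖D 0‖ ^ 2 with hQ
  have hQD : ‖D 0‖ ^ 2 ≤ Q := le_add_of_nonneg_left (by positivity)
  set ex := Real.exp (-(lam * t)) with hex
  have hex0 : 0 < ex := Real.exp_pos _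
  have fixed : ∀ (δ : ℝ) (R W R' W' : H →L[ℝ] H), IsResolvent A B δ R W → IsResolvent B A δ R' W' →
      δ ≤ 1 → inner ℝ (R₁ (R (D t 0 - u t))) (R (D t 0 - u t)) ≤
        ex * (4 * inner ℝ (R₁ (R (D 0 0 - u 0))) (R (D 0 0 - u 0)) + (20 * r ^ 2 + 4 * μ * K) * Q
          + 2 * S) := by
    intro δ R W R' W' hR hR' hδ1
    set q := μ * (2 * r * (δ⁻¹ * (‖b‖ + (√δ)⁻¹)) * (3 * ‖D 0‖ ^ 2)) with hq
    have key : ∀ N : ℕ, 4 ≤ N → inner ℝ (R₁ (R (D t 0 - u t))) (R (D t 0 - u t)) ≤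
        ex * (4 * inner ℝ (R₁ (R (D 0 0 - u 0))) (R (D 0 0 - u 0)) + (20 * r ^ 2 + 4 * μ * K) * Q
          + 2 * S) + (√N)⁻¹ * (2 * (q / lam)) := by
      intro N hN
      have hN0 : 0 < N := by omega
      have k1 := hD.inner_corrector_add_le h h₁ h₁' hr hDe hα hαr hαr' hα8 hK hu hm hue hR hR' hδ1
        hN hμ ht
      rw [← hlam, ← hex, ← hS, ← hq, mul_div_assoc] at k1
      have k2 := inner_le_corrector (r := r) hp hR' h₁ h₁' (R := R) (D t) (u t)
      have k3 := inner_corrector_le (r := r) hp hR' h₁ h₁' (R := R) (D 0) (u 0)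
      have k4 := h1Func_zero_le hp h₁ hR hR' hr hα hsm hK2 hN0 h0 hk hg
      rw [← hQ] at k4
      have k5 := (h1Func_bounds (W := W) hp h₁ hR' hr hα hsm hK2 hN0 (D t)).1
      have k6 := h1Energy_eq (W := W) (W' := W') hN0 (D t)
      have k7 := h1Perp_nonneg (W' := W') N (D t)
      have k8 : 0 ≤ K * l2Func W₁ r α (D t) := mul_nonneg (by linarith)
        ((l2Func_bounds hp h₁ hr hα hsm (D t)).1.trans' (by positivity))
      have k9 : 0 ≤ μ * h1Func W W' R' W₁ N r α K (D t) :=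
        mul_nonneg hμ0.le (by linarith [sq_nonneg ‖W (D t 0)‖])
      have k10 := hD.norm_sq_le h h₁ h₁' hr hDe hα hαr ht
      have k11 : Real.exp (-(2 / 3 * gapConst cP * (α * r ^ 2) * t)) ≤ ex := by
        refine Real.exp_le_exp.2 (neg_le_neg (mul_le_mul_of_nonneg_right ?_ ht))
        rw [hlam]
        have : 0 ≤ gapConst cP * (α * r ^ 2) := by positivity
        linarith
      have k12 : ‖D t‖ ^ 2 ≤ 3 * Q * ex := by
        refine k10.trans ?_
        gcongr
      have k13 := mul_le_mul_of_nonneg_left k12 (sq_nonneg r)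
      have k14 := mul_le_mul_of_nonneg_left k4 hμ0.le
      have k15 := mul_le_mul_of_nonneg_left hQD (sq_nonneg r)
      have k16 := mul_le_mul_of_nonneg_left (add_le_add k3 k14) hex0.le
      have k17 := mul_le_mul_of_nonneg_left k15 hex0.le
      linarith
    have hlim : Tendsto (fun N : ℕ => ex * (4 * inner ℝ (R₁ (R (D 0 0 - u 0))) (R (D 0 0 - u 0))
        + (20 * r ^ 2 + 4 * μ * K) * Q + 2 * S) + (√N)⁻¹ * (2 * (q / lam))) atTop
        (𝓝 (ex * (4 * inner ℝ (R₁ (R (D 0 0 - u 0))) (R (D 0 0 - u 0))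
          + (20 * r ^ 2 + 4 * μ * K) * Q + 2 * S) + 0)) := by
      refine Tendsto.const_add _ ?_
      have e1 : Tendsto (fun N : ℕ => (√(N : ℝ))⁻¹) atTop (𝓝 0) :=
        (Real.tendsto_sqrt_atTop.comp tendsto_natCast_atTop_atTop).inv_tendsto_atTop
      simpa using e1.mul_const (2 * (q / lam))
    simpa using ge_of_tendsto hlim (eventually_atTop.2 ⟨4, key⟩)
  obtain ⟨δ, R, W, R', W', -, hR, hR', hδ1, -, hδ, -⟩ := hp.exists_seq 0 0 0
  have ht1 : ∀ x : H, Tendsto (fun n => inner ℝ (R₁ (R n x)) (R n x)) atTop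
      (𝓝 (inner ℝ (R₁ x) x)) := fun x => by
    have := IsResolvent.tendsto hp hR hδ x
    exact ((R₁.continuous.tendsto x).comp this).inner this
  have hfin := le_of_tendsto_of_tendsto' (ht1 (D t 0 - u t))
    ((((ht1 (D 0 0 - u 0)).const_mul 4).add_const _ |>.add_const _).const_mul ex)
    (fun n => fixed _ _ _ _ _ (hR n) (hR' n) (hδ1 n))
  refine hfin.trans (le_of_eq ?_)
  rw [hS]
  ring

end DiffusionDecay

end VFP

namespace VFP

/-! ### The elliptic problem and the abstract decay theorem -/

section Elliptic

variable {H : Type*} [NormedAddCommGroup H] [InnerProductSpace ℝ H]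
variable {A B : Submodule ℝ (H × H)} {b M : H →L[ℝ] H} {e : H} {cP : ℝ}
  {R₁ W₁ : H →L[ℝ] H}

/-- On the complement of `e` the resolvent `R` with `δ = 1` is a strict contraction, because `‖R v‖²
≤ ⟨R v, v⟩ ≤ (1 - gapConst cP) ‖v‖²`. The Neumann series `f = ∑ Rⁿ x` solves `f - R f = x`, that is,
`B A (R f) = x`. -/
theorem HermitePair.exists_elliptic [CompleteSpace H] (h : HermitePair A B b M e cP) {x : H}
    (hx : inner ℝ x e = 0) : ∃ v w, (v, w) ∈ A ∧ (w, x) ∈ B ∧ inner ℝ v e = 0 := by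
  have hp := h.toIsAdjointPair
  obtain ⟨R, W, hR⟩ := hp.exists_isResolvent one_pos
  set q := √(1 - gapConst cP) with hq
  have hc := gapConst_pos cP
  have hc2 := gapConst_le cP
  have hq2 : q ^ 2 = 1 - gapConst cP := Real.sq_sqrt (by linarith)
  have hq0 : 0 ≤ q := Real.sqrt_nonneg _
  have hq1 : q < 1 := by nlinarith
  have hit : ∀ n : ℕ, inner ℝ ((R ^ n) x) e = 0 ∧ ‖(R ^ n) x‖ ≤ q ^ n * ‖x‖ := by
    intro n
    induction n with
    | zero => simpa using hx
    | succ n ih =>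
      rw [pow_succ' R, mul_apply_eq_comp, h.inner_kernel hR]
      refine ⟨ih.1, ?_⟩
      have h1 := h.gap_mul_le hR ih.1
      rw [inner_sub_left, real_inner_self_eq_norm_sq, hR.inner_self hp] at h1
      have h2 : ‖R ((R ^ n) x)‖ ^ 2 ≤ (q * ‖(R ^ n) x‖) ^ 2 := by
        rw [mul_pow, hq2]
        linarith [sq_nonneg ‖W ((R ^ n) x)‖]
      refine (le_of_sq_le_sq h2 (by positivity)).trans ?_
      rw [pow_succ', mul_assoc]
      gcongr
      exact ih.2
  have hs : Summable fun n : ℕ => (R ^ n) x :=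
    Summable.of_norm_bounded ((summable_geometric_of_lt_one hq0 hq1).mul_right ‖x‖)
      fun n => (hit n).2
  set f := ∑' n : ℕ, (R ^ n) x with hf
  have hfx : f - R f = x := by
    have h1 := hs.tsum_eq_zero_add
    have h2 : R f = ∑' n : ℕ, (R ^ (n + 1)) x := by
      rw [hf, R.map_tsum hs]
      simp only [pow_succ' R, mul_apply_eq_comp]
    rw [h2, hf, h1]
    simp
  refine ⟨R f, W f, hR.fst f, ?_, ?_⟩
  · simpa [hfx] using hR.snd f
  · rw [h.inner_kernel hR, real_inner_comm]
    have h1 := (hs.hasSum.mapL (innerSL ℝ e)).tsum_eq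
    rw [← innerSL_apply_apply (𝕜 := ℝ), ← h1]
    refine (tsum_congr fun n => ?_).trans tsum_zero
    rw [innerSL_apply_apply, real_inner_comm, (hit n).1]

/-- `‖w - w'‖² = ⟨v - v', 0⟩`. So the norm `‖w‖` does not depend on the chosen solution, even
without normalising its mean. -/
theorem HermitePair.elliptic_unique (h : HermitePair A B b M e cP) {v v' w w' x : H}
    (hv : (v, w) ∈ A) (hw : (w, x) ∈ B) (hv' : (v', w') ∈ A) (hw' : (w', x) ∈ B) : w = w' := by
  have h1 := h.inner_eq (A.sub_mem hv hv') (B.sub_mem hw hw')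
  simp at h1
  exact sub_eq_zero.1 h1

theorem HermitePair.inner_resolvent_le_norm_elliptic (h : HermitePair A B b M e cP)
    (h₁ : IsResolvent A B 1 R₁ W₁) {w x : H} (hw : (w, x) ∈ B) :
    inner ℝ (R₁ x) x ≤ ‖w‖ ^ 2 := by
  have h1 := h.inner_eq (h₁.fst x) hw
  have h2 := h₁.inner_self h.toIsAdjointPair x
  have h3 := real_inner_le_norm (W₁ x) w
  rw [h1] at h3
  rw [one_mul] at h2
  nlinarith [sq_nonneg (‖W₁ x‖ - ‖w‖), sq_nonneg ‖R₁ x‖]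

/-- The converse half of the equivalence of `⟨R₁ x, x⟩` with the squared `H⁻¹` norm: `‖w‖² = ⟨v, x⟩
= ⟨w, W₁ x⟩ + ⟨v, R₁ x⟩`, and Poincaré bounds `v` by `w`. -/
theorem HermitePair.norm_elliptic_le (h : HermitePair A B b M e cP)
    (h₁ : IsResolvent A B 1 R₁ W₁) {v w x : H} (hv : (v, w) ∈ A) (hw : (w, x) ∈ B)
    (hve : inner ℝ v e = 0) : gapConst cP * ‖w‖ ^ 2 ≤ inner ℝ (R₁ x) x := by
  have hc := h.poincare_pos
  have h1 := h.inner_eq hv hw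
  have h2 := h.inner_eq hv (h₁.snd x)
  have h3 := h₁.inner_self h.toIsAdjointPair x
  rw [inv_one, one_smul, inner_sub_right, ← h1, real_inner_self_eq_norm_sq] at h2
  have h4 := real_inner_le_norm w (W₁ x)
  have h5 := real_inner_le_norm v (R₁ x)
  have h6 := h.poincare hv hve
  have h7 : ‖w‖ ≤ cP * ‖R₁ x‖ + ‖W₁ x‖ := by
    rcases eq_or_lt_of_le (norm_nonneg w) with h0 | h0
    · rw [← h0]; positivity
    · refine le_of_mul_le_mul_left ?_ h0
      have : ‖v‖ * ‖R₁ x‖ ≤ cP * ‖w‖ * ‖R₁ x‖ := by gcongr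
      nlinarith
  rw [gapConst, one_div, inv_mul_le_iff₀ (by positivity), h3, one_mul]
  have h8 : ‖w‖ ^ 2 ≤ (cP * ‖R₁ x‖ + ‖W₁ x‖) ^ 2 := by gcongr
  nlinarith [sq_nonneg (‖R₁ x‖ - cP * ‖W₁ x‖), sq_nonneg (cP * ‖R₁ x‖ - ‖W₁ x‖),
    sq_nonneg ‖R₁ x‖, sq_nonneg ‖W₁ x‖, mul_nonneg (sq_nonneg cP) (sq_nonneg ‖W₁ x‖)]

theorem sqrt_perp_aux {P P₀ t C₁ C₂ K₀ r G E : ℝ} (hP : 0 ≤ P₀) (hr : 0 < r) (hC₁0 : 0 < C₁)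
    (hC₂0 : 0 < C₂) (hG0 : 0 ≤ G) (hE0 : 0 < E) (hC₁ : C₁ = 6 * K₀)
    (h1 : P ≤ P₀ * Real.exp (-t) + 6 * (K₀ * (1 + r ^ 2)) * r ^ 2 * G * (E * E)) :
    √P ≤ √P₀ * Real.exp (-(t / 2)) + (√C₁ + √C₂) * (r * (1 + r)) * √G * E := by
  have h2 : Real.exp (-t) = Real.exp (-(t / 2)) ^ 2 := by
    rw [sq, ← Real.exp_add]; congr 1; ring
  have h3 := Real.sq_sqrt hP
  have hGs : √G ^ 2 = G := Real.sq_sqrt hG0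
  refine Real.sqrt_le_iff.2 ⟨by positivity, h1.trans ?_⟩
  have h5 : C₁ ≤ (√C₁ + √C₂) ^ 2 := by
    have h4 : √C₁ ^ 2 = C₁ := Real.sq_sqrt hC₁0.le
    nlinarith [Real.sqrt_nonneg C₁, Real.sqrt_nonneg C₂]
  have h6 : r ^ 2 * (1 + r ^ 2) ≤ (r * (1 + r)) ^ 2 := by
    rw [mul_pow]
    gcongr
    linarith
  have h7 : 6 * (K₀ * (1 + r ^ 2)) * r ^ 2 * G * (E * E)
      ≤ ((√C₁ + √C₂) * (r * (1 + r)) * √G * E) ^ 2 := by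
    rw [mul_pow, mul_pow, mul_pow, hGs]
    calc 6 * (K₀ * (1 + r ^ 2)) * r ^ 2 * G * (E * E)
        = C₁ * (r ^ 2 * (1 + r ^ 2)) * G * E ^ 2 := by rw [hC₁]; ring
      _ ≤ _ := by gcongr
  have h8 : 0 ≤ √P₀ * Real.exp (-(t / 2)) * ((√C₁ + √C₂) * (r * (1 + r)) * √G * E) := by
    positivity
  rw [add_sq, mul_pow, h3, ← h2]
  linarith

theorem norm_elliptic_aux {c κ K₀ C₁ C₂ r G E X U θ w S₀ S : ℝ} (hr : 0 < r) (hc : 0 < c)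
    (hκ0 : 0 < κ) (hK₀ : 0 ≤ K₀) (hC₁0 : 0 < C₁) (hC₂0 : 0 < C₂) (hG0 : 0 ≤ G) (hE0 : 0 < E)
    (hC₂ : C₂ = (20 + 4 * κ * K₀ + 4 + 4 * cP ^ 2 * (4 / c + 1)) / c)
    (h3 : S₀ ≤ X ^ 2) (h2 : c * w ^ 2 ≤ S)
    (h1 : S ≤ E * E * (4 * S₀
      + (20 * r ^ 2 + 4 * (κ * (r ^ 2 * (1 + r ^ 2))) * (K₀ * (1 + r ^ 2))) * G
      + 4 * cP ^ 2 * (4 / c + 1) * (θ ^ 2 * U ^ 2)))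
    (hX0 : 0 ≤ X) (hU : 0 ≤ U) (hθ : 0 ≤ θ) :
    w ≤ (√C₁ + √C₂) * (X + r * (1 + r ^ 2) * √G + θ * U) * E := by
  refine le_of_sq_le_sq ?_ (by positivity)
  have hGs : √G ^ 2 = G := Real.sq_sqrt hG0
  have hYG : (r * (1 + r ^ 2) * √G) ^ 2 = r ^ 2 * (1 + r ^ 2) ^ 2 * G := by
    rw [mul_pow, mul_pow, hGs]
  have hY0 : 0 ≤ r * (1 + r ^ 2) * √G := by positivity
  have hZ0 : 0 ≤ θ * U := by positivity
  have e3 : θ ^ 2 * U ^ 2 = (θ * U) ^ 2 := by rw [mul_pow]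
  rw [e3] at h1
  generalize r * (1 + r ^ 2) * √G = Y at hY0 hYG ⊢
  generalize θ * U = Z at hZ0 h1 ⊢
  have h5 : C₂ ≤ (√C₁ + √C₂) ^ 2 := by
    have h4 : √C₂ ^ 2 = C₂ := Real.sq_sqrt hC₂0.le
    nlinarith [Real.sqrt_nonneg C₁, Real.sqrt_nonneg C₂]
  have h6 : r ^ 2 * G ≤ Y ^ 2 := by
    rw [hYG]
    gcongr
    exact le_mul_of_one_le_right (sq_nonneg r) (one_le_pow₀ (by linarith [sq_nonneg r]))
  have h7 : 4 * S₀ + (20 * r ^ 2 + 4 * (κ * (r ^ 2 * (1 + r ^ 2))) * (K₀ * (1 + r ^ 2))) * G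
      + 4 * cP ^ 2 * (4 / c + 1) * Z ^ 2 ≤ c * C₂ * (X ^ 2 + Y ^ 2 + Z ^ 2) := by
    have e1 : c * C₂ = 20 + 4 * κ * K₀ + 4 + 4 * cP ^ 2 * (4 / c + 1) := by
      rw [hC₂]; field_simp
    have e2 : 4 * (κ * (r ^ 2 * (1 + r ^ 2))) * (K₀ * (1 + r ^ 2)) * G = 4 * κ * K₀ * Y ^ 2 := by
      rw [hYG]; ring
    have p1 : 0 ≤ 4 * κ * K₀ := by positivity
    have p2 : 0 ≤ 4 * cP ^ 2 * (4 / c + 1) := by positivity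
    rw [e1, add_mul, e2]
    linarith [mul_nonneg p1 (sq_nonneg X), mul_nonneg p1 (sq_nonneg Z),
      mul_nonneg p2 (sq_nonneg X), mul_nonneg p2 (sq_nonneg Y), sq_nonneg X, sq_nonneg Y,
      sq_nonneg Z]
  have h8 : c * w ^ 2 ≤ c * (C₂ * (X ^ 2 + Y ^ 2 + Z ^ 2) * E ^ 2) := by
    refine h2.trans (h1.trans ?_)
    have := mul_le_mul_of_nonneg_left h7 (mul_pos hE0 hE0).le
    linarith
  refine (le_of_mul_le_mul_left h8 hc).trans ?_
  rw [mul_pow, mul_pow]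
  have h9 : X ^ 2 + Y ^ 2 + Z ^ 2 ≤ (X + Y + Z) ^ 2 := by
    linarith [mul_nonneg hX0 hY0, mul_nonneg hX0 hZ0, mul_nonneg hY0 hZ0,
      show (X + Y + Z) ^ 2 = X ^ 2 + Y ^ 2 + Z ^ 2 + 2 * (X * Y) + 2 * (X * Z) + 2 * (Y * Z) by ring]
  gcongr

/-- Decay of `D_⊥` in norm and of `D₀ - u` in `H⁻¹`; the `H⁻¹` norm of `x ⟂ e` is `‖w‖`, where
`w = A v` and `B w = x`. -/
theorem HermitePair.exists_decay [CompleteSpace H] (hp : IsAdjointPair A B) (b M : H →L[ℝ] H) (cP : ℝ) :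
    ∃ C γ : ℝ, 0 < C ∧ 0 < γ ∧ ∀ e : H, HermitePair A B b M e cP → ∀ r : ℝ, 0 < r →
      ∀ D : ℝ → lp (fun _ : ℕ => H) 2, IsWeakSol A b r D → inner ℝ (D 0 0) e = 0 →
      ∀ g : ℕ → H, (D 0 0, g 0) ∈ A → (∀ k, k ≠ 0 → (D 0 k, g k) ∈ B) →
      Summable (fun k => ‖g k‖ ^ 2) →
      (∀ t, 0 ≤ t → √(perpSq (D t)) ≤ √(perpSq (D 0)) * Real.exp (-(t / 2))
        + C * (r * (1 + r)) * √(∑' k, ‖g k‖ ^ 2 + ‖D 0‖ ^ 2)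
          * Real.exp (-(γ * (r ^ 2 / (1 + r ^ 2)) * t))) ∧
      ∀ (m : ℝ) (u : ℝ → H), IsWeakHeatSol A B m u → r ^ 2 / 2 ≤ m → inner ℝ (u 0) e = 0 →
        ∀ v₀ w₀ : H, (v₀, w₀) ∈ A → (w₀, D 0 0 - u 0) ∈ B → ∀ t, 0 ≤ t →
        ∃ v w, (v, w) ∈ A ∧ (w, D t 0 - u t) ∈ B ∧ inner ℝ v e = 0 ∧
          ‖w‖ ≤ C * (‖w₀‖ + r * (1 + r ^ 2) * √(∑' k, ‖g k‖ ^ 2 + ‖D 0‖ ^ 2)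
            + |m / r ^ 2 - 1| * ‖u 0‖) * Real.exp (-(γ * (r ^ 2 / (1 + r ^ 2)) * t)) := by
  obtain ⟨R₁, W₁, h₁⟩ := hp.exists_isResolvent one_pos
  obtain ⟨R₁', W₁', h₁'⟩ := hp.symm.exists_isResolvent one_pos
  set c := gapConst cP with hcdef
  have hc : 0 < c := gapConst_pos cP
  set Q := l2Const ‖b‖ cP + h1Const ‖M‖ + 8 with hQ
  have hl2 : 0 ≤ l2Const ‖b‖ cP := by
    unfold l2Const
    positivity
  have hh1 : 0 ≤ h1Const ‖M‖ := by
    unfold h1Const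
    positivity
  have hQ0 : 0 < Q := by positivity
  set K₀ := 8 * ‖M‖ ^ 2 + 6 with hK₀
  set κ := correctorConst ‖b‖ cP with hκ
  have hκ0 : 0 < κ := correctorConst_pos ‖b‖ cP
  set γ := 2 / 9 * c / Q with hγ
  set C₁ := 6 * K₀ with hC₁
  set C₂ := (20 + 4 * κ * K₀ + 4 + 4 * cP ^ 2 * (4 / c + 1)) / c with hC₂
  have hC₁0 : 0 < C₁ := by positivity
  have hC₂0 : 0 < C₂ := by positivity
  -- The constants are fixed before `e` and `r`; in the application they see neither the mass nor
  -- `ε` and `τ`.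
  refine ⟨√C₁ + √C₂, γ, by positivity, by positivity, ?_⟩
  intro e h r hr D hD hDe0 g h0 hk hg
  have hDe : ∀ t, 0 ≤ t → inner ℝ (D t 0) e = 0 := fun t ht => (hD.inner_kernel h ht).trans hDe0
  -- One choice meets all smallness conditions for every `r` and gives the uniform rate `r² / (1 +
  -- r²)` up to a constant.
  set α := 1 / (Q * (1 + r ^ 2)) with hα
  have hα0 : 0 < α := by positivity
  have hαQ : α * (Q * (1 + r ^ 2)) = 1 := by
    rw [hα]; field_simp
  have hr1 : 0 < 1 + r ^ 2 := by positivity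
  have hαr : α * (l2Const ‖b‖ cP * (1 + r ^ 2)) ≤ 1 := by
    refine le_trans ?_ hαQ.le
    gcongr
    linarith
  have hαr' : α * (h1Const ‖M‖ * (1 + r ^ 2)) ≤ 1 := by
    refine le_trans ?_ hαQ.le
    gcongr
    linarith
  have hα8 : α ≤ 1 / 8 := by
    rw [hα]
    refine one_div_le_one_div_of_le (by norm_num) ?_
    nlinarith [sq_nonneg r]
  have hK : 8 * ‖M‖ ^ 2 * r ^ 2 + 4 * α + 2 ≤ K₀ * (1 + r ^ 2) := by
    rw [hK₀]
    nlinarith [sq_nonneg r, sq_nonneg ‖M‖, mul_nonneg (sq_nonneg r) (sq_nonneg ‖M‖)]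
  -- The estimates so far concern squares; the exponent is split into two equal halves, of which one
  -- remains after the square root.
  have hrate : ∀ t, 4 / 9 * gapConst cP * (α * r ^ 2) * t
      = γ * (r ^ 2 / (1 + r ^ 2)) * t + γ * (r ^ 2 / (1 + r ^ 2)) * t := fun t => by
    rw [hα, hγ, ← hcdef]
    field_simp
    ring
  set G := ∑' k, ‖g k‖ ^ 2 + ‖D 0‖ ^ 2 with hG
  have hG0 : 0 ≤ G := by positivity
  have hGs : √G ^ 2 = G := Real.sq_sqrt hG0
  constructor
  · intro t ht
    have h1 := hD.perpSq_le h h₁ h₁' hr hDe hα0 hαr hαr' hK h0 hk hg ht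
    rw [hrate, neg_add, Real.exp_add, ← hG] at h1
    set E := Real.exp (-(γ * (r ^ 2 / (1 + r ^ 2)) * t)) with hE
    have hE0 : 0 < E := Real.exp_pos _
    exact sqrt_perp_aux (perpSq_nonneg _) hr hC₁0 hC₂0 hG0 hE0 hC₁ h1
  · intro m' u hu hm hue0 v₀ w₀ hv₀ hw₀ t ht
    have hue : ∀ t, 0 ≤ t → inner ℝ (u t) e = 0 := fun t ht => (hu.inner_kernel h ht).trans hue0
    obtain ⟨v, w, hv, hw, hve⟩ := h.exists_elliptic (x := D t 0 - u t)
      (by rw [inner_sub_left, hDe t ht, hue t ht, sub_zero])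
    refine ⟨v, w, hv, hw, hve, ?_⟩
    have h1 := hD.inner_resolvent_sub_le h h₁ h₁' hr hDe hα0 hαr hαr' hα8 hK h0 hk hg hu hm hue ht
    have h2 := h.norm_elliptic_le h₁ hv hw hve
    have h3 := h.inner_resolvent_le_norm_elliptic h₁ hw₀
    rw [hrate, neg_add, Real.exp_add, ← hG, ← hκ, ← hcdef, ← sq_abs (m' / r ^ 2 - 1)] at h1
    rw [← hcdef] at h2
    set E := Real.exp (-(γ * (r ^ 2 / (1 + r ^ 2)) * t)) with hE
    have hE0 : 0 < E := Real.exp_pos _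
    exact norm_elliptic_aux hr hc hκ0 (by positivity) hC₁0 hC₂0 hG0 hE0 hC₂ h3 h2 h1
      (norm_nonneg _) (norm_nonneg _) (abs_nonneg _)

end Elliptic

end VFP

namespace VFP

/-! ### Test functions and Fourier coefficients on the torus -/

section Torus

variable {L : ℝ} {φ ψ u v g h f : AddCircle L → ℝ}

theorem torusDeriv_coe (φ : AddCircle L → ℝ) (y : ℝ) :
    torusDeriv φ y = deriv (fun z : ℝ => φ (z : AddCircle L)) y := by
  have := deriv_comp_const_add (fun z : ℝ => φ (z : AddCircle L)) y 0
  simp only [add_zero, AddCircle.coe_add] at this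
  exact this

theorem IsTest.hasDerivAt (hφ : IsTest φ) (y : ℝ) :
    HasDerivAt (fun z : ℝ => φ (z : AddCircle L)) (torusDeriv φ y) y := by
  rw [torusDeriv_coe]
  exact (hφ.differentiable (by simp) y).hasDerivAt

theorem torusDeriv_of_hasDerivAt {φ' : AddCircle L → ℝ}
    (h : ∀ y : ℝ, HasDerivAt (fun z : ℝ => φ (z : AddCircle L)) (φ' y) y) : torusDeriv φ = φ' := by
  funext x
  induction x using QuotientAddGroup.induction_on with
  | H y => exact (torusDeriv_coe φ y).trans (h y).deriv

theorem IsTest.isTest_torusDeriv (hφ : IsTest φ) : IsTest (torusDeriv φ) := by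
  have h1 := (contDiff_infty_iff_deriv (𝕜 := ℝ)).1 hφ
  have h2 : (fun y : ℝ => torusDeriv φ y) = deriv (fun z : ℝ => φ (z : AddCircle L)) :=
    funext (torusDeriv_coe φ)
  rw [IsTest, h2]
  exact h1.2

theorem IsTest.mul (hφ : IsTest φ) (hψ : IsTest ψ) : IsTest (fun x => φ x * ψ x) :=
  ContDiff.mul hφ hψ

theorem IsTest.torusDeriv_mul (hφ : IsTest φ) (hψ : IsTest ψ) :
    torusDeriv (fun x => φ x * ψ x)
      = fun x => torusDeriv φ x * ψ x + φ x * torusDeriv ψ x :=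
  torusDeriv_of_hasDerivAt fun y => (hφ.hasDerivAt y).mul (hψ.hasDerivAt y)

theorem IsTest.continuous (hφ : IsTest φ) : Continuous φ :=
  (QuotientAddGroup.isQuotientMap_mk (AddSubgroup.zmultiples L)).continuous_iff.2 (ContDiff.continuous hφ)

theorem contDiff_fourier (n : ℤ) :
    ContDiff ℝ ((⊤ : ℕ∞) : WithTop ℕ∞) (fun y : ℝ => fourier n (y : AddCircle L)) := by
  simp_rw [fourier_coe_apply]
  exact ContDiff.cexp (contDiff_const.mul Complex.ofRealCLM.contDiff |>.div_const _)

theorem isTest_re_fourier (n : ℤ) : IsTest (fun x : AddCircle L => (fourier n x).re) :=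
  Complex.reCLM.contDiff.comp (contDiff_fourier n)

theorem isTest_im_fourier (n : ℤ) : IsTest (fun x : AddCircle L => (fourier n x).im) :=
  Complex.imCLM.contDiff.comp (contDiff_fourier n)

theorem torusDeriv_re_fourier (n : ℤ) : torusDeriv (fun x : AddCircle L => (fourier n x).re)
    = fun x => -(2 * Real.pi * n / L) * (fourier n x).im :=
  torusDeriv_of_hasDerivAt fun y => by
    have h1 := Complex.reCLM.hasFDerivAt.comp_hasDerivAt y (hasDerivAt_fourier L n y)
    refine h1.congr_deriv ?_
    have : (2 * Real.pi * Complex.I * n / L : ℂ) = ((2 * Real.pi * n / L : ℝ) : ℂ) * Complex.I := by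
      push_cast; ring
    rw [Complex.reCLM_apply, this]
    simp [Complex.mul_re]

theorem torusDeriv_im_fourier (n : ℤ) : torusDeriv (fun x : AddCircle L => (fourier n x).im)
    = fun x => 2 * Real.pi * n / L * (fourier n x).re :=
  torusDeriv_of_hasDerivAt fun y => by
    have h1 := Complex.imCLM.hasFDerivAt.comp_hasDerivAt y (hasDerivAt_fourier L n y)
    refine h1.congr_deriv ?_
    have : (2 * Real.pi * Complex.I * n / L : ℂ) = ((2 * Real.pi * n / L : ℝ) : ℂ) * Complex.I := by
      push_cast; ring
    rw [Complex.imCLM_apply, this]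
    simp [Complex.mul_im]

variable [hL : Fact (0 < L)]

theorem IsTest.memLp (hφ : IsTest φ) (p : ℝ≥0∞) : MemLp φ p (volume : Measure (AddCircle L)) :=
  hφ.continuous.memLp_of_hasCompactSupport (HasCompactSupport.of_compactSpace φ)

theorem IsTest.integral_torusDeriv (hφ : IsTest φ) : ∫ x : AddCircle L, torusDeriv φ x = 0 := by
  rw [← AddCircle.intervalIntegral_preimage L 0, zero_add]
  have := intervalIntegral.integral_eq_sub_of_hasDerivAt (a := 0) (b := L)
    (fun y _ => hφ.hasDerivAt y)
    (ContDiff.continuous (show IsTest (torusDeriv φ) from hφ.isTest_torusDeriv) |>.intervalIntegrable _ _)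
  rw [this, AddCircle.coe_period]
  exact sub_self _

/-- `g` is the weak derivative of the function `u` on the torus. -/
def HasWeakDeriv (u g : AddCircle L → ℝ) : Prop :=
  ∀ φ : AddCircle L → ℝ, IsTest φ → ∫ x, u x * torusDeriv φ x = - ∫ x, g x * φ x

theorem IsTest.hasWeakDeriv (hφ : IsTest φ) : HasWeakDeriv φ (torusDeriv φ) := by
  intro ψ hψ
  have h1 := (hφ.mul hψ).integral_torusDeriv
  rw [hφ.torusDeriv_mul hψ, integral_add] at h1
  · linarith
  · exact ((hφ.isTest_torusDeriv.memLp 2).integrable_mul (hψ.memLp 2))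
  · exact ((hφ.memLp 2).integrable_mul (hψ.isTest_torusDeriv.memLp 2))

theorem HasWeakDeriv.mul_isTest (hu : HasWeakDeriv u g)
    (hu2 : Integrable u) (hg2 : Integrable g) (hφ : IsTest φ) :
    HasWeakDeriv (fun x => u x * φ x) (fun x => g x * φ x + u x * torusDeriv φ x) := by
  have key : ∀ {w χ : AddCircle L → ℝ}, Integrable w → IsTest χ →
      Integrable (fun x => w x * χ x) := fun hw hχ =>
    hw.mul_of_top_left (hχ.memLp ⊤)
  intro ψ hψ
  have h1 := hu _ (hφ.mul hψ)
  rw [hφ.torusDeriv_mul hψ] at h1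
  simp only [mul_add, add_mul] at h1 ⊢
  simp only [← mul_assoc] at h1
  have i1 : Integrable fun x => u x * torusDeriv φ x * ψ x :=
    key (key hu2 hφ.isTest_torusDeriv) hψ
  have i2 : Integrable fun x => u x * φ x * torusDeriv ψ x :=
    key (key hu2 hφ) hψ.isTest_torusDeriv
  have i3 : Integrable fun x => g x * φ x * ψ x := key (key hg2 hφ) hψ
  rw [integral_add i1 i2] at h1
  rw [integral_add i3 i1]
  linarith

theorem HasWeakDeriv.congr {u' g' : AddCircle L → ℝ} (hu : HasWeakDeriv u g)
    (h1 : u =ᵐ[volume] u') (h2 : g =ᵐ[volume] g') : HasWeakDeriv u' g' := by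
  intro φ hφ
  refine ((integral_congr_ae ?_).trans (hu φ hφ)).trans (congrArg _ (integral_congr_ae ?_))
  · filter_upwards [h1] with x hx
    rw [hx]
  · filter_upwards [h2] with x hx
    rw [hx]

/-! ### Fourier coefficients -/

/-- The Fourier coefficients of a real function. -/
noncomputable def coeff (f : AddCircle L → ℝ) (n : ℤ) : ℂ := fourierCoeff (fun x => (f x : ℂ)) n

/-- Parseval in polarised form; `L⁻¹` converts Lebesgue measure to the normalised Haar measure of
the Fourier basis. -/
theorem hasSum_coeff (hf : MemLp f 2 (volume : Measure (AddCircle L)))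
    (hg : MemLp g 2 (volume : Measure (AddCircle L))) :
    HasSum (fun n => starRingEnd ℂ (coeff f n) * coeff g n)
      ((L⁻¹ * ∫ x, f x * g x : ℝ) : ℂ) := by
  have hf' := (hf.ofReal (K := ℂ)).haarAddCircle
  have hg' := (hg.ofReal (K := ℂ)).haarAddCircle
  have h1 := (fourierBasis (T := L)).hasSum_inner_mul_inner (hf'.toLp _) (hg'.toLp _)
  have h3 : (fun n => starRingEnd ℂ (coeff f n) * coeff g n) = fun n =>
      inner ℂ (hf'.toLp _) (fourierBasis n) * inner ℂ (fourierBasis n) (hg'.toLp _) := by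
    funext n
    rw [← fourierBasis.repr_apply_apply, ← inner_conj_symm, ← fourierBasis.repr_apply_apply,
      fourierBasis_repr, fourierBasis_repr, fourierCoeff_congr_ae hf'.coeFn_toLp,
      fourierCoeff_congr_ae hg'.coeFn_toLp]
    rfl
  have h4 : ((L⁻¹ * ∫ x, f x * g x : ℝ) : ℂ) = inner ℂ (hf'.toLp _) (hg'.toLp _) := by
    rw [L2.inner_def, ← smul_eq_mul (L⁻¹), ← AddCircle.integral_haarAddCircle, ← integral_complex_ofReal]
    refine integral_congr_ae ?_
    filter_upwards [hf'.coeFn_toLp, hg'.coeFn_toLp] with x h3 h4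
    rw [h3, h4]
    simp [mul_comm]
  rw [h3, h4]
  exact h1

theorem coeff_eq (hf : Integrable f) (n : ℤ) :
    coeff f n = (L : ℂ)⁻¹ * (((∫ x, f x * (fourier (-n) x).re : ℝ) : ℂ)
      + ((∫ x, f x * (fourier (-n) x).im : ℝ) : ℂ) * Complex.I) := by
  have hi1 : Integrable fun x => f x * (fourier (-n) x).re :=
    hf.mul_of_top_left ((isTest_re_fourier (-n)).memLp ⊤)
  have hi2 : Integrable fun x => f x * (fourier (-n) x).im :=
    hf.mul_of_top_left ((isTest_im_fourier (-n)).memLp ⊤)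
  rw [coeff, fourierCoeff, AddCircle.integral_haarAddCircle, ← integral_complex_ofReal,
    ← integral_complex_ofReal, ← integral_mul_const, ← integral_add hi1.ofReal (hi2.ofReal.mul_const _)]
  rw [Complex.real_smul, Complex.ofReal_inv]
  congr 2
  funext x
  rw [smul_eq_mul]
  push_cast
  rw [mul_assoc, ← mul_add, Complex.re_add_im, mul_comm]

/-- Real and imaginary parts of the Fourier modes are admissible test functions. With Parseval this
yields uniqueness of weak derivatives, integration by parts and Wirtinger's inequality. -/
theorem HasWeakDeriv.coeff (hu : HasWeakDeriv u g) (hui : Integrable u) (hgi : Integrable g)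
    (n : ℤ) : coeff g n = (2 * Real.pi * n / L : ℝ) * Complex.I * VFP.coeff u n := by
  have h1 := hu _ (isTest_re_fourier (-n))
  have h2 := hu _ (isTest_im_fourier (-n))
  rw [torusDeriv_re_fourier] at h1
  rw [torusDeriv_im_fourier] at h2
  simp only [mul_left_comm (u _), integral_const_mul] at h1 h2
  rw [coeff_eq hui, coeff_eq hgi, ← neg_eq_iff_eq_neg.2 h1, ← neg_eq_iff_eq_neg.2 h2]
  push_cast
  linear_combination -(L : ℂ)⁻¹ * ((2 * Real.pi * n / L)
    * ((∫ x, u x * (fourier (-n) x).im : ℝ) : ℂ)) * Complex.I_sq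

end Torus

end VFP

namespace VFP

/-! ### Calculus of weak derivatives -/

section WeakDerivative

variable {L : ℝ} [hL : Fact (0 < L)] {φ ψ u v g h f : AddCircle L → ℝ}

theorem _root_.MeasureTheory.MemLp.two_of_top
    (hf : MemLp f ⊤ (volume : Measure (AddCircle L))) : MemLp f 2 (volume : Measure (AddCircle L)) :=
  hf.mono_exponent le_top

theorem coeff_sub (hf : Integrable f) (hg : Integrable g) (n : ℤ) :
    coeff (fun x => f x - g x) n = coeff f n - coeff g n := by
  have key : ∀ {w χ : AddCircle L → ℝ}, Integrable w → IsTest χ →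
      Integrable (fun x => w x * χ x) := fun hw hχ => hw.mul_of_top_left (hχ.memLp ⊤)
  rw [coeff_eq hf, coeff_eq hg, coeff_eq (f := fun x => f x - g x) (hf.sub hg)]
  simp only [sub_mul]
  rw [integral_sub (key hf (isTest_re_fourier _)) (key hg (isTest_re_fourier _)),
    integral_sub (key hf (isTest_im_fourier _)) (key hg (isTest_im_fourier _))]
  push_cast
  ring

theorem ae_eq_zero_of_coeff (hf : MemLp f 2 (volume : Measure (AddCircle L)))
    (h : ∀ n, coeff f n = 0) : f =ᵐ[volume] 0 := by
  have h1 := hasSum_coeff hf hf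
  simp only [h, mul_zero] at h1
  have h2 := h1.unique hasSum_zero
  have h3 : ∫ x, f x * f x = 0 := by
    have := Complex.ofReal_eq_zero.1 h2
    simpa [hL.out.ne'] using this
  have h4 := (integral_eq_zero_iff_of_nonneg (fun x => mul_self_nonneg (f x))
    (hf.integrable_mul hf)).1 h3
  filter_upwards [h4] with x hx
  simpa using hx

theorem HasWeakDeriv.unique {g' : AddCircle L → ℝ} (hu : HasWeakDeriv u g)
    (hu' : HasWeakDeriv u g') (hu2 : MemLp u 2 (volume : Measure (AddCircle L)))
    (hg : MemLp g 2 (volume : Measure (AddCircle L)))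
    (hg' : MemLp g' 2 (volume : Measure (AddCircle L))) : g =ᵐ[volume] g' := by
  have h1 := ae_eq_zero_of_coeff (hg.sub hg') fun n => by
    have := coeff_sub (hg.integrable one_le_two) (hg'.integrable one_le_two) n
    rw [hu.coeff (hu2.integrable one_le_two) (hg.integrable one_le_two),
      hu'.coeff (hu2.integrable one_le_two) (hg'.integrable one_le_two), sub_self] at this
    exact this
  filter_upwards [h1] with x hx
  simpa [sub_eq_zero] using hx

/-- Integration by parts in `H¹(𝕋)`. -/
theorem HasWeakDeriv.integral_mul (hu : HasWeakDeriv u g) (hv : HasWeakDeriv v h)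
    (hu2 : MemLp u 2 (volume : Measure (AddCircle L)))
    (hg2 : MemLp g 2 (volume : Measure (AddCircle L)))
    (hv2 : MemLp v 2 (volume : Measure (AddCircle L)))
    (hh2 : MemLp h 2 (volume : Measure (AddCircle L))) :
    ∫ x, u x * h x = -∫ x, g x * v x := by
  have h1 := hasSum_coeff hu2 hh2
  have h2 := (hasSum_coeff hg2 hv2).neg
  have h3 : (fun n => starRingEnd ℂ (VFP.coeff u n) * VFP.coeff h n)
      = fun n => -(starRingEnd ℂ (VFP.coeff g n) * VFP.coeff v n) := by
    funext n
    rw [hu.coeff (hu2.integrable one_le_two) (hg2.integrable one_le_two),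
      hv.coeff (hv2.integrable one_le_two) (hh2.integrable one_le_two), map_mul, map_mul,
      Complex.conj_I, Complex.conj_ofReal]
    ring
  rw [h3] at h1
  have h4 := h1.unique h2
  rw [← Complex.ofReal_neg, Complex.ofReal_inj, ← mul_neg] at h4
  exact mul_left_cancel₀ (inv_ne_zero hL.out.ne') h4

/-- Wirtinger's inequality. -/
theorem HasWeakDeriv.integral_sq_le (hu : HasWeakDeriv u g)
    (hu2 : MemLp u 2 (volume : Measure (AddCircle L)))
    (hg2 : MemLp g 2 (volume : Measure (AddCircle L))) (hmean : ∫ x, u x = 0) :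
    ∫ x, u x * u x ≤ (L / (2 * Real.pi)) ^ 2 * ∫ x, g x * g x := by
  have h1 := Complex.hasSum_re (hasSum_coeff hu2 hu2)
  have h2 := (Complex.hasSum_re (hasSum_coeff hg2 hg2)).mul_left ((L / (2 * Real.pi)) ^ 2)
  have hL0 := hL.out
  have h3 : ∀ n : ℤ, (starRingEnd ℂ (VFP.coeff u n) * VFP.coeff u n).re
      ≤ (L / (2 * Real.pi)) ^ 2 * (starRingEnd ℂ (VFP.coeff g n) * VFP.coeff g n).re := by
    intro n
    have e1 : ∀ z : ℂ, (starRingEnd ℂ z * z).re = ‖z‖ ^ 2 := fun z => by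
      rw [Complex.conj_mul']; norm_cast
    rw [e1, e1]
    rcases eq_or_ne n 0 with rfl | hn
    · have : VFP.coeff u 0 = 0 := by
        rw [coeff_eq (hu2.integrable one_le_two)]
        simp [hmean]
      rw [this]
      rw [norm_zero, zero_pow two_ne_zero]
      positivity
    · rw [hu.coeff (hu2.integrable one_le_two) (hg2.integrable one_le_two), norm_mul, norm_mul,
        Complex.norm_I, mul_one, Complex.norm_real, Real.norm_eq_abs, mul_pow, sq_abs, ← mul_assoc,
        ← mul_pow]
      refine le_mul_of_one_le_left (sq_nonneg _) ?_
      have : L / (2 * Real.pi) * (2 * Real.pi * n / L) = n := by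
        have := Real.pi_pos
        field_simp
      rw [this]
      have : (1 : ℝ) ≤ ((n ^ 2 : ℤ) : ℝ) := by
        exact_mod_cast Int.one_le_abs hn |>.trans (by
          rw [← sq_abs]; exact le_self_pow₀ (Int.one_le_abs hn) two_ne_zero)
      simpa using this
  have h4 := hasSum_le h3 h1 h2
  simp only [Complex.ofReal_re] at h4
  rw [mul_left_comm] at h4
  exact le_of_mul_le_mul_left h4 (inv_pos.2 hL0)

/-- Attach the test function to `u` and integrate `b` by parts against `u ψ`, which is again in
`H¹`. -/
theorem HasWeakDeriv.mul {b b' : AddCircle L → ℝ} (hb : HasWeakDeriv b b') (hu : HasWeakDeriv u g)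
    (hb2 : MemLp b ⊤ (volume : Measure (AddCircle L)))
    (hb2' : MemLp b' ⊤ (volume : Measure (AddCircle L)))
    (hu2 : MemLp u 2 (volume : Measure (AddCircle L)))
    (hg2 : MemLp g 2 (volume : Measure (AddCircle L))) :
    HasWeakDeriv (fun x => b x * u x) (fun x => b' x * u x + b x * g x) := by
  intro ψ hψ
  have ht := hψ.memLp ⊤
  have ht' := hψ.isTest_torusDeriv.memLp ⊤
  have m1 : MemLp (fun x => g x * ψ x) 2 (volume : Measure (AddCircle L)) := ht.mul hg2
  have m2 : MemLp (fun x => u x * torusDeriv ψ x) 2 (volume : Measure (AddCircle L)) := ht'.mul hu2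
  have m3 : MemLp (fun x => u x * ψ x) 2 (volume : Measure (AddCircle L)) := ht.mul hu2
  have h1 := hb.integral_mul (hu.mul_isTest (hu2.integrable one_le_two)
    (hg2.integrable one_le_two) hψ) hb2.two_of_top hb2'.two_of_top m3 (m1.add m2)
  simp only [mul_add, add_mul, mul_assoc] at h1 ⊢
  have i1 : Integrable fun x => b x * (g x * ψ x) := hb2.two_of_top.integrable_mul m1
  have i2 : Integrable fun x => b x * (u x * torusDeriv ψ x) := hb2.two_of_top.integrable_mul m2
  have i3 : Integrable fun x => b' x * (u x * ψ x) := hb2'.two_of_top.integrable_mul m3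
  rw [integral_add i1 i2] at h1
  rw [integral_add i3 i1]
  linarith

theorem HasWeakDeriv.add (hu : HasWeakDeriv u g) (hv : HasWeakDeriv v h) (hui : Integrable u)
    (hgi : Integrable g) (hvi : Integrable v) (hhi : Integrable h) :
    HasWeakDeriv (fun x => u x + v x) (fun x => g x + h x) := by
  have key : ∀ {w χ : AddCircle L → ℝ}, Integrable w → IsTest χ →
      Integrable (fun x => w x * χ x) := fun hw hχ => hw.mul_of_top_left (hχ.memLp ⊤)
  intro ψ hψ
  have ht' := hψ.isTest_torusDeriv
  simp only [add_mul]
  rw [integral_add (key hui ht') (key hvi ht'), integral_add (key hgi hψ) (key hhi hψ), hu ψ hψ,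
    hv ψ hψ]
  ring

theorem HasWeakDeriv.const_mul (hu : HasWeakDeriv u g) (c : ℝ) :
    HasWeakDeriv (fun x => c * u x) (fun x => c * g x) := by
  intro ψ hψ
  simp only [mul_assoc]
  rw [integral_const_mul, integral_const_mul, hu ψ hψ, mul_neg]

theorem hasWeakDeriv_const (c : ℝ) :
    HasWeakDeriv (fun _ : AddCircle L => c) (fun _ => 0) := by
  intro ψ hψ
  rw [integral_const_mul, hψ.integral_torusDeriv]
  simp

theorem HasWeakDeriv.pow_div_factorial {Ψ Ψ' : AddCircle L → ℝ} (hΨ : HasWeakDeriv Ψ Ψ')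
    (hb : MemLp Ψ ⊤ (volume : Measure (AddCircle L)))
    (hb' : MemLp Ψ' ⊤ (volume : Measure (AddCircle L))) (n : ℕ) :
    MemLp (fun x => Ψ x ^ n / n.factorial) ⊤ (volume : Measure (AddCircle L)) ∧
    HasWeakDeriv (fun x => Ψ x ^ (n + 1) / (n + 1).factorial)
      (fun x => Ψ' x * (Ψ x ^ n / n.factorial)) := by
  induction n with
  | zero =>
    refine ⟨by simpa using memLp_const 1, by simpa using hΨ⟩
  | succ n ih =>
    have hm : MemLp (fun x => Ψ x ^ (n + 1) / (n + 1).factorial) ⊤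
        (volume : Measure (AddCircle L)) := by
      have : MemLp (fun x => Ψ x * (Ψ x ^ n / n.factorial)) ⊤ (volume : Measure (AddCircle L)) :=
        ih.1.mul hb
      refine (this.const_mul ((n : ℝ) + 1)⁻¹).ae_eq (Eventually.of_forall fun x => ?_)
      simp only [Nat.factorial_succ]
      push_cast
      field_simp
      ring
    refine ⟨hm, ?_⟩
    have h1 := (hΨ.mul ih.2 hb hb' hm.two_of_top (ih.1.mul hb').two_of_top).const_mul
      ((n : ℝ) + 2)⁻¹
    refine h1.congr (Eventually.of_forall fun x => ?_) (Eventually.of_forall fun x => ?_)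
    · simp only [Nat.factorial_succ]
      push_cast
      field_simp
      ring
    · simp only [Nat.factorial_succ]
      push_cast
      field_simp
      ring

theorem HasWeakDeriv.of_tendsto {un gn : ℕ → AddCircle L → ℝ} (h : ∀ n, HasWeakDeriv (un n) (gn n))
    {C : ℝ} (hun : ∀ n, AEStronglyMeasurable (un n) volume)
    (hgn : ∀ n, AEStronglyMeasurable (gn n) volume)
    (hub : ∀ n, ∀ᵐ x, ‖un n x‖ ≤ C) (hgb : ∀ n, ∀ᵐ x, ‖gn n x‖ ≤ C)
    (hu : ∀ᵐ x, Tendsto (fun n => un n x) atTop (𝓝 (u x)))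
    (hg : ∀ᵐ x, Tendsto (fun n => gn n x) atTop (𝓝 (g x))) : HasWeakDeriv u g := by
  have key : ∀ {wn : ℕ → AddCircle L → ℝ} {w χ : AddCircle L → ℝ}, IsTest χ →
      (∀ n, AEStronglyMeasurable (wn n) volume) → (∀ n, ∀ᵐ x, ‖wn n x‖ ≤ C) →
      (∀ᵐ x, Tendsto (fun n => wn n x) atTop (𝓝 (w x))) →
      Tendsto (fun n => ∫ x, wn n x * χ x) atTop (𝓝 (∫ x, w x * χ x)) := by
    intro wn w χ hχ hm hb hw
    refine tendsto_integral_of_dominated_convergence (fun x => C * ‖χ x‖)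
      (fun n => (hm n).mul (hχ.memLp 1).1) (((hχ.memLp 1).integrable le_rfl).norm.const_mul C)
      (fun n => ?_) ?_
    · filter_upwards [hb n] with x hx
      rw [norm_mul]
      gcongr
    · filter_upwards [hw] with x hx
      exact hx.mul_const _
  intro ψ hψ
  refine tendsto_nhds_unique (key hψ.isTest_torusDeriv hun hub hu) ?_
  simp_rw [fun n => h n ψ hψ]
  exact (key hψ hgn hgb hg).neg

/-- Each partial sum of the exponential series of `Ψ` has as weak derivative `Ψ'` times the
preceding partial sum. Boundedness of `Ψ` and `Ψ'` gives a uniform bound, and dominated convergence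
passes to the limit. -/
theorem HasWeakDeriv.exp {Ψ Ψ' : AddCircle L → ℝ} (hΨ : HasWeakDeriv Ψ Ψ')
    (hb : MemLp Ψ ⊤ (volume : Measure (AddCircle L)))
    (hb' : MemLp Ψ' ⊤ (volume : Measure (AddCircle L))) {K K' : ℝ}
    (hK : ∀ᵐ x, ‖Ψ x‖ ≤ K) (hK' : ∀ᵐ x, ‖Ψ' x‖ ≤ K') :
    HasWeakDeriv (fun x => Real.exp (Ψ x)) (fun x => Ψ' x * Real.exp (Ψ x)) := by
  have hp := hΨ.pow_div_factorial hb hb'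
  have hS : ∀ n, MemLp (fun x => ∑ i ∈ Finset.range n, Ψ x ^ i / i.factorial) ⊤
      (volume : Measure (AddCircle L)) := fun n => memLp_finsetSum _ fun i _ => (hp i).1
  have hw : ∀ n, HasWeakDeriv (fun x => ∑ i ∈ Finset.range (n + 1), Ψ x ^ i / i.factorial)
      (fun x => Ψ' x * ∑ i ∈ Finset.range n, Ψ x ^ i / i.factorial) := by
    intro n
    induction n with
    | zero => simpa using hasWeakDeriv_const 1
    | succ n ih =>
      have i1 : ∀ {w : AddCircle L → ℝ}, MemLp w ⊤ (volume : Measure (AddCircle L)) →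
        Integrable w := fun hw => hw.integrable le_top
      have := ih.add (hp n).2 (i1 (hS _)) (i1 ((hS n).mul hb')) (i1 (hp (n + 1)).1)
        (i1 ((hp n).1.mul hb'))
      simpa only [← mul_add, ← Finset.sum_range_succ] using this
  have hlim : ∀ y : ℝ, Tendsto (fun n => ∑ i ∈ Finset.range n, y ^ i / i.factorial) atTop
      (𝓝 (Real.exp y)) := fun y => by
    have := (NormedSpace.expSeries_div_hasSum_exp (𝔸 := ℝ) y).tendsto_sum_nat
    rwa [← Real.exp_eq_exp_ℝ] at this
  have hbound : ∀ y : ℝ, ‖y‖ ≤ K → ∀ n,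
      ‖∑ i ∈ Finset.range n, y ^ i / (i.factorial : ℝ)‖ ≤ Real.exp K := fun y hy n => by
    refine (norm_sum_le _ _).trans (le_trans ?_ (Real.sum_le_exp_of_nonneg
      ((norm_nonneg y).trans hy) n))
    gcongr with i _
    rw [norm_div, norm_pow, Real.norm_natCast]
    gcongr
  refine HasWeakDeriv.of_tendsto (C := (1 + K') * Real.exp K) hw (fun n => (hS _).1)
    (fun n => hb'.1.mul (hS n).1) (fun n => ?_) (fun n => ?_) (Eventually.of_forall fun x => ?_)
    (Eventually.of_forall fun x => ?_)
  · filter_upwards [hK, hK'] with x hx hx'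
    refine (hbound _ hx _).trans ?_
    refine le_mul_of_one_le_left (Real.exp_pos K).le ?_
    linarith [(norm_nonneg _).trans hx']
  · filter_upwards [hK, hK'] with x hx hx'
    rw [norm_mul]
    gcongr
    · linarith [(norm_nonneg _).trans hx']
    · linarith
    · exact hbound _ hx _
  · exact (hlim (Ψ x)).comp (tendsto_add_atTop_nat 1)
  · exact (hlim (Ψ x)).const_mul _

end WeakDerivative

end VFP

namespace VFP

/-! ### First order operators `c ∂ₓ + a` as adjoint pairs -/

section Operators

variable {L : ℝ} [hL : Fact (0 < L)]

theorem inner_eq_integral (u v : LpT L 2) : inner ℝ u v = ∫ x, u x * v x := by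
  rw [L2.inner_def]
  refine integral_congr_ae (Eventually.of_forall fun x => ?_)
  simp [mul_comm]

theorem ae_norm_le (f : LpT L ⊤) : ∀ᵐ x, ‖f x‖ ≤ ‖f‖ := by
  have h := ae_le_eLpNormEssSup (f := fun x => f x) (μ := (volume : Measure (AddCircle L)))
  have hfin : eLpNormEssSup (fun x => f x) (volume : Measure (AddCircle L)) ≠ ⊤ := by
    have := Lp.eLpNorm_ne_top f
    rwa [eLpNorm_exponent_top] at this
  filter_upwards [h] with x hx
  rw [Lp.norm_def, eLpNorm_exponent_top]
  simpa using ENNReal.toReal_mono hfin hx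

/-- Multiplication by a bounded function. -/
noncomputable def mulCLM (f : LpT L ⊤) : LpT L 2 →L[ℝ] LpT L 2 :=
  LinearMap.mkContinuous
    { toFun := fun u => (f • u : LpT L 2)
      map_add' := fun u v => Lp.add_smul f u v
      map_smul' := fun c u => (Lp.smul_comm c f u).symm } ‖f‖ fun u => Lp.norm_smul_le f u

theorem mulCLM_apply (f : LpT L ⊤) (u : LpT L 2) : mulCLM f u = (f • u : LpT L 2) := rfl

theorem coeFn_mulCLM (f : LpT L ⊤) (u : LpT L 2) : mulCLM f u =ᵐ[volume] fun x => f x * u x :=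
  Lp.coeFn_lpSMul f u

theorem inner_mulCLM (f : LpT L ⊤) (u v : LpT L 2) :
    inner ℝ (mulCLM f u) v = ∫ x, f x * u x * v x := by
  rw [inner_eq_integral]
  refine integral_congr_ae ?_
  filter_upwards [coeFn_mulCLM f u] with x hx
  rw [hx]

theorem inner_mulCLM_right (f : LpT L ⊤) (u v : LpT L 2) :
    inner ℝ u (mulCLM f v) = inner ℝ (mulCLM f u) v := by
  rw [real_inner_comm, inner_mulCLM, inner_mulCLM]
  refine integral_congr_ae (Eventually.of_forall fun x => ?_)
  ring

variable {u v g h : LpT L 2}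

theorem IsWeakDeriv.add (hu : IsWeakDeriv u g) (hv : IsWeakDeriv v h) :
    IsWeakDeriv (u + v) (g + h) :=
  (HasWeakDeriv.add hu hv ((Lp.memLp u).integrable one_le_two) ((Lp.memLp g).integrable one_le_two)
    ((Lp.memLp v).integrable one_le_two) ((Lp.memLp h).integrable one_le_two)).congr
    (Lp.coeFn_add u v).symm (Lp.coeFn_add g h).symm

theorem IsWeakDeriv.const_smul {p : ℝ≥0∞} {u g : LpT L p} (hu : IsWeakDeriv u g) (c : ℝ) :
    IsWeakDeriv (c • u) (c • g) :=
  (HasWeakDeriv.const_mul hu c).congr (Lp.coeFn_smul c u).symm (Lp.coeFn_smul c g).symm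

theorem isWeakDeriv_zero : IsWeakDeriv (0 : LpT L 2) 0 := by
  have := (hasWeakDeriv_const (L := L) 0)
  exact this.congr (Lp.coeFn_zero ℝ 2 _).symm (Lp.coeFn_zero ℝ 2 _).symm

theorem IsWeakDeriv.unique (hg : IsWeakDeriv u g) (hh : IsWeakDeriv u h) : g = h :=
  Lp.ext (HasWeakDeriv.unique hg hh (Lp.memLp u) (Lp.memLp g) (Lp.memLp h))

theorem MemW1.isWeakDeriv {p : ℝ≥0∞} {u : LpT L p} (hu : MemW1 u) :
    IsWeakDeriv u (weakDeriv u) := by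
  rw [weakDeriv, dif_pos hu]
  exact hu.choose_spec

theorem IsWeakDeriv.weakDeriv_eq (hg : IsWeakDeriv u g) : weakDeriv u = g :=
  IsWeakDeriv.unique (MemW1.isWeakDeriv ⟨g, hg⟩) hg

theorem IsWeakDeriv.inner_eq (hu : IsWeakDeriv u g) (hv : IsWeakDeriv v h) :
    inner ℝ u h = -inner ℝ g v := by
  rw [inner_eq_integral, inner_eq_integral]
  exact HasWeakDeriv.integral_mul hu hv (Lp.memLp u) (Lp.memLp g) (Lp.memLp v) (Lp.memLp h)

theorem IsTest.isWeakDeriv_toLp {φ : AddCircle L → ℝ} (hφ : IsTest φ) :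
    IsWeakDeriv ((hφ.memLp 2).toLp φ) ((hφ.isTest_torusDeriv.memLp 2).toLp _) :=
  hφ.hasWeakDeriv.congr (MemLp.coeFn_toLp _).symm (MemLp.coeFn_toLp _).symm

theorem IsTest.inner_toLp {φ : AddCircle L → ℝ} (hφ : IsTest φ) (u : LpT L 2) :
    inner ℝ u ((hφ.memLp 2).toLp φ) = ∫ x, u x * φ x := by
  rw [inner_eq_integral]
  refine integral_congr_ae ?_
  filter_upwards [(hφ.memLp 2).coeFn_toLp] with x hx
  rw [hx]

theorem IsWeakDeriv.mulCLM {a a' : LpT L ⊤} (ha : IsWeakDeriv a a') (hu : IsWeakDeriv u g) :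
    IsWeakDeriv (mulCLM a u) (mulCLM a' u + mulCLM a g) := by
  refine (HasWeakDeriv.mul ha hu (Lp.memLp a) (Lp.memLp a') (Lp.memLp u) (Lp.memLp g)).congr
    (coeFn_mulCLM a u).symm ?_
  filter_upwards [coeFn_mulCLM a' u, coeFn_mulCLM a g,
    Lp.coeFn_add (VFP.mulCLM a' u) (VFP.mulCLM a g)] with x h1 h2 h3
  rw [h3, Pi.add_apply, h1, h2]

/-- The graph of `u ↦ c ∂ₓ u + a u` on `H¹(𝕋)`. -/
noncomputable def derivGraph (c : ℝ) (a : LpT L ⊤) : Submodule ℝ (LpT L 2 × LpT L 2) where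
  carrier := {q | ∃ g, IsWeakDeriv q.1 g ∧ q.2 = c • g + mulCLM a q.1}
  add_mem' := by
    rintro q q' ⟨g, hg, e⟩ ⟨g', hg', e'⟩
    refine ⟨g + g', hg.add hg', ?_⟩
    rw [Prod.snd_add, Prod.fst_add, e, e', map_add, smul_add]
    abel
  zero_mem' := ⟨0, isWeakDeriv_zero, by simp⟩
  smul_mem' := by
    rintro s q ⟨g, hg, e⟩
    refine ⟨s • g, hg.const_smul s, ?_⟩
    rw [Prod.smul_snd, Prod.smul_fst, e, map_smul, smul_add, smul_comm]

variable {c : ℝ} {a a' : LpT L ⊤}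

theorem mem_derivGraph {w : LpT L 2} :
    (u, w) ∈ derivGraph c a ↔ ∃ g, IsWeakDeriv u g ∧ w = c • g + mulCLM a u := Iff.rfl

theorem IsWeakDeriv.mem_derivGraph (hg : IsWeakDeriv u g) :
    (u, c • g + VFP.mulCLM a u) ∈ derivGraph c a := ⟨g, hg, rfl⟩

/-- Tested on smooth functions alone, the adjoint relation is the definition of `c⁻¹ (w - a u)` as
weak derivative of `u`. This gives maximality of both graphs. -/
theorem mem_derivGraph_of_inner_eq (hc : c ≠ 0) {w : LpT L 2}
    (h : ∀ v z, (v, z) ∈ derivGraph (-c) a → inner ℝ w v = inner ℝ u z) :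
    (u, w) ∈ derivGraph c a := by
  refine ⟨c⁻¹ • (w - mulCLM a u), fun φ hφ => ?_, ?_⟩
  · have h1 := h _ _ hφ.isWeakDeriv_toLp.mem_derivGraph
    rw [← hφ.isTest_torusDeriv.inner_toLp, ← hφ.inner_toLp, inner_smul_left, inner_sub_left,
      conj_trivial]
    rw [inner_add_right, inner_smul_right, inner_mulCLM_right] at h1
    rw [h1]
    field_simp
    ring
  · rw [smul_inv_smul₀ hc, sub_add_cancel]

theorem dense_derivGraph : Dense {u : LpT L 2 | ∃ w, (u, w) ∈ derivGraph c a} := by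
  have h1 : {u : LpT L 2 | ∃ w, (u, w) ∈ derivGraph c a}
      = ((derivGraph c a).map (LinearMap.fst ℝ _ _) : Submodule ℝ (LpT L 2)) := by
    ext u; simp
  rw [h1, Submodule.dense_iff_topologicalClosure_eq_top, Submodule.topologicalClosure_eq_top_iff,
    Submodule.eq_bot_iff]
  intro u hu
  have h2 : ∀ φ : AddCircle L → ℝ, IsTest φ → ∫ x, u x * φ x = 0 := fun φ hφ => by
    rw [← hφ.inner_toLp, real_inner_comm]
    exact (Submodule.mem_orthogonal _ _).1 hu _ ⟨_, hφ.isWeakDeriv_toLp.mem_derivGraph, rfl⟩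
  refine Lp.eq_zero_iff_ae_eq_zero.2 (ae_eq_zero_of_coeff (Lp.memLp u) fun n => ?_)
  rw [coeff_eq ((Lp.memLp u).integrable one_le_two), h2 _ (isTest_re_fourier _),
    h2 _ (isTest_im_fourier _)]
  simp

theorem isAdjointPair_derivGraph (hc : c ≠ 0) (a : LpT L ⊤) :
    IsAdjointPair (derivGraph c a) (derivGraph (-c) a) where
  inner_eq := by
    intro u w v z hu hv
    obtain ⟨g, hg, rfl⟩ := mem_derivGraph.1 hu
    obtain ⟨h, hh, rfl⟩ := mem_derivGraph.1 hv
    have := hg.inner_eq hh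
    rw [inner_add_left, inner_add_right, inner_smul_left, inner_smul_right, inner_mulCLM_right,
      this, conj_trivial]
    ring
  mem_left := mem_derivGraph_of_inner_eq hc
  mem_right := fun {v z} h => mem_derivGraph_of_inner_eq (neg_ne_zero.2 hc) fun u w hu => by
    rw [neg_neg] at hu
    rw [real_inner_comm, ← h u w hu, real_inner_comm]
  dense_left := dense_derivGraph
  dense_right := dense_derivGraph

theorem derivGraph_add {w : LpT L 2} (hu : (u, w) ∈ derivGraph c a) :
    (u, ((2 : ℝ) • mulCLM a) u - w) ∈ derivGraph (-c) a := by
  obtain ⟨g, hg, rfl⟩ := mem_derivGraph.1 hu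
  refine ⟨g, hg, ?_⟩
  rw [smul_apply, two_smul]
  module

/-- Only cross terms survive, namely `-2 c (⟨u', a v⟩ + ⟨a u, v'⟩)`, and integrating the second by
parts leaves `a'`. The bound on the second derivative of the potential is used here. -/
theorem derivGraph_commutator (ha : IsWeakDeriv a a') {w z : LpT L 2}
    (hu : (u, w) ∈ derivGraph c a) (hv : (v, z) ∈ derivGraph c a) :
    inner ℝ (((2 : ℝ) • mulCLM a) u - w) (((2 : ℝ) • mulCLM a) v - z) - inner ℝ w z
      = inner ℝ (((2 * c) • mulCLM a') u) v := by
  obtain ⟨g, hg, rfl⟩ := mem_derivGraph.1 hu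
  obtain ⟨h, hh, rfl⟩ := mem_derivGraph.1 hv
  have h1 := (ha.mulCLM hg).inner_eq hh
  rw [inner_add_left] at h1
  simp only [smul_apply, inner_add_left, inner_add_right, inner_sub_left, inner_sub_right,
    inner_smul_left, inner_smul_right, conj_trivial, inner_mulCLM_right]
  linear_combination (-2 * c) * h1

/-- The Poincaré inequality for a weighted derivative. -/
theorem poincare_derivGraph {Ψ Ψ' : LpT L ⊤} (hc : 0 < c) (hΨ : IsWeakDeriv Ψ Ψ')
    (ha : a = -c • Ψ') {w e : LpT L 2} (he : e =ᵐ[volume] fun x => Real.exp (Ψ x))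
    (hu : (u, w) ∈ derivGraph c a) (hue : inner ℝ u e = 0) :
    ‖u‖ ≤ Real.exp (2 * ‖Ψ‖) * (L / (2 * Real.pi)) / c * ‖w‖ := by
  obtain ⟨g, hg, hw⟩ := mem_derivGraph.1 hu
  have hL0 := hL.out
  have sq_eq : ∀ v : LpT L 2, ‖v‖ ^ 2 = ∫ x, v x * v x := fun v => by
    rw [← real_inner_self_eq_norm_sq, inner_eq_integral]
  have hK := ae_norm_le Ψ
  have hneg : HasWeakDeriv (fun x => -1 * Ψ x) (fun x => -1 * Ψ' x) := HasWeakDeriv.const_mul hΨ (-1)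
  have hb := hneg.exp ((Lp.memLp Ψ).const_mul _) ((Lp.memLp Ψ').const_mul _) (K := ‖Ψ‖)
    (K' := ‖Ψ'‖) (by simpa using hK) (by simpa using ae_norm_le Ψ')
  have hbm : MemLp (fun x => Real.exp (-1 * Ψ x)) ⊤ (volume : Measure (AddCircle L)) := by
    refine memLp_top_of_bound (Real.continuous_exp.comp_aestronglyMeasurable
      ((Lp.aestronglyMeasurable Ψ).const_mul _)) (Real.exp ‖Ψ‖) ?_
    filter_upwards [hK] with x hx
    rw [Real.norm_eq_abs, Real.abs_exp]
    exact Real.exp_le_exp.2 (by linarith [neg_le_of_abs_le hx])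
  have hbm' : MemLp (fun x => -1 * Ψ' x * Real.exp (-1 * Ψ x)) ⊤ (volume : Measure (AddCircle L)) :=
    hbm.mul ((Lp.memLp Ψ').const_mul _)
  have hf := hb.mul hg hbm hbm' (Lp.memLp u) (Lp.memLp g)
  -- Conjugation by the weight turns the operator into a plain derivative: `w = c exp Ψ · f'`.
  -- Wirtinger's inequality then applies to `f` minus its mean, and the weights cost `exp (2 ‖Ψ‖)`.
  set f : AddCircle L → ℝ := fun x => Real.exp (-1 * Ψ x) * u x with hfdef
  set f' : AddCircle L → ℝ := fun x => -1 * Ψ' x * Real.exp (-1 * Ψ x) * u x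
    + Real.exp (-1 * Ψ x) * g x with hf'def
  have hf2 : MemLp f 2 (volume : Measure (AddCircle L)) := (Lp.memLp u).mul hbm
  have hf2' : MemLp f' 2 (volume : Measure (AddCircle L)) :=
    ((Lp.memLp u).mul hbm').add ((Lp.memLp g).mul hbm)
  set m := L⁻¹ * ∫ x, f x with hm
  have hcm : MemLp (fun _ : AddCircle L => -m) 2 (volume : Measure (AddCircle L)) := memLp_const _
  have hF := hf.add (hasWeakDeriv_const (-m)) (hf2.integrable one_le_two)
    (hf2'.integrable one_le_two) (hcm.integrable one_le_two) (integrable_zero _ _ _)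
  have hW := hF.integral_sq_le (hf2.add hcm) (by simpa using hf2') (by
    rw [integral_add (hf2.integrable one_le_two) (hcm.integrable one_le_two), integral_const]
    simp [Measure.real, ENNReal.toReal_ofReal hL0.le, hm, hL0.ne'])
  simp only [add_zero] at hW
  -- The constraint on `u` is orthogonality to `e`, not zero mean of `f`; subtracting a multiple of
  -- `e` can only increase the norm.
  have h1 : ‖u‖ ^ 2 ≤ ‖u - m • e‖ ^ 2 := by
    rw [norm_sub_sq_real, inner_smul_right, hue]
    linarith [sq_nonneg ‖m • e‖]
  have h2 : ‖u - m • e‖ ^ 2 ≤ Real.exp ‖Ψ‖ ^ 2 * ∫ x, (f x + -m) * (f x + -m) := by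
    rw [sq_eq, ← integral_const_mul]
    refine integral_mono_ae ((Lp.memLp _).integrable_mul (Lp.memLp _))
      (((hf2.add hcm).integrable_mul (hf2.add hcm)).const_mul _) ?_
    filter_upwards [hK, he, Lp.coeFn_sub u (m • e), Lp.coeFn_smul m e] with x h1 h2 h3 h4
    have h5 : (u - m • e) x = Real.exp (Ψ x) * (f x + -m) := by
      rw [h3, Pi.sub_apply, h4, Pi.smul_apply, h2, hfdef]
      have : Real.exp (Ψ x) * Real.exp (-1 * Ψ x) = 1 := by
        rw [← Real.exp_add]; simp
      rw [smul_eq_mul]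
      linear_combination (-u x) * this
    have h6 : Real.exp (Ψ x) ^ 2 ≤ Real.exp ‖Ψ‖ ^ 2 := by
      gcongr
      exact (le_abs_self _).trans h1
    have h7 := mul_le_mul_of_nonneg_right h6 (mul_self_nonneg (f x + -m))
    simp only [h5]
    linarith
  have h3 : ∫ x, f' x * f' x ≤ Real.exp ‖Ψ‖ ^ 2 / c ^ 2 * ‖w‖ ^ 2 := by
    rw [sq_eq, ← integral_const_mul]
    refine integral_mono_ae (hf2'.integrable_mul hf2')
      (((Lp.memLp w).integrable_mul (Lp.memLp w)).const_mul _) ?_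
    have hw' : w = c • (g - mulCLM Ψ' u) := by
      rw [hw, ha, mulCLM_apply, Lp.smul_assoc, neg_smul, smul_sub, ← mulCLM_apply, sub_eq_add_neg]
    filter_upwards [hK, Lp.coeFn_smul c (g - mulCLM Ψ' u), Lp.coeFn_sub g (mulCLM Ψ' u),
      coeFn_mulCLM Ψ' u] with x h1 h2 h3 h4
    have h5 : f' x = Real.exp (-1 * Ψ x) / c * w x := by
      rw [hw', h2, Pi.smul_apply, h3, Pi.sub_apply, h4, smul_eq_mul, hf'def]
      field_simp
      ring
    have h6 : Real.exp (-1 * Ψ x) ^ 2 ≤ Real.exp ‖Ψ‖ ^ 2 := by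
      gcongr
      linarith [neg_le_of_abs_le h1]
    have h7 : Real.exp (-1 * Ψ x) ^ 2 / c ^ 2 * (w x * w x)
        ≤ Real.exp ‖Ψ‖ ^ 2 / c ^ 2 * (w x * w x) := by
      have := mul_self_nonneg (w x)
      gcongr
    simp only [h5]
    refine le_trans (le_of_eq ?_) h7
    field_simp
  refine le_of_sq_le_sq ?_ (by positivity)
  refine h1.trans (h2.trans ?_)
  calc Real.exp ‖Ψ‖ ^ 2 * ∫ x, (f x + -m) * (f x + -m)
      ≤ Real.exp ‖Ψ‖ ^ 2 * ((L / (2 * Real.pi)) ^ 2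
        * (Real.exp ‖Ψ‖ ^ 2 / c ^ 2 * ‖w‖ ^ 2)) := by
        have := mul_le_mul_of_nonneg_left h3 (sq_nonneg (L / (2 * Real.pi)))
        gcongr
        exact hW.trans this
    _ = _ := by
      rw [two_mul ‖Ψ‖, Real.exp_add]
      ring

theorem kernel_derivGraph {Ψ Ψ' : LpT L ⊤} (hΨ : IsWeakDeriv Ψ Ψ') (ha : a = -c • Ψ')
    {e : LpT L 2} (he : e =ᵐ[volume] fun x => Real.exp (Ψ x)) : (e, 0) ∈ derivGraph c a := by
  refine ⟨mulCLM Ψ' e, ?_, ?_⟩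
  · refine (HasWeakDeriv.exp hΨ (Lp.memLp Ψ) (Lp.memLp Ψ') (ae_norm_le Ψ) (ae_norm_le Ψ')).congr
      he.symm ?_
    filter_upwards [coeFn_mulCLM Ψ' e, he] with x h1 h2
    rw [h1, h2]
  · rw [ha, mulCLM_apply, mulCLM_apply, Lp.smul_assoc, neg_smul, add_neg_cancel]

end Operators

end VFP

namespace VFP

/-! ### The operators of the theorem -/

section Concrete

variable {L : ℝ} [hL : Fact (0 < L)]

/-- The zeroth order coefficient of `𝒜`. -/
noncomputable def fieldCoeff (T₀ : ℝ) (Φ : LpT L ⊤) : LpT L ⊤ :=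
  -(1 / (2 * √T₀)) • electricField Φ

variable {T₀ c₀ : ℝ} {Φ : LpT L ⊤} {u w g : LpT L 2}

theorem opA_eq (T₀ : ℝ) (Φ : LpT L ⊤) (u : LpT L 2) :
    opA T₀ Φ u = √T₀ • weakDeriv u + mulCLM (fieldCoeff T₀ Φ) u := by
  rw [opA, fieldCoeff, mulCLM_apply, Lp.smul_assoc, neg_smul, sub_eq_add_neg]

theorem opAstar_eq (T₀ : ℝ) (Φ : LpT L ⊤) (u : LpT L 2) :
    opAstar T₀ Φ u = -√T₀ • weakDeriv u + mulCLM (fieldCoeff T₀ Φ) u := by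
  rw [opAstar, fieldCoeff, mulCLM_apply, Lp.smul_assoc, neg_smul, neg_smul, sub_eq_add_neg]

theorem mem_derivGraph_iff {c : ℝ} {a : LpT L ⊤} :
    (u, w) ∈ derivGraph c a ↔ MemH1 u ∧ w = c • weakDeriv u + mulCLM a u := by
  rw [mem_derivGraph]
  constructor
  · rintro ⟨g, hg, hw⟩
    exact ⟨⟨g, hg⟩, by rw [hw, hg.weakDeriv_eq]⟩
  · rintro ⟨hu, hw⟩
    exact ⟨_, hu.isWeakDeriv, hw⟩

theorem mem_graph_opA :
    (u, w) ∈ derivGraph (√T₀) (fieldCoeff T₀ Φ) ↔ MemH1 u ∧ w = opA T₀ Φ u := by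
  rw [mem_derivGraph_iff, opA_eq]

theorem mem_graph_opAstar :
    (u, w) ∈ derivGraph (-√T₀) (fieldCoeff T₀ Φ) ↔ MemH1 u ∧ w = opAstar T₀ Φ u := by
  rw [mem_derivGraph_iff, opAstar_eq]

theorem coeFn_sqrtRhoInf (T₀ : ℝ) (Φ : LpT L ⊤) (hc₀ : 0 ≤ c₀) :
    sqrtRhoInf T₀ Φ c₀ =ᵐ[volume] fun x => √c₀ * Real.exp ((-(1 / (2 * T₀)) • Φ : LpT L ⊤) x) := by
  filter_upwards [(memLp_sqrt_rhoInf T₀ Φ c₀).coeFn_toLp, Lp.coeFn_smul (-(1 / (2 * T₀))) Φ]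
    with x h1 h2
  rw [sqrtRhoInf, h1, h2, rhoInf, Real.sqrt_mul hc₀, Real.sqrt_eq_rpow (Real.exp _),
    ← Real.exp_mul, Pi.smul_apply, smul_eq_mul]
  congr 2
  rcases eq_or_ne T₀ 0 with rfl | hT
  · simp
  · field_simp

/-- With `Ψ = -Φ / (2 T₀)` the zeroth order coefficient is `-√T₀ Ψ'`, so `exp Ψ` spans the kernel
and `√ρ_∞ = √c₀ exp Ψ`. The bounded operators and the Poincaré constant do not involve `c₀`. -/
theorem hermitePair_opA (hT₀ : 0 < T₀) (hΦ : MemW2Infty Φ) (hc₀ : 0 < c₀) :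
    HermitePair (derivGraph (√T₀) (fieldCoeff T₀ Φ)) (derivGraph (-√T₀) (fieldCoeff T₀ Φ))
      ((2 : ℝ) • mulCLM (fieldCoeff T₀ Φ))
      ((2 * √T₀) • mulCLM ((1 / (2 * √T₀)) • weakDeriv (weakDeriv Φ)))
      (sqrtRhoInf T₀ Φ c₀)
      (Real.exp (2 * ‖(-(1 / (2 * T₀)) • Φ : LpT L ⊤)‖) * (L / (2 * Real.pi)) / √T₀) := by
  have hL0 := hL.out
  have hs : 0 < √T₀ := Real.sqrt_pos.2 hT₀
  have hsc : 0 < √c₀ := Real.sqrt_pos.2 hc₀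
  have hf : fieldCoeff T₀ Φ = (1 / (2 * √T₀)) • weakDeriv Φ := by
    rw [fieldCoeff, electricField, smul_neg, neg_smul, neg_neg]
  have hΨ := hΦ.1.isWeakDeriv.const_smul (-(1 / (2 * T₀)))
  have ha : fieldCoeff T₀ Φ = -√T₀ • (-(1 / (2 * T₀))) • weakDeriv Φ := by
    rw [hf, smul_smul]
    congr 1
    have := Real.mul_self_sqrt hT₀.le
    field_simp
    linarith
  have he : ((√c₀)⁻¹ • sqrtRhoInf T₀ Φ c₀ : LpT L 2) =ᵐ[volume]
      fun x => Real.exp ((-(1 / (2 * T₀)) • Φ : LpT L ⊤) x) := by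
    filter_upwards [coeFn_sqrtRhoInf T₀ Φ hc₀.le, Lp.coeFn_smul (√c₀)⁻¹ (sqrtRhoInf T₀ Φ c₀)]
      with x h1 h2
    rw [h2, Pi.smul_apply, h1, smul_eq_mul, inv_mul_cancel_left₀ hsc.ne']
  have hk := kernel_derivGraph hΨ ha he
  exact
    { isAdjointPair_derivGraph hs.ne' (fieldCoeff T₀ Φ) with
      add_left := derivGraph_add
      add_right := fun hu => by
        have := derivGraph_add hu
        rwa [neg_neg] at this
      commutator := fun hu hv => derivGraph_commutator
        (by rw [hf]; exact hΦ.2.isWeakDeriv.const_smul _) hu hv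
      kernel := by
        have := Submodule.smul_mem _ (√c₀) hk
        simpa [smul_smul, hsc.ne'] using this
      poincare_pos := by positivity
      poincare := fun hu hue => poincare_derivGraph hs hΨ ha he hu
        (by rw [inner_smul_right, hue, mul_zero]) }

theorem inner_sqrtRhoInf (u : LpT L 2) :
    inner ℝ u (sqrtRhoInf T₀ Φ c₀) = ∫ x, u x * √(rhoInf T₀ Φ c₀ x) := by
  rw [inner_eq_integral]
  refine integral_congr_ae ?_
  filter_upwards [(memLp_sqrt_rhoInf T₀ Φ c₀).coeFn_toLp] with x hx
  rw [sqrtRhoInf, hx]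

theorem HasEquilibriumMass.inner_sub (hc₀ : 0 ≤ c₀) (h : HasEquilibriumMass T₀ Φ c₀ u) :
    inner ℝ (u - sqrtRhoInf T₀ Φ c₀) (sqrtRhoInf T₀ Φ c₀) = 0 := by
  rw [inner_sub_left, inner_sqrtRhoInf, inner_sqrtRhoInf, h, sub_eq_zero]
  refine integral_congr_ae ?_
  filter_upwards [(memLp_sqrt_rhoInf T₀ Φ c₀).coeFn_toLp] with x hx
  rw [sqrtRhoInf, hx, Real.mul_self_sqrt]
  unfold rhoInf
  positivity

theorem isEllipticSol_iff : IsEllipticSol T₀ Φ c₀ g u ↔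
    ∃ w, (u, w) ∈ derivGraph (√T₀) (fieldCoeff T₀ Φ) ∧
      (w, g) ∈ derivGraph (-√T₀) (fieldCoeff T₀ Φ) ∧ inner ℝ u (sqrtRhoInf T₀ Φ c₀) = 0 := by
  constructor
  · intro h
    exact ⟨_, mem_graph_opA.2 ⟨h.memH1, rfl⟩, mem_graph_opAstar.2 ⟨h.memH1_opA, h.eq.symm⟩,
      by rw [inner_sqrtRhoInf, h.mean_zero]⟩
  · rintro ⟨w, h1, h2, h3⟩
    obtain ⟨hu, rfl⟩ := mem_graph_opA.1 h1
    obtain ⟨hw, hg⟩ := mem_graph_opAstar.1 h2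
    exact ⟨hu, hw, hg.symm, by rw [← inner_sqrtRhoInf, h3]⟩

theorem hMinusOneNorm_eq (hT₀ : 0 < T₀) (hΦ : MemW2Infty Φ) (hc₀ : 0 < c₀)
    (hu : (u, w) ∈ derivGraph (√T₀) (fieldCoeff T₀ Φ))
    (hw : (w, g) ∈ derivGraph (-√T₀) (fieldCoeff T₀ Φ))
    (hue : inner ℝ u (sqrtRhoInf T₀ Φ c₀) = 0) : hMinusOneNorm T₀ Φ c₀ g = ‖w‖ := by
  have hex : ∃ u, IsEllipticSol T₀ Φ c₀ g u := ⟨u, isEllipticSol_iff.2 ⟨w, hu, hw, hue⟩⟩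
  rw [hMinusOneNorm, dif_pos hex]
  obtain ⟨w', h1, h2, h3⟩ := isEllipticSol_iff.1 hex.choose_spec
  rw [← (mem_graph_opA.1 h1).2, (hermitePair_opA hT₀ hΦ hc₀).elliptic_unique h1 h2 hu hw]

theorem norm_zeroth (u : LpT L 2) : ‖zeroth u‖ = ‖u‖ :=
  lp.norm_single (E := fun _ : ℕ => LpT L 2) two_pos 0 u

theorem norm_sub_single {H : Type*} [NormedAddCommGroup H] [InnerProductSpace ℝ H]
    (v : lp (fun _ : ℕ => H) 2) (e : H) :
    ‖v - lp.single 2 0 (v 0)‖ = √(perpSq (v - lp.single 2 0 e)) := by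
  have h1 : ‖v - lp.single 2 0 (v 0)‖ ^ 2 = perpSq (v - lp.single 2 0 e) := by
    rw [norm_sq_eq_add_perpSq, perpSq_eq_tsum, perpSq_eq_tsum]
    simp [lp.single_apply]
  rw [← h1, Real.sqrt_sq (norm_nonneg _)]

theorem norm_perp (D : SeqL2 L) (T₀ : ℝ) (Φ : LpT L ⊤) (c₀ : ℝ) :
    ‖perp D‖ = √(perpSq (D - equilibrium T₀ Φ c₀)) := norm_sub_single D _

/-- The constant `e` in mode `0` enters only the equation for `k = 1`, through `⟨e, B φ⟩ = ⟨A e, φ⟩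
= 0`. -/
theorem IsWeakSol.sub_single {H : Type*} [NormedAddCommGroup H] [InnerProductSpace ℝ H]
    {A B : Submodule ℝ (H × H)} {b : H →L[ℝ] H} {r : ℝ} {D : ℝ → lp (fun _ : ℕ => H) 2} {e : H}
    (h : IsAdjointPair A B) (hb : ∀ {u w : H}, (u, w) ∈ A → (u, b u - w) ∈ B) (he : (e, 0) ∈ A)
    (hD : IsWeakSol A b r D) : IsWeakSol A b r (fun t => D t - lp.single 2 0 e) where
  continuousOn := hD.continuousOn.sub continuousOn_const
  weak k φ w hφ t ht := by
    have h1 := (hD.weak k φ w hφ t ht).sub_const (inner ℝ (Pi.single (M := fun _ => H) 0 e k) φ)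
    have h2 := h.inner_eq he (hb hφ)
    rw [inner_zero_left] at h2
    simp only [lp.coeFn_sub, Pi.sub_apply, lp.single_apply, inner_sub_left]
    refine h1.congr_deriv ?_
    rcases k with _ | _ | k
    · simp
    · simp [← h2]
    · simp

/-- Time is measured in units of `τ`, which normalises the damping and makes `τ / ε` the only
parameter. -/
theorem IsHermiteSol.isWeakSol {ε τ : ℝ} (hτ : 0 < τ) {D : ℝ → SeqL2 L}
    (hD : IsHermiteSol T₀ Φ ε τ D) :
    IsWeakSol (derivGraph (√T₀) (fieldCoeff T₀ Φ)) ((2 : ℝ) • mulCLM (fieldCoeff T₀ Φ)) (τ / ε)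
      (fun s => D (τ * s)) where
  continuousOn := hD.continuousOn.comp (by fun_prop) fun s hs => mul_nonneg hτ.le hs
  weak k φ w hφ t ht := by
    obtain ⟨h1, -⟩ := mem_graph_opA.1 hφ
    have h2 := (mem_graph_opAstar.1 (derivGraph_add hφ)).2
    have h3 := (hD.weak k φ h1 (τ * t) (mul_nonneg hτ.le ht)).scomp t
      (((hasDerivAt_id t).const_mul τ).hasDerivWithinAt (s := Ici 0))
      (fun s hs => mul_nonneg hτ.le hs)
    rw [h2, (mem_graph_opA.1 hφ).2]
    refine h3.congr_deriv ?_
    rw [smul_eq_mul]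
    field_simp

theorem IsDriftDiffusionSol.isWeakHeatSol {τ τ₀ : ℝ} (hτ : 0 < τ) {v : ℝ → LpT L 2} {e : LpT L 2}
    (h : IsAdjointPair (derivGraph (√T₀) (fieldCoeff T₀ Φ)) (derivGraph (-√T₀) (fieldCoeff T₀ Φ)))
    (he : (e, 0) ∈ derivGraph (√T₀) (fieldCoeff T₀ Φ))
    (hv : IsDriftDiffusionSol T₀ Φ τ₀ v) :
    IsWeakHeatSol (derivGraph (√T₀) (fieldCoeff T₀ Φ)) (derivGraph (-√T₀) (fieldCoeff T₀ Φ))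
      (τ₀ * τ) (fun s => v (τ * s) - e) where
  continuousOn := (hv.continuousOn.comp (by fun_prop) fun s hs => mul_nonneg hτ.le hs).sub
    continuousOn_const
  weak φ w z hφ hw t ht := by
    obtain ⟨h1, rfl⟩ := mem_graph_opA.1 hφ
    obtain ⟨h2, rfl⟩ := mem_graph_opAstar.1 hw
    have h3 := (hv.weak φ h1 h2 (τ * t) (mul_nonneg hτ.le ht)).scomp t
      (((hasDerivAt_id t).const_mul τ).hasDerivWithinAt (s := Ici 0))
      (fun s hs => mul_nonneg hτ.le hs)
    have h4 := h.inner_eq he hw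
    rw [inner_zero_left] at h4
    simp only [inner_sub_left, ← h4, sub_zero]
    refine (h3.sub_const (inner ℝ e φ)).congr_deriv ?_
    rw [smul_eq_mul]
    ring

theorem isWeakHeatSol_zero {H : Type*} [NormedAddCommGroup H] [InnerProductSpace ℝ H]
    (A B : Submodule ℝ (H × H)) (m : ℝ) : IsWeakHeatSol A B m (fun _ => 0) where
  continuousOn := continuousOn_const
  weak φ w z _ _ t _ := by
    simpa using hasDerivWithinAt_const t (Ici 0) (0 : ℝ)

/-- The data needed to apply the abstract decay estimates to `D(0) - D_∞`. -/
theorem SeqMemH1.sub_equilibrium {D : SeqL2 L} (hD : SeqMemH1 T₀ Φ D)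
    (he : (sqrtRhoInf T₀ Φ c₀, 0) ∈ derivGraph (√T₀) (fieldCoeff T₀ Φ)) :
    ((D - equilibrium T₀ Φ c₀) 0, opB T₀ Φ 0 ((D - equilibrium T₀ Φ c₀) 0))
        ∈ derivGraph (√T₀) (fieldCoeff T₀ Φ) ∧
      (∀ k, k ≠ 0 → ((D - equilibrium T₀ Φ c₀) k, opB T₀ Φ k ((D - equilibrium T₀ Φ c₀) k))
        ∈ derivGraph (-√T₀) (fieldCoeff T₀ Φ)) ∧
      Summable fun k => ‖opB T₀ Φ k ((D - equilibrium T₀ Φ c₀) k)‖ ^ 2 := by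
  have hk : ∀ k, k ≠ 0 → (D - equilibrium T₀ Φ c₀) k = D k := fun k hk => by
    rw [lp.coeFn_sub, Pi.sub_apply, equilibrium, zeroth, lp.single_apply_ne _ _ _ hk, sub_zero]
  refine ⟨?_, fun k hk0 => ?_, ?_⟩
  · have h1 := Submodule.sub_mem _
      (mem_graph_opA (T₀ := T₀) (Φ := Φ).2 ⟨hD.1 0, rfl⟩) he
    rw [opB, if_pos rfl, mem_graph_opA]
    refine ⟨?_, rfl⟩
    rw [lp.coeFn_sub, Pi.sub_apply, equilibrium, zeroth, lp.single_apply_self]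
    exact (mem_graph_opA.1 h1).1
  · rw [hk k hk0, opB, if_neg hk0]
    exact mem_graph_opAstar.2 ⟨hD.1 k, rfl⟩
  · refine (summable_nat_add_iff 1).1 (((summable_nat_add_iff 1).2 hD.2).congr fun k => ?_)
    rw [hk _ k.succ_ne_zero]

end Concrete

end VFP

namespace VFP

/-! ### Returning to the original time scale -/

section Regimes

variable {L : ℝ} [hL : Fact (0 < L)]

theorem IsHermiteSol.exists_decay {T₀ : ℝ} (hT₀ : 0 < T₀) {Φ : LpT L ⊤} (hΦ : MemW2Infty Φ) :
    ∃ C γ : ℝ, 0 < C ∧ 0 < γ ∧ ∀ (c₀ ε τ : ℝ) (D : ℝ → SeqL2 L), 0 < c₀ → 0 < ε → 0 < τ →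
      IsHermiteSol T₀ Φ ε τ D → HasEquilibriumMass T₀ Φ c₀ (D 0 0) → SeqMemH1 T₀ Φ (D 0) →
      (∀ t, 0 ≤ t → ‖perp (D t)‖ ≤ ‖perp (D 0)‖ * Real.exp (-t / (2 * τ))
        + C * (τ / ε * (1 + τ / ε)) * seqH1Norm T₀ Φ (D 0 - equilibrium T₀ Φ c₀)
          * Real.exp (-(γ * (τ / ε ^ 2 / (1 + (τ / ε) ^ 2)) * t))) ∧
      ∀ (m : ℝ) (u : ℝ → LpT L 2),
        IsWeakHeatSol (derivGraph (√T₀) (fieldCoeff T₀ Φ)) (derivGraph (-√T₀) (fieldCoeff T₀ Φ))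
          m u → (τ / ε) ^ 2 / 2 ≤ m → inner ℝ (u 0) (sqrtRhoInf T₀ Φ c₀) = 0 →
        ∀ t, 0 ≤ t →
          (∃ v, IsEllipticSol T₀ Φ c₀ (D t 0 - sqrtRhoInf T₀ Φ c₀ - u (t / τ)) v) ∧
          hMinusOneNorm T₀ Φ c₀ (D t 0 - sqrtRhoInf T₀ Φ c₀ - u (t / τ)) ≤
            C * (hMinusOneNorm T₀ Φ c₀ (D 0 0 - sqrtRhoInf T₀ Φ c₀ - u 0)
              + τ / ε * (1 + (τ / ε) ^ 2) * seqH1Norm T₀ Φ (D 0 - equilibrium T₀ Φ c₀)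
              + |m / (τ / ε) ^ 2 - 1| * ‖u 0‖)
            * Real.exp (-(γ * (τ / ε ^ 2 / (1 + (τ / ε) ^ 2)) * t)) := by
  obtain ⟨C, γ, hC, hγ, key⟩ := HermitePair.exists_decay
    (isAdjointPair_derivGraph (Real.sqrt_pos.2 hT₀).ne' (fieldCoeff T₀ Φ))
    ((2 : ℝ) • mulCLM (fieldCoeff T₀ Φ))
    ((2 * √T₀) • mulCLM ((1 / (2 * √T₀)) • weakDeriv (weakDeriv Φ)))
    (Real.exp (2 * ‖(-(1 / (2 * T₀)) • Φ : LpT L ⊤)‖) * (L / (2 * Real.pi)) / √T₀)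
  refine ⟨C, γ, hC, hγ, fun c₀ ε τ D hc₀ hε hτ hD hmass hH1 => ?_⟩
  have hp := hermitePair_opA hT₀ hΦ hc₀
  have hsol : IsWeakSol _ _ _ (fun t => D (τ * t) - equilibrium T₀ Φ c₀) :=
    (hD.isWeakSol hτ).sub_single hp.toIsAdjointPair hp.add_left hp.kernel
  obtain ⟨g0, gk, gs⟩ := hH1.sub_equilibrium hp.kernel
  have h00 : ∀ E : SeqL2 L, (E - equilibrium T₀ Φ c₀) 0 = E 0 - sqrtRhoInf T₀ Φ c₀ := fun E => by
    rw [lp.coeFn_sub, Pi.sub_apply, equilibrium, zeroth, lp.single_apply_self]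
  have hτ0 : τ * 0 = 0 := mul_zero τ
  have hDe : inner ℝ ((D (τ * 0) - equilibrium T₀ Φ c₀) 0) (sqrtRhoInf T₀ Φ c₀) = 0 := by
    rw [hτ0, h00]
    exact hmass.inner_sub hc₀.le
  have hrate : ∀ t : ℝ, γ * ((τ / ε) ^ 2 / (1 + (τ / ε) ^ 2)) * (t / τ)
      = γ * (τ / ε ^ 2 / (1 + (τ / ε) ^ 2)) * t := fun t => by
    field_simp
  obtain ⟨k1, k2⟩ := key _ hp (τ / ε) (by positivity) _ hsol hDe
    (fun k => opB T₀ Φ k ((D 0 - equilibrium T₀ Φ c₀) k)) (by simpa only [hτ0] using g0)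
    (by simpa only [hτ0] using gk) gs
  simp only [hτ0] at k1 k2
  constructor
  · intro t ht
    have h1 := k1 (t / τ) (by positivity)
    rw [mul_div_cancel₀ _ hτ.ne', hrate] at h1
    rw [norm_perp _ T₀ Φ c₀, norm_perp _ T₀ Φ c₀, seqH1Norm]
    have e1 : -(t / τ / 2) = -t / (2 * τ) := by
      field_simp
    rw [e1] at h1
    exact h1
  · intro m u hu hm hue t ht
    have hXe : inner ℝ (D 0 0 - sqrtRhoInf T₀ Φ c₀ - u 0) (sqrtRhoInf T₀ Φ c₀) = 0 := by
      rw [inner_sub_left, hue, hmass.inner_sub hc₀.le, sub_zero]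
    obtain ⟨v₀, w₀, hv₀, hw₀, hve₀⟩ := hp.exists_elliptic hXe
    obtain ⟨v, w, hv, hw, hve, hle⟩ := k2 m u hu hm hue v₀ w₀ hv₀
      (by rw [h00]; exact hw₀) (t / τ) (by positivity)
    rw [mul_div_cancel₀ _ hτ.ne', h00] at hw
    rw [hrate] at hle
    refine ⟨⟨v, isEllipticSol_iff.2 ⟨w, hv, hw, hve⟩⟩, ?_⟩
    rw [hMinusOneNorm_eq hT₀ hΦ hc₀ hv hw hve, hMinusOneNorm_eq hT₀ hΦ hc₀ hv₀ hw₀ hve₀, seqH1Norm]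
    exact hle

/-- Here `q = τ / ε²`. The slack `T ≤ 2 q` serves the diffusive regime, where `T = τ₀` is only
comparable to `q`, and explains `2 / γ ≤ C`. -/
theorem rate_le {γ C q r τbar T : ℝ} (hγ : 0 < γ) (hC : 2 / γ ≤ C) (hq : 0 ≤ q) (hr : 0 ≤ r)
    (hrb : r ≤ τbar) (hT : T ≤ 2 * q) :
    T * kappa C τbar ≤ γ * (q / (1 + r ^ 2)) := by
  have hC0 : 0 < C := (by positivity : 0 < 2 / γ).trans_le hC
  have h1 : kappa C τbar ≤ γ / 2 / (1 + r ^ 2) := by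
    have : kappa C τbar = 1 / C / (1 + τbar ^ 2) := by
      rw [kappa, div_div, add_comm (1 : ℝ)]
    rw [this]
    have : 1 / C ≤ γ / 2 := by
      rw [div_le_iff₀ hC0]
      rw [div_le_iff₀ hγ] at hC
      linarith
    gcongr
  have h2 : 0 ≤ kappa C τbar := by
    unfold kappa
    positivity
  calc T * kappa C τbar ≤ 2 * q * kappa C τbar := by gcongr
    _ ≤ 2 * q * (γ / 2 / (1 + r ^ 2)) := by gcongr
    _ = _ := by ring

theorem one_add_sq_le {r τbar : ℝ} (hr : 0 ≤ r) (hrb : r ≤ τbar) :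
    1 + r ^ 2 ≤ 2 * (τbar ^ 3 + 1) := by
  have h1 : r ^ 2 ≤ τbar ^ 2 := by gcongr
  have h2 : 0 ≤ τbar := hr.trans hrb
  nlinarith [mul_nonneg (add_nonneg h2 zero_le_one) (sq_nonneg (τbar - 1)),
    mul_nonneg h2 (sq_nonneg (τbar - 1)), sq_nonneg (τbar - 1)]

end Regimes

end VFP


/-! ### The diffusive and the intermediate regime -/

theorem theorem2p2 (L : ℝ) [Fact (0 < L)] (T₀ : ℝ) (hT₀ : 0 < T₀)
    (Φ : VFP.LpT L ⊤) (hΦ : VFP.MemW2Infty Φ) :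
    ∃ C : ℝ, 0 < C ∧
      ∀ (τbar ε₀ : ℝ) (τ : ℝ → ℝ), 0 < τbar → 0 < ε₀ →
        (∀ ε ∈ Ioc 0 ε₀, 0 < τ ε) →
        (∀ ε ∈ Ioc 0 ε₀, τ ε / ε ≤ τbar) →
        -- the diffusive regime
        (∀ τ₀ : ℝ, 0 < τ₀ →
          Tendsto (fun ε => τ ε / ε ^ 2) (𝓝[>] 0) (𝓝 τ₀) →
          (∀ ε ∈ Ioc 0 ε₀, |τ ε / (τ₀ * ε ^ 2) - 1| ≤ 1 / 2) →
          ∀ ε ∈ Ioc 0 ε₀, ∀ (c₀ : ℝ) (D : ℝ → VFP.SeqL2 L), 0 < c₀ →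
            VFP.IsHermiteSol T₀ Φ ε (τ ε) D →
            VFP.HasEquilibriumMass T₀ Φ c₀ (D 0 0) →
            VFP.SeqMemH1 T₀ Φ (D 0) →
            (∀ t : ℝ, 0 ≤ t →
              ‖VFP.perp (D t)‖ ≤
                ‖VFP.perp (D 0)‖ * Real.exp (-t / (4 * τ₀ * ε ^ 2))
                + τ₀ * ε * (C * (τbar + 1))
                  * VFP.seqH1Norm T₀ Φ (D 0 - VFP.equilibrium T₀ Φ c₀)
                  * Real.exp (-(τ₀ * VFP.kappa C τbar * t))) ∧
            (∀ Dlim : ℝ → VFP.LpT L 2,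
              VFP.IsDriftDiffusionSol T₀ Φ τ₀ Dlim →
              VFP.HasEquilibriumMass T₀ Φ c₀ (Dlim 0) →
              ∀ t : ℝ, 0 ≤ t →
                (∃ u, VFP.IsEllipticSol T₀ Φ c₀ (D t 0 - Dlim t) u) ∧
                VFP.hMinusOneNorm T₀ Φ c₀ (D t 0 - Dlim t) ≤
                  C * (VFP.hMinusOneNorm T₀ Φ c₀ (D 0 0 - Dlim 0)
                      + ε * τ₀ * (τbar ^ 3 + 1)
                        * VFP.seqH1Norm T₀ Φ (D 0 - VFP.equilibrium T₀ Φ c₀))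
                    * Real.exp (-(τ₀ * VFP.kappa C τbar * t))
                  + C * |τ₀ * ε ^ 2 / τ ε - 1|
                    * ‖VFP.zeroth (Dlim 0) - VFP.equilibrium T₀ Φ c₀‖
                    * Real.exp (-(τ₀ * VFP.kappa C τbar * t)))) ∧
        -- the intermediate regime
        (Tendsto (fun ε => τ ε / ε ^ 2) (𝓝[>] 0) atTop →
          ∀ ε ∈ Ioc 0 ε₀, ∀ (c₀ : ℝ) (D : ℝ → VFP.SeqL2 L), 0 < c₀ →
            VFP.IsHermiteSol T₀ Φ ε (τ ε) D →
            VFP.HasEquilibriumMass T₀ Φ c₀ (D 0 0) →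
            VFP.SeqMemH1 T₀ Φ (D 0) →
            ∀ t : ℝ, 0 ≤ t →
              ‖VFP.perp (D t)‖ ≤
                ‖VFP.perp (D 0)‖ * Real.exp (-t / (2 * τ ε))
                + τ ε / ε * (C * (τbar + 1))
                  * VFP.seqH1Norm T₀ Φ (D 0 - VFP.equilibrium T₀ Φ c₀)
                  * Real.exp (-(τ ε / ε ^ 2 * VFP.kappa C τbar * t)) ∧
              (∃ u, VFP.IsEllipticSol T₀ Φ c₀ (D t 0 - VFP.sqrtRhoInf T₀ Φ c₀) u) ∧
              VFP.hMinusOneNorm T₀ Φ c₀ (D t 0 - VFP.sqrtRhoInf T₀ Φ c₀) ≤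
                C * (VFP.hMinusOneNorm T₀ Φ c₀ (D 0 0 - VFP.sqrtRhoInf T₀ Φ c₀)
                    + τ ε / ε * (τbar ^ 3 + 1)
                      * VFP.seqH1Norm T₀ Φ (D 0 - VFP.equilibrium T₀ Φ c₀))
                  * Real.exp (-(τ ε / ε ^ 2 * VFP.kappa C τbar * t))) := by
  obtain ⟨C₁, γ, hC₁, hγ, key⟩ := VFP.IsHermiteSol.exists_decay hT₀ hΦ
  have hγ2 : 0 < 2 / γ := by positivity
  -- The summand `2 / γ` serves the exponent. The factor `3` is `3 / 2` from `τ ≤ 3 / 2 τ₀ ε²` times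
  -- `2` from `1 + r² ≤ 2 (τbar³ + 1)`.
  set C := 3 * C₁ + 2 / γ with hC
  refine ⟨C, by positivity, ?_⟩
  intro τbar ε₀ τ hτbar hε₀ hτpos hτle
  refine ⟨?_, ?_⟩
  · intro τ₀ hτ₀ _ hclose ε hε c₀ D hc₀ hD hmass hH1
    have hε0 : 0 < ε := hε.1
    have ht := hτpos ε hε
    have hr : τ ε / ε ≤ τbar := hτle ε hε
    have hr0 : 0 < τ ε / ε := by positivity
    obtain ⟨q1, q2⟩ := abs_le.1 (hclose ε hε)
    have hlo : τ₀ * ε ^ 2 ≤ 2 * τ ε := by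
      have : (1 : ℝ) / 2 ≤ τ ε / (τ₀ * ε ^ 2) := by linarith
      rw [le_div_iff₀ (by positivity)] at this
      linarith
    have hhi : τ ε ≤ 3 / 2 * (τ₀ * ε ^ 2) := by
      have : τ ε / (τ₀ * ε ^ 2) ≤ 3 / 2 := by linarith
      rwa [div_le_iff₀ (by positivity)] at this
    have hr2 : τ ε / ε ≤ 3 / 2 * (τ₀ * ε) := by
      rw [div_le_iff₀ hε0]
      linarith
    have hrate := VFP.rate_le hγ (show 2 / γ ≤ C by linarith) (q := τ ε / ε ^ 2) (T := τ₀)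
      (by positivity) hr0.le hr (by
        rw [← mul_div_assoc, le_div_iff₀ (by positivity)]
        linarith)
    have hexp : ∀ t : ℝ, 0 ≤ t → Real.exp (-(γ * (τ ε / ε ^ 2 / (1 + (τ ε / ε) ^ 2)) * t))
        ≤ Real.exp (-(τ₀ * VFP.kappa C τbar * t)) := fun t ht => by gcongr
    obtain ⟨k1, k2⟩ := key c₀ ε (τ ε) D hc₀ hε0 ht hD hmass hH1
    have hN : 0 ≤ VFP.seqH1Norm T₀ Φ (D 0 - VFP.equilibrium T₀ Φ c₀) := Real.sqrt_nonneg _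
    have hp := VFP.hermitePair_opA hT₀ hΦ hc₀
    constructor
    · intro t ht0
      refine (k1 t ht0).trans ?_
      have e1 : Real.exp (-t / (2 * τ ε)) ≤ Real.exp (-t / (4 * τ₀ * ε ^ 2)) := by
        refine Real.exp_le_exp.2 ?_
        rw [neg_div, neg_div]
        refine neg_le_neg (div_le_div_of_nonneg_left ht0 (by positivity) ?_)
        linarith [show 0 < τ₀ * ε ^ 2 by positivity]
      have e2 : C₁ * (τ ε / ε * (1 + τ ε / ε)) ≤ τ₀ * ε * (C * (τbar + 1)) := by
        calc C₁ * (τ ε / ε * (1 + τ ε / ε)) ≤ C₁ * (3 / 2 * (τ₀ * ε) * (1 + τbar)) := by gcongr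
          _ = 3 / 2 * C₁ * (τ₀ * ε * (τbar + 1)) := by ring
          _ ≤ C * (τ₀ * ε * (τbar + 1)) := by
            gcongr
            linarith
          _ = _ := by ring
      have e3 := hexp t ht0
      gcongr
    · intro Dlim hlim hlmass t ht0
      have hu := hlim.isWeakHeatSol ht hp.toIsAdjointPair hp.kernel
      have hme : τ₀ * τ ε / (τ ε / ε) ^ 2 = τ₀ * ε ^ 2 / τ ε := by field_simp
      -- In rescaled time the limit flow has diffusivity `m = τ₀ τ`; the bound amounts to `τ ≤ 2 τ₀
      -- ε²`.
      have hm : (τ ε / ε) ^ 2 / 2 ≤ τ₀ * τ ε := by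
        rw [div_pow, div_div, div_le_iff₀ (by positivity)]
        nlinarith [mul_le_mul_of_nonneg_left hhi ht.le, mul_pos ht (show 0 < τ₀ * ε ^ 2 by positivity)]
      obtain ⟨h1, h2⟩ := k2 _ _ hu hm (by
        rw [mul_zero]
        exact hlmass.inner_sub hc₀.le) t ht0
      simp only [mul_zero, mul_div_cancel₀ _ ht.ne', sub_sub_sub_cancel_right] at h1 h2
      refine ⟨h1, h2.trans ?_⟩
      rw [hme]
      have e0 : VFP.zeroth (Dlim 0) - VFP.equilibrium T₀ Φ c₀
          = VFP.zeroth (Dlim 0 - VFP.sqrtRhoInf T₀ Φ c₀) := (lp.single_sub 2 0 _ _).symm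
      rw [e0, VFP.norm_zeroth]
      have hX : 0 ≤ VFP.hMinusOneNorm T₀ Φ c₀ (D 0 0 - Dlim 0) := by
        unfold VFP.hMinusOneNorm
        split_ifs
        · exact norm_nonneg _
        · exact le_rfl
      have e2 : C₁ * (τ ε / ε * (1 + (τ ε / ε) ^ 2)) ≤ C * (ε * τ₀ * (τbar ^ 3 + 1)) := by
        have := VFP.one_add_sq_le hr0.le hr
        calc C₁ * (τ ε / ε * (1 + (τ ε / ε) ^ 2))
            ≤ C₁ * (3 / 2 * (τ₀ * ε) * (2 * (τbar ^ 3 + 1))) := by gcongr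
          _ = 3 * C₁ * (ε * τ₀ * (τbar ^ 3 + 1)) := by ring
          _ ≤ C * (ε * τ₀ * (τbar ^ 3 + 1)) := by
            gcongr
            linarith
      have e3 := hexp t ht0
      have e4 : C₁ ≤ C := by linarith
      rw [← add_mul]
      refine mul_le_mul ?_ e3 (Real.exp_pos _).le (by positivity)
      have e5 := mul_le_mul_of_nonneg_right e2 hN
      have e6 := mul_le_mul_of_nonneg_right e4 hX
      have e7 := mul_le_mul_of_nonneg_right e4 (mul_nonneg (abs_nonneg (τ₀ * ε ^ 2 / τ ε - 1))
        (norm_nonneg (Dlim 0 - VFP.sqrtRhoInf T₀ Φ c₀)))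
      linarith
  · intro _ ε hε c₀ D hc₀ hD hmass hH1 t ht0
    have hε0 : 0 < ε := hε.1
    have ht := hτpos ε hε
    have hr : τ ε / ε ≤ τbar := hτle ε hε
    have hr0 : 0 < τ ε / ε := by positivity
    have hq : 0 < τ ε / ε ^ 2 := by positivity
    have hrate := VFP.rate_le hγ (show 2 / γ ≤ C by linarith) (q := τ ε / ε ^ 2)
      (T := τ ε / ε ^ 2) hq.le hr0.le hr (by linarith)
    have hexp : Real.exp (-(γ * (τ ε / ε ^ 2 / (1 + (τ ε / ε) ^ 2)) * t))
        ≤ Real.exp (-(τ ε / ε ^ 2 * VFP.kappa C τbar * t)) := by gcongr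
    obtain ⟨k1, k2⟩ := key c₀ ε (τ ε) D hc₀ hε0 ht hD hmass hH1
    have hN : 0 ≤ VFP.seqH1Norm T₀ Φ (D 0 - VFP.equilibrium T₀ Φ c₀) := Real.sqrt_nonneg _
    constructor
    · refine (k1 t ht0).trans ?_
      have e2 : C₁ * (τ ε / ε * (1 + τ ε / ε)) ≤ τ ε / ε * (C * (τbar + 1)) := by
        calc C₁ * (τ ε / ε * (1 + τ ε / ε)) ≤ C₁ * (τ ε / ε * (1 + τbar)) := by gcongr
          _ = C₁ * (τ ε / ε * (τbar + 1)) := by ring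
          _ ≤ C * (τ ε / ε * (τbar + 1)) := by
            gcongr
            linarith
          _ = _ := by ring
      gcongr
    -- The comparison flow is zero, that is, the equilibrium itself; `m = r²` is one admissible
    -- diffusivity.
    · obtain ⟨h1, h2⟩ := k2 ((τ ε / ε) ^ 2) _ (VFP.isWeakHeatSol_zero _ _ _)
        (by linarith [sq_nonneg (τ ε / ε)]) (inner_zero_left _) t ht0
      simp only [sub_zero, norm_zero, mul_zero, add_zero] at h1 h2
      refine ⟨h1, h2.trans ?_⟩
      have hX : 0 ≤ VFP.hMinusOneNorm T₀ Φ c₀ (D 0 0 - VFP.sqrtRhoInf T₀ Φ c₀) := by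
        unfold VFP.hMinusOneNorm
        split_ifs
        · exact norm_nonneg _
        · exact le_rfl
      have e2 : C₁ * (τ ε / ε * (1 + (τ ε / ε) ^ 2)) ≤ C * (τ ε / ε * (τbar ^ 3 + 1)) := by
        have := VFP.one_add_sq_le hr0.le hr
        calc C₁ * (τ ε / ε * (1 + (τ ε / ε) ^ 2))
            ≤ C₁ * (τ ε / ε * (2 * (τbar ^ 3 + 1))) := by gcongr
          _ = 2 * C₁ * (τ ε / ε * (τbar ^ 3 + 1)) := by ring
          _ ≤ C * (τ ε / ε * (τbar ^ 3 + 1)) := by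
            gcongr
            linarith
      have e4 : C₁ ≤ C := by linarith
      refine mul_le_mul ?_ hexp (Real.exp_pos _).le (by positivity)
      have e5 := mul_le_mul_of_nonneg_right e2 hN
      have e6 := mul_le_mul_of_nonneg_right e4 hX
      linarith
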